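/- **Setting.** Let $M$ be a smooth (Hausdorff, second countable, finite-dimensional) manifold without boundary, $\mathcal F$ a regular foliation of $M$ with tangent bundle $\mathbb V=T\mathcal F$, and $\mathbb H\subset TM$ a normal bundle, $TM=\mathbb H\oplus\mathbb V$. Write $T^*M=\mathbb V^0\oplus\mathbb H^0$ for the splitting by annihilators. Let $P\in\Gamma(\wedge^2\mathbb V)$ be a leaf-tangent Poisson tensor, and let $\{\Pi_\varepsilon\}_{\varepsilon\in[0,1]}$ be an $\mathcal F$-almost-coupling Poisson deformation of $P$ via $\mathbb H$: Poisson tensors on $M$ depending smoothly on $\varepsilon$, with $\Pi_0=P$, $\Pi_\varepsilon^\sharp(\mathbb V^0)\subseteq\mathbb H$, and with component of bidegree $(0,2)$ equal to $P$ for all $\varepsilon\in[0,1]$; thus $\Pi_\varepsilon=P+\varepsilon\Lambda_\varepsilon$ with $\Lambda_\varepsilon\in\Gamma(\wedge^2\mathbb H)$. Let $G$ be a compact connected Lie group with Lie algebra $\mathfrak g$ and normalized Haar measure $dg$, acting smoothly on $M$ from the left by $\Phi$, with infinitesimal generators $a_M(q)=\frac{d}{dt}\big|_{t=0}\Phi_{\exp(ta)}(q)$.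 Assume that $a_M=P^\sharp\mu_a$ for all $a\in\mathfrak g$, for some $\mathbb R$-linear map $\mu:\mathfrak g\to\Omega^1(M)$, and let $\mu=\mu_{1,0}+\mu_{0,1}$ be its decomposition, with $\mu_{1,0}$ valued in $\mathbb V^0$ and $\mu_{0,1}$ in $\mathbb H^0$. A Dirac structure is a smooth sub-bundle $D\subset TM\oplus T^*M$ which is maximally isotropic for $\langle(X,\alpha),(Y,\beta)\rangle=\alpha(Y)+\beta(X)$ and involutive for the Courant bracket. Its presymplectic leaves are the maximal integral manifolds of $C=p_T(D)\subset TM$, with leafwise form $\omega(X,Y)=-\alpha(Y)$ for $(X,\alpha)\in D$, $Y\in C$. The action is compatible with $D$ through $\rho\in\mathrm{Hom}(\mathfrak g,\Omega^1(M))$ if it maps every leaf to itself and $(a_M,\rho_a)\in\Gamma(D)$ for all $a\in\mathfrak g$. Suppose the action preserves $C$, i.e. $d\Phi_g(C_q)\subseteq C_{\Phi_g(q)}$ for all $g$ and $q$. A $G$-average of $D$ is then a Dirac structure with the same characteristic distribution $C$ (hence the same leaves) whose leafwise form is the (convergent) average $\langle\omega\rangle^G=\int_G\Phi_g^*\omega\,dg$.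 **Theorem.** There is a measurable map $g\mapsto a(g)\in\mathfrak g$, with values in a compact set, such that $\exp a(g)=g$ for all $g\in G$. For every $\varepsilon\in[0,1]$, $D_\varepsilon=\operatorname{Graph}\Pi_\varepsilon=\{(\Pi_\varepsilon^\sharp\alpha,\alpha)\}$ is a Dirac structure, the action is compatible with $D_\varepsilon$ through $\rho=\mu_{0,1}$, and the $G$-average $\overline D_\varepsilon$ is well defined: the action preserves the characteristic distribution of $D_\varepsilon$, and $D_\varepsilon$ has exactly one $G$-average. For every map $g\mapsto a(g)$ as above, $$\Theta:=\int_G\Big(\int_0^1\Phi_{\exp(\tau a)}^*\rho_a\,d\tau\Big)dg,\qquad a=a(g),\quad \rho=\mu_{0,1},$$ is a smooth $1$-form on $M$, and $\overline D_\varepsilon$ is the exact gauge transform $$\overline D_\varepsilon=\{(X,\alpha+\mathbf i_X d\Theta)\mid (X,\alpha)\in D_\varepsilon\},$$ which is a $G$-invariant Dirac structure. -/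

import Mathlib

open scoped Manifold ContDiff

noncomputable section

namespace DiracAveraging

/-! Smooth fields on a manifold `M` without boundary, modelled on the finite-dimensional space `E`. -/

section Fields

variable (E : Type*) [NormedAddCommGroup E] [NormedSpace ℝ E]
  {M : Type*} [TopologicalSpace M] [ChartedSpace E M]

/-- The tangent space `T_q M`. -/
abbrev Tan (q : M) : Type _ := TangentSpace 𝓘(ℝ, E) q

/-- The cotangent space `T*_q M`. -/
abbrev Cot (q : M) : Type _ := TangentSpace 𝓘(ℝ, E) q →L[ℝ] ℝ

instance (q : M) : T2Space (TangentSpace 𝓘(ℝ, E) q) := inferInstanceAs (T2Space E)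

instance [FiniteDimensional ℝ E] (q : M) : FiniteDimensional ℝ (TangentSpace 𝓘(ℝ, E) q) :=
  inferInstanceAs (FiniteDimensional ℝ E)

variable (M)

/-- (Not necessarily smooth) vector fields. -/
abbrev VField : Type _ := ∀ q : M, Tan E q

/-- (Not necessarily smooth) differential 1-forms. -/
abbrev OneForm : Type _ := ∀ q : M, Cot E q

/-- (Not necessarily smooth) contravariant 2-tensor fields `Π`, given by the induced bundle maps
`Π^♯ : T*M → TM`, where `β (Π^♯ α) = Π(α, β)`. -/
abbrev TwoTensor : Type _ := ∀ q : M, Cot E q →ₗ[ℝ] Tan E q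

/-- (Not necessarily smooth or regular) distributions in `TM`. -/
abbrev Distribution : Type _ := ∀ q : M, Submodule ℝ (Tan E q)

/-- Families of subspaces of the fibres of the generalized tangent bundle `TM ⊕ T*M`. -/
abbrev GenDistribution : Type _ := ∀ q : M, Submodule ℝ (Tan E q × Cot E q)

variable {M} {E}

section Smooth

variable [IsManifold 𝓘(ℝ, E) ∞ M]

/-- Smoothness of a vector field, as a section of the tangent bundle. -/
def SmoothVField (X : VField E M) : Prop :=
  ContMDiff 𝓘(ℝ, E) 𝓘(ℝ, E).tangent ∞ (fun q => (⟨q, X q⟩ : TangentBundle 𝓘(ℝ, E) M))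

/-- Smoothness of a 1-form, as a section of the cotangent bundle. -/
def SmoothOneForm (α : OneForm E M) : Prop :=
  ContMDiff 𝓘(ℝ, E) (𝓘(ℝ, E).prod 𝓘(ℝ, E →L[ℝ] ℝ)) ∞
    (fun q => Bundle.TotalSpace.mk' (E →L[ℝ] ℝ)
      (E := fun q : M => TangentSpace 𝓘(ℝ, E) q →L[ℝ] Bundle.Trivial M ℝ q) q (α q))

/-- A smooth bivector field: `Π` is skew-symmetric and `Π^♯` maps smooth 1-forms to smooth vector
fields. -/
structure IsBivectorField (P : TwoTensor E M) : Prop where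
  skew : ∀ (q : M) (α β : Cot E q), β (P q α) = - α (P q β)
  smooth : ∀ α : OneForm E M, SmoothOneForm α → SmoothVField (fun q => P q (α q))

/-- A smooth family `Π_ε`, `ε ∈ [0, 1]`, of 2-tensor fields: jointly smooth on `[0, 1] × M`. -/
def SmoothFamily (P : ℝ → TwoTensor E M) : Prop :=
  ∀ α : OneForm E M, SmoothOneForm α →
    ContMDiffOn (𝓘(ℝ, ℝ).prod 𝓘(ℝ, E)) 𝓘(ℝ, E).tangent ∞
      (fun p : ℝ × M => (⟨p.2, P p.1 p.2 (α p.2)⟩ : TangentBundle 𝓘(ℝ, E) M))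
      (Set.Icc (0 : ℝ) 1 ×ˢ Set.univ)

/-- A smooth (regular) distribution, that is, a smooth sub-bundle of `TM`: the rank is locally
constant and every vector of the distribution extends to a smooth section. -/
structure IsSubbundle (V : Distribution E M) : Prop where
  rank : IsLocallyConstant (fun q : M => Module.finrank ℝ (V q))
  smooth : ∀ (q : M), ∀ v ∈ V q, ∃ X : VField E M, SmoothVField X ∧ (∀ p, X p ∈ V p) ∧ X q = v

/-- The tangent bundle `V = TF` of a regular foliation `F` (in the form given by the Frobenius
theorem): a smooth sub-bundle of `TM` closed under the Lie bracket. -/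
structure IsFoliation (V : Distribution E M) : Prop extends IsSubbundle V where
  involutive : ∀ X Y : VField E M, SmoothVField X → SmoothVField Y →
    (∀ q, X q ∈ V q) → (∀ q, Y q ∈ V q) → ∀ q, VectorField.mlieBracket 𝓘(ℝ, E) X Y q ∈ V q

end Smooth

/-- A normal bundle of the foliation with tangent bundle `V`: a sub-bundle `H` with
`TM = H ⊕ V`. -/
structure IsNormalBundle [IsManifold 𝓘(ℝ, E) ∞ M] (V H : Distribution E M) : Prop
    extends IsSubbundle H where
  isCompl : ∀ q, IsCompl (V q) (H q)

/-- The annihilator of a distribution at a point. -/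
def annihilator (V : Distribution E M) (q : M) : Set (Cot E q) := {α | ∀ v ∈ V q, α v = 0}

/-- The differential of a function. -/
def dfun (f : M → ℝ) : OneForm E M := fun q => mfderiv 𝓘(ℝ, E) 𝓘(ℝ, ℝ) f q

/-- The Poisson bracket `{f, g} = Π(df, dg)`. -/
def pbracket (P : TwoTensor E M) (f g : M → ℝ) : M → ℝ :=
  fun q => dfun (E := E) g q (P q (dfun f q))

/-- A Poisson tensor: a smooth bivector field whose bracket satisfies the Jacobi identity. -/
structure IsPoisson [IsManifold 𝓘(ℝ, E) ∞ M] (P : TwoTensor E M) : Prop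
    extends IsBivectorField P where
  jacobi : ∀ f g h : M → ℝ, ContMDiff 𝓘(ℝ, E) 𝓘(ℝ, ℝ) ∞ f → ContMDiff 𝓘(ℝ, E) 𝓘(ℝ, ℝ) ∞ g →
    ContMDiff 𝓘(ℝ, E) 𝓘(ℝ, ℝ) ∞ h → ∀ q : M,
      pbracket P f (pbracket P g h) q + pbracket P g (pbracket P h f) q
        + pbracket P h (pbracket P f g) q = 0

/-- The local expression at `y ∈ E` of a 1-form in the preferred chart at `q`, that is, the value
at `y` of its pull-back by the inverse of that chart. -/
def localExpr (α : OneForm E M) (q : M) (y : E) : E →L[ℝ] ℝ :=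
  (α ((extChartAt 𝓘(ℝ, E) q).symm y)).comp
    (mfderiv 𝓘(ℝ, E) 𝓘(ℝ, E) (extChartAt 𝓘(ℝ, E) q).symm y)

/-- The exterior derivative of a 1-form at `q`: in a chart,
`dα(X, Y) = (D_X α)(Y) - (D_Y α)(X)`. -/
def extd (α : OneForm E M) (q : M) : Tan E q →L[ℝ] Cot E q :=
  letI φ := extChartAt 𝓘(ℝ, E) q
  letI A : Tan E q →L[ℝ] E := mfderiv 𝓘(ℝ, E) 𝓘(ℝ, E) φ q
  letI B : E →L[ℝ] E →L[ℝ] ℝ := fderiv ℝ (localExpr α q) (φ q)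
  (ContinuousLinearMap.precomp ℝ A).comp ((B - B.flip).comp A)

/-! Dirac structures. -/

section Dirac

/-- `(X, α)` is a smooth section of `D ⊆ TM ⊕ T*M`. -/
structure IsSection [IsManifold 𝓘(ℝ, E) ∞ M] (D : GenDistribution E M) (X : VField E M)
    (α : OneForm E M) : Prop where
  smooth_fst : SmoothVField X
  smooth_snd : SmoothOneForm α
  mem : ∀ q, (X q, α q) ∈ D q

/-- The 1-form component of the Courant bracket,
`L_X β - L_Y α + (1/2) d(α(Y) - β(X)) = i_X dβ - i_Y dα + (1/2) d(β(X) - α(Y))`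
(Cartan's formula `L_X = i_X d + d i_X` has been used). The vector component is `[X, Y]`. -/
def courantForm (X : VField E M) (α : OneForm E M) (Y : VField E M) (β : OneForm E M) :
    OneForm E M :=
  fun q => extd β q (X q) - extd α q (Y q)
    + (1 / 2 : ℝ) • dfun (fun p => β p (X p) - α p (Y p)) q

/-- Dirac structures on `M`: smooth sub-bundles `D` of `TM ⊕ T*M` that are maximally isotropic for
the pairing `⟨(X, α), (Y, β)⟩ = α(Y) + β(X)`, i.e. equal to their own orthogonal (so that the rank
is constantly `dim M`), and involutive for the Courant bracket. -/
structure IsDirac [IsManifold 𝓘(ℝ, E) ∞ M] (D : GenDistribution E M) : Prop where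
  smooth : ∀ q, ∀ e ∈ D q, ∃ (X : VField E M) (α : OneForm E M),
    IsSection D X α ∧ (X q, α q) = e
  lagrangian : ∀ (q : M) (X : Tan E q) (α : Cot E q),
    (X, α) ∈ D q ↔ ∀ (Y : Tan E q) (β : Cot E q), (Y, β) ∈ D q → α Y + β X = 0
  involutive : ∀ (X : VField E M) (α : OneForm E M) (Y : VField E M) (β : OneForm E M),
    IsSection D X α → IsSection D Y β →
      IsSection D (VectorField.mlieBracket 𝓘(ℝ, E) X Y) (courantForm X α Y β)

/-- `Graph Π = {(Π^♯ α, α)}`. -/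
def graph (P : TwoTensor E M) : GenDistribution E M :=
  fun q => LinearMap.range ((P q).prod LinearMap.id)

/-- The exact gauge transform `{(X, α + i_X dΘ) | (X, α) ∈ D}`. -/
def exactGauge (D : GenDistribution E M) (Θ : OneForm E M) : GenDistribution E M :=
  fun q => (D q).map
    ((LinearMap.fst ℝ (Tan E q) (Cot E q)).prod
      (LinearMap.snd ℝ (Tan E q) (Cot E q) +
        (extd Θ q : Tan E q →ₗ[ℝ] Cot E q) ∘ₗ LinearMap.fst ℝ (Tan E q) (Cot E q)))

/-- The characteristic distribution `C = p_T(D)`, tangent to the presymplectic leaves of `D`. -/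
def charDist (D : GenDistribution E M) : Distribution E M :=
  fun q => (D q).map (LinearMap.fst ℝ (Tan E q) (Cot E q))

/-- The presymplectic leaves of `D`, i.e. the maximal integral manifolds of `C = p_T(D)`. As in the
Stefan-Sussmann theorem, these are the orbits of the family of vector fields `p_T(Γ(D))`: two
points are on the same leaf when they are joined by finitely many integral curves of such fields. -/
def SameLeaf [IsManifold 𝓘(ℝ, E) ∞ M] (D : GenDistribution E M) : M → M → Prop :=
  Relation.EqvGen (fun p q => ∃ (X : VField E M) (α : OneForm E M) (γ : ℝ → M) (s t : ℝ), s ≤ t ∧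
    IsSection D X α ∧ IsMIntegralCurveOn γ X (Set.Icc s t) ∧ γ s = p ∧ γ t = q)

open Classical in
/-- The leafwise presymplectic form `ω_q(X, Y) = -α(Y)` for `(X, α) ∈ D_q` and `Y ∈ C_q`; for a Dirac
structure it does not depend on `α`. (It is only used for `X, Y ∈ C_q`.) -/
def leafForm (D : GenDistribution E M) (q : M) (X Y : Tan E q) : ℝ :=
  if h : ∃ α : Cot E q, (X, α) ∈ D q then - (h.choose Y) else 0

end Dirac

end Fields

/-! Lie group actions and averages. -/

section Action

variable {F : Type*} [NormedAddCommGroup F] [NormedSpace ℝ F]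
  {G : Type*} [TopologicalSpace G] [ChartedSpace F G] [Group G]
  {E : Type*} [NormedAddCommGroup E] [NormedSpace ℝ E]
  {M : Type*} [TopologicalSpace M] [ChartedSpace E M] [MulAction G M]

/-- `γ` is the smooth one-parameter subgroup of `G` with initial velocity `a`. -/
structure IsOneParameterSubgroup (a : GroupLieAlgebra 𝓘(ℝ, F) G) (γ : ℝ → G) : Prop where
  smooth : ContMDiff 𝓘(ℝ, ℝ) 𝓘(ℝ, F) ∞ γ
  map_add : ∀ s t : ℝ, γ (s + t) = γ s * γ t
  map_zero : γ 0 = 1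
  velocity : HasMFDerivAt 𝓘(ℝ, ℝ) 𝓘(ℝ, F) γ 0 ((1 : ℝ →L[ℝ] ℝ).smulRight a)

open Classical in
/-- The exponential map `exp : 𝔤 → G`, `exp a = γ(1)` with `γ` the one-parameter subgroup with
initial velocity `a` (which exists and is unique in a Lie group). -/
def lieExp (a : GroupLieAlgebra 𝓘(ℝ, F) G) : G :=
  if h : ∃ γ : ℝ → G, IsOneParameterSubgroup a γ then h.choose 1 else 1

variable (E M) in
/-- The infinitesimal generator `a_M(q) = d/dt|_{t = 0} Φ_{exp(ta)}(q)`. -/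
def infGen (a : GroupLieAlgebra 𝓘(ℝ, F) G) : VField E M :=
  fun q => (mfderiv 𝓘(ℝ, ℝ) 𝓘(ℝ, E) (fun t : ℝ => lieExp (t • a) • q) 0 (1 : ℝ) : E)

variable (E) in
/-- The tangent map `d_q Φ_g : T_q M → T_{gq} M`. -/
def dact (g : G) (q : M) : Tan E q →L[ℝ] Tan E (g • q) :=
  mfderiv 𝓘(ℝ, E) 𝓘(ℝ, E) (fun p : M => g • p) q

/-- The pull-back `Φ_g^* α`. -/
def pullAct (g : G) (α : OneForm E M) : OneForm E M := fun q => (α (g • q)).comp (dact E g q)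

/-- The `G`-action is compatible with `D` through `ρ ∈ Hom(𝔤, Ω¹(M))`: the leaves of `D` are
`G`-invariant, and `(a_M, ρ_a)` is a smooth section of `D` (equivalently
`i_{a_M} ω_S = - ι_S^* ρ_a` on all leaves) for all `a`. -/
structure IsCompatible [IsManifold 𝓘(ℝ, E) ∞ M] (D : GenDistribution E M)
    (ρ : GroupLieAlgebra 𝓘(ℝ, F) G →ₗ[ℝ] OneForm E M) : Prop where
  leaf : ∀ (g : G) (q : M), SameLeaf D q (g • q)
  isSection : ∀ a : GroupLieAlgebra 𝓘(ℝ, F) G, IsSection D (infGen E M a) (ρ a)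

variable (G) in
/-- `D` is `G`-invariant: `(X, α)` belongs to `D` if and only if `(dΦ_g X, α ∘ (dΦ_g)⁻¹)` does. -/
def IsInvariant (D : GenDistribution E M) : Prop :=
  ∀ (g : G) (q : M) (X : Tan E q) (α : Cot E (g • q)),
    (X, α.comp (dact E g q)) ∈ D q ↔ (dact E g q X, α) ∈ D (g • q)

/-- `D'` is the `G`-average of `D` (`ν` is the normalized Haar measure): `D'` is a Dirac structure
with the same characteristic distribution (hence the same leaves) as `D`, whose leafwise
presymplectic form is the average `⟨ω⟩^G = ∫_G Φ_g^* ω dg` of the one of `D`. The characteristic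
distribution has to be preserved by the action, and the integrals have to converge. -/
structure IsAverage [MeasurableSpace G] (ν : MeasureTheory.Measure G) [IsManifold 𝓘(ℝ, E) ∞ M]
    (D D' : GenDistribution E M) : Prop where
  isDirac : IsDirac D'
  charDist_eq : charDist D' = charDist D
  charDist_map : ∀ (g : G) (q : M), ∀ X ∈ charDist D q, dact E g q X ∈ charDist D (g • q)
  integrable : ∀ q : M, ∀ X ∈ charDist D q, ∀ Y ∈ charDist D q,
    MeasureTheory.Integrable (fun g => leafForm D (g • q) (dact E g q X) (dact E g q Y)) ν
  leafForm_eq : ∀ q : M, ∀ X ∈ charDist D q, ∀ Y ∈ charDist D q,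
    leafForm D' q X Y = ∫ g, leafForm D (g • q) (dact E g q X) (dact E g q Y) ∂ν

/-- An admissible choice of `a` in `g = exp a`: a measurable section `g ↦ a = log g` of the
exponential map with values in a compact subset of `𝔤`. -/
structure IsLogarithm [MeasurableSpace G] (ν : MeasureTheory.Measure G)
    (log : G → GroupLieAlgebra 𝓘(ℝ, F) G) : Prop where
  measurable : MeasureTheory.AEStronglyMeasurable log ν
  bounded : ∃ K : Set (GroupLieAlgebra 𝓘(ℝ, F) G), IsCompact K ∧ ∀ g, log g ∈ K
  exp_log : ∀ g : G, lieExp (log g) = g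

/-- The averaged 1-form
`Θ = ∫_G (∫_0^1 Φ_{exp(τa)}^* ρ_a dτ) dg`, `g = exp a`, with `a = log g`. -/
def averagedForm [MeasurableSpace G] (ν : MeasureTheory.Measure G)
    (log : G → GroupLieAlgebra 𝓘(ℝ, F) G) (ρ : GroupLieAlgebra 𝓘(ℝ, F) G →ₗ[ℝ] OneForm E M) :
    OneForm E M :=
  fun q => (∫ g : G, (∫ τ in (0 : ℝ)..1,
    (pullAct (lieExp (τ • log g)) (ρ (log g)) q : E →L[ℝ] ℝ)) ∂ν : E →L[ℝ] ℝ)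

/-- The component `μ_{0,1}`, with values in `H⁰`, of `μ = μ_{1,0} + μ_{0,1}` relative to
`T*M = V⁰ ⊕ H⁰`: the composition of `μ` with the projection `TM → V` along `H`. -/
def comp01 [FiniteDimensional ℝ E] {V H : Distribution E M} (h : ∀ q, IsCompl (V q) (H q))
    (μ : GroupLieAlgebra 𝓘(ℝ, F) G →ₗ[ℝ] OneForm E M) :
    GroupLieAlgebra 𝓘(ℝ, F) G →ₗ[ℝ] OneForm E M where
  toFun a := fun q =>
    (μ a q).comp (LinearMap.toContinuousLinearMap ((V q).projection (H q) (h q)))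
  map_add' a b := by
    funext q
    ext v
    simp
  map_smul' c a := by
    funext q
    ext v
    simp

end Action

section Deformation

variable {E : Type*} [NormedAddCommGroup E] [NormedSpace ℝ E]
  {M : Type*} [TopologicalSpace M] [ChartedSpace E M] [IsManifold 𝓘(ℝ, E) ∞ M]

/-- A leaf-tangent Poisson structure: a Poisson tensor `P ∈ Γ(∧² V)`. -/
structure IsLeafTangentPoisson (V : Distribution E M) (P : TwoTensor E M) : Prop
    extends IsPoisson P where
  leafTangent : ∀ (q : M) (α : Cot E q), P q α ∈ V q

/-- An `F`-almost-coupling Poisson deformation `Π_ε`, `ε ∈ [0, 1]`, of `P` via the normal bundle `H`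
of the foliation with tangent bundle `V`: a smooth family of Poisson tensors with `Π_0 = P`,
`Π_ε^♯(V⁰) ⊆ H`, and `(0, 2)`-component `(Π_ε)_{0,2} = P`. Then the `(1, 1)`-component vanishes, and
`Π_ε = P + (Π_ε)_{2,0} = P + ε Λ_ε` with bivector fields `Λ_ε ∈ Γ(∧² H)` depending smoothly on `ε`. -/
structure IsAlmostCouplingDeformation (V H : Distribution E M) (P : TwoTensor E M)
    (Pi : ℝ → TwoTensor E M) : Prop where
  isPoisson : ∀ ε ∈ Set.Icc (0 : ℝ) 1, IsPoisson (Pi ε)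
  smooth : SmoothFamily Pi
  zero : Pi 0 = P
  almostCoupling : ∀ ε ∈ Set.Icc (0 : ℝ) 1, ∀ q : M, ∀ α ∈ annihilator V q, Pi ε q α ∈ H q
  vertical : ∀ ε ∈ Set.Icc (0 : ℝ) 1, ∀ q : M, ∀ α ∈ annihilator H q, ∀ β ∈ annihilator H q,
    β (Pi ε q α) = β (P q α)

end Deformation

end DiracAveraging

end

/-!
# Averaging the graphs of an almost-coupling Poisson deformation

**Compatibility.** The graph of a Poisson tensor is a Dirac structure
(`IsPoisson.isDirac_graph`), exact gauge transformations preserve Dirac structures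
(`IsDirac.exactGauge`), and a Dirac structure is determined by its characteristic distribution and
its leafwise form (`IsDirac.mem_iff`, `IsDirac.ext`). In particular averages are unique
(`IsAverage.eq`), and their invariance under the action is the right-invariance of the Haar measure
(`IsAverage.isInvariant`). The almost-coupling condition gives `Π_ε^♯ μ_{0,1} = P^♯ μ`
(`IsAlmostCouplingDeformation.apply_projForm`): with `ρ = μ_{0,1}`, the infinitesimal generators
are `a_M = Π_ε^♯ ρ_a`, for all `ε` at once. Thus they are sections of the graph of `Π = Π_ε`, and
their integral curves, which are the orbits of the one-parameter subgroups, stay in its leaves.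

**Change of the leafwise form.** Let `Q_t` be the pull-back of `Π` by the action of `exp (t a)`.
By the Jacobi identity, the derivative of `Q_t` is `- Q_t b_t Q_t`, where `b_t` is the exterior
derivative of `Φ_{exp(ta)}^* ρ_a` (`hasDerivAt_pullTens`). This Riccati equation has the solution
`Q_1 (α + B Π α) = Π α`, where `B` is the integral of `b` over the unit interval
(`riccati_solution`). Hence the action preserves the characteristic distribution, and changes the
leafwise form by `- B` (`leafForm_graph_smul`). No flow on the leaves and no regularity of the
characteristic distribution is needed. Integrating over the group with `a = a(g)`, and
differentiating under the integral sign (`extdE_averagedForm`), one finds that the average of the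
leafwise form is the leafwise form of the gauge transform by `dΘ` (`isAverage_exactGauge`).

**Bounded measurable logarithms.** The exponential map is constructed from the integral curves of
left-invariant vector fields (`exists_isOneParameterSubgroup`). That it maps some ball onto a compact
connected group (`exists_expE_surjOn`) is proved without an invariant metric. Let `ψ` be a smooth
map to a Euclidean space that vanishes exactly at the identity and is immersive there. The energy
`h ↦ ∫ ‖ψ (k⁻¹ h k)‖² dk` is conjugation-invariant, vanishes exactly at the identity, and has a
nondegenerate Hessian there. The energy of a discrete path is the sum of the energies of its steps.
Every element `g` is the endpoint of a path from the identity of small energy, with a number `n`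
of steps which does not depend on `g`. For a path of minimal energy among those to `g` with `n`
steps, consecutive steps have the same differential of the energy, hence coincide, so that `g` is
the `n`-th power of an element near the identity. A Borel section of the restriction of the
exponential map to a ball (`exists_measurable_section`) is the required logarithm.

Tangent spaces of a manifold modelled on `E` are copies of `E`. The values of fields, forms, tensors
and tangent maps are often taken in `E` itself (`vecE`, `covE`, `tensE`, `tmap`), where the
calculus of normed spaces applies.
-/

open scoped Topology

set_option linter.unusedSectionVars false
set_option maxSynthPendingDepth 3

noncomputable section

namespace DiracAveraging

/-! ### Fields in preferred charts -/

section Coordinates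

variable {E : Type*} [NormedAddCommGroup E] [NormedSpace ℝ E]
  {M : Type*} [TopologicalSpace M] [ChartedSpace E M]

/-- The differential at `p` of the preferred chart at `q`, as an endomorphism of the model space. -/
def chartD (E : Type*) [NormedAddCommGroup E] [NormedSpace ℝ E]
    {M : Type*} [TopologicalSpace M] [ChartedSpace E M] (q p : M) : E →L[ℝ] E := mfderiv 𝓘(ℝ, E) 𝓘(ℝ, E) (extChartAt 𝓘(ℝ, E) q) p

/-- The differential at `y` of the inverse of the preferred chart at `q`. -/
def chartDs (q : M) (y : E) : E →L[ℝ] E :=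
  mfderiv 𝓘(ℝ, E) 𝓘(ℝ, E) (extChartAt 𝓘(ℝ, E) q).symm y

/-- The local expression of a vector field in the preferred chart at `q`. -/
def vecLoc (X : VField E M) (q : M) (y : E) : E :=
  chartD E q ((extChartAt 𝓘(ℝ, E) q).symm y) (X ((extChartAt 𝓘(ℝ, E) q).symm y))

variable [IsManifold 𝓘(ℝ, E) ∞ M]

instance isManifold_one_of_infty : IsManifold 𝓘(ℝ, E) 1 M :=
  IsManifold.of_le (n := ∞) (by simp)

lemma chartDs_chartD {q p : M} (hp : p ∈ (extChartAt 𝓘(ℝ, E) q).source) (v : E) :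
    chartDs q (extChartAt 𝓘(ℝ, E) q p) (chartD E q p v) = v := by
  have := mfderivWithin_extChartAt_symm_comp_mfderiv_extChartAt' (I := 𝓘(ℝ, E)) hp
  simp only [modelWithCornersSelf_coe, Set.range_id, mfderivWithin_univ] at this
  exact DFunLike.congr_fun this v

lemma chartD_chartDs {q p : M} (hp : p ∈ (extChartAt 𝓘(ℝ, E) q).source) (v : E) :
    chartD E q p (chartDs q (extChartAt 𝓘(ℝ, E) q p) v) = v := by
  have := mfderiv_extChartAt_comp_mfderivWithin_extChartAt_symm' (I := 𝓘(ℝ, E)) hp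
  simp only [modelWithCornersSelf_coe, Set.range_id, mfderivWithin_univ] at this
  exact DFunLike.congr_fun this v

lemma contMDiffAt_chart {q p : M} (hp : p ∈ (extChartAt 𝓘(ℝ, E) q).source) :
    ContMDiffAt 𝓘(ℝ, E) 𝓘(ℝ, E) ∞ (extChartAt 𝓘(ℝ, E) q) p :=
  contMDiffAt_extChartAt' (by simpa using hp)

lemma contMDiffAt_chart_symm {q : M} {y : E} (hy : y ∈ (extChartAt 𝓘(ℝ, E) q).target) :
    ContMDiffAt 𝓘(ℝ, E) 𝓘(ℝ, E) ∞ (extChartAt 𝓘(ℝ, E) q).symm y :=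
  (contMDiffOn_extChartAt_symm q).contMDiffAt ((isOpen_extChartAt_target q).mem_nhds hy)

lemma contDiffAt_congr_nhds {V W : Type*} [NormedAddCommGroup V] [NormedSpace ℝ V]
    [NormedAddCommGroup W] [NormedSpace ℝ W] {f g : V → W} {x : V} (h : f =ᶠ[𝓝 x] g) :
    ContDiffAt ℝ ∞ f x ↔ ContDiffAt ℝ ∞ g x :=
  ⟨fun hf => hf.congr_of_eventuallyEq h.symm, fun hg => hg.congr_of_eventuallyEq h⟩

lemma contMDiffAt_iff_contDiffAt_chart {W : Type*} [NormedAddCommGroup W] [NormedSpace ℝ W]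
    {q p : M} (hp : p ∈ (extChartAt 𝓘(ℝ, E) q).source) {f : M → W} :
    ContMDiffAt 𝓘(ℝ, E) 𝓘(ℝ, W) ∞ f p ↔
      ContDiffAt ℝ ∞ (fun y => f ((extChartAt 𝓘(ℝ, E) q).symm y)) (extChartAt 𝓘(ℝ, E) q p) := by
  rw [← contMDiffAt_iff_contDiffAt]
  constructor
  · intro h
    refine ContMDiffAt.comp _ (g := f) ?_
      (contMDiffAt_chart_symm ((extChartAt 𝓘(ℝ, E) q).map_source hp))
    rwa [(extChartAt 𝓘(ℝ, E) q).left_inv hp]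
  · intro h
    have := ContMDiffAt.comp p h (contMDiffAt_chart hp)
    refine this.congr_of_eventuallyEq ?_
    filter_upwards [(isOpen_extChartAt_source q).mem_nhds hp] with x hx
    rw [Function.comp_apply, (extChartAt 𝓘(ℝ, E) q).left_inv hx]

/-- A section of the tangent bundle is smooth at a point exactly when its local expression in any
preferred chart around that point is: the trivialization of the bundle is the differential of the
chart. -/
lemma contMDiffAt_vfield_iff {X : VField E M} {q p : M}
    (hp : p ∈ (extChartAt 𝓘(ℝ, E) q).source) :
    ContMDiffAt 𝓘(ℝ, E) 𝓘(ℝ, E).tangent ∞ (fun q => (⟨q, X q⟩ : TangentBundle 𝓘(ℝ, E) M)) p ↔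
      ContDiffAt ℝ ∞ (vecLoc X q) (extChartAt 𝓘(ℝ, E) q p) := by
  have h1 := (trivializationAt E (TangentSpace 𝓘(ℝ, E)) q).contMDiffAt_section_iff
    (IB := 𝓘(ℝ, E)) (n := ∞) (s := X) (x₀ := p) (by simpa using hp)
  refine h1.trans ?_
  rw [contMDiffAt_iff_contDiffAt_chart hp]
  apply contDiffAt_congr_nhds
  filter_upwards [(isOpen_extChartAt_target q).mem_nhds ((extChartAt 𝓘(ℝ, E) q).map_source hp)] with y hy
  have hs : (extChartAt 𝓘(ℝ, E) q).symm y ∈ (chartAt E q).source := by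
    simpa using (extChartAt 𝓘(ℝ, E) q).map_target hy
  have h2 := DFunLike.congr_fun (TangentBundle.continuousLinearMapAt_trivializationAt
    (I := 𝓘(ℝ, E)) hs) (X ((extChartAt 𝓘(ℝ, E) q).symm y))
  rw [Bundle.Trivialization.continuousLinearMapAt_apply, Bundle.Trivialization.linearMapAt_apply,
    if_pos (by simpa using hs)] at h2
  exact h2

/-- A section of the cotangent bundle is smooth at a point exactly when its local expression in
any preferred chart around that point is. -/
lemma contMDiffAt_oneForm_iff {α : OneForm E M} {q p : M}
    (hp : p ∈ (extChartAt 𝓘(ℝ, E) q).source) :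
    ContMDiffAt 𝓘(ℝ, E) (𝓘(ℝ, E).prod 𝓘(ℝ, E →L[ℝ] ℝ)) ∞
    (fun q => Bundle.TotalSpace.mk' (E →L[ℝ] ℝ)
      (E := fun q : M => TangentSpace 𝓘(ℝ, E) q →L[ℝ] Bundle.Trivial M ℝ q) q (α q)) p ↔
      ContDiffAt ℝ ∞ (localExpr α q) (extChartAt 𝓘(ℝ, E) q p) := by
  have h1 := (trivializationAt (E →L[ℝ] ℝ)
    (fun q : M => TangentSpace 𝓘(ℝ, E) q →L[ℝ] Bundle.Trivial M ℝ q) q).contMDiffAt_section_iff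
    (IB := 𝓘(ℝ, E)) (n := ∞) (s := α) (x₀ := p) (by simpa using hp)
  refine h1.trans ?_
  rw [contMDiffAt_iff_contDiffAt_chart hp]
  apply contDiffAt_congr_nhds
  filter_upwards [(isOpen_extChartAt_target q).mem_nhds ((extChartAt 𝓘(ℝ, E) q).map_source hp)] with y hy
  have hs : (extChartAt 𝓘(ℝ, E) q).symm y ∈ (chartAt E q).source := by
    simpa using (extChartAt 𝓘(ℝ, E) q).map_target hy
  rw [hom_trivializationAt_apply]
  ext v
  have h2 := TangentBundle.symmL_trivializationAt (I := 𝓘(ℝ, E)) hs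
  simp only [modelWithCornersSelf_coe, Set.range_id, mfderivWithin_univ] at h2
  rw [(extChartAt 𝓘(ℝ, E) q).right_inv hy] at h2
  have h3 : (Bundle.Trivialization.symmL ℝ (trivializationAt E (TangentSpace 𝓘(ℝ, E)) q)
      ((extChartAt 𝓘(ℝ, E) q).symm y)) v =
      mfderiv 𝓘(ℝ, E) 𝓘(ℝ, E) (extChartAt 𝓘(ℝ, E) q).symm y v := DFunLike.congr_fun h2 v
  refine Eq.trans ?_ (congrArg (α ((extChartAt 𝓘(ℝ, E) q).symm y)) h3)
  change (Bundle.Trivialization.continuousLinearMapAt ℝ (trivializationAt ℝ (Bundle.Trivial M ℝ) q)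
    ((extChartAt 𝓘(ℝ, E) q).symm y)) _ = _
  rw [Bundle.Trivialization.continuousLinearMapAt_apply, Bundle.Trivialization.linearMapAt_apply,
    if_pos (by simp)]
  rfl

lemma smoothVField_iff {X : VField E M} :
    SmoothVField X ↔
      ∀ q p : M, p ∈ (extChartAt 𝓘(ℝ, E) q).source →
        ContDiffAt ℝ ∞ (vecLoc X q) (extChartAt 𝓘(ℝ, E) q p) :=
  ⟨fun h _ p hp => (contMDiffAt_vfield_iff hp).1 (h p),
    fun h p => (contMDiffAt_vfield_iff (mem_extChartAt_source p)).2
      (h p p (mem_extChartAt_source p))⟩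

lemma smoothOneForm_iff {α : OneForm E M} :
    SmoothOneForm α ↔
      ∀ q p : M, p ∈ (extChartAt 𝓘(ℝ, E) q).source →
        ContDiffAt ℝ ∞ (localExpr α q) (extChartAt 𝓘(ℝ, E) q p) :=
  ⟨fun h _ p hp => (contMDiffAt_oneForm_iff hp).1 (h p),
    fun h p => (contMDiffAt_oneForm_iff (mem_extChartAt_source p)).2
      (h p p (mem_extChartAt_source p))⟩

end Coordinates

/-! ### Exterior derivative, pull-backs and Lie brackets in charts -/

section VectorSpace

variable {E : Type*} [NormedAddCommGroup E] [NormedSpace ℝ E]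
  {E' : Type*} [NormedAddCommGroup E'] [NormedSpace ℝ E']

/-- The exterior derivative of a 1-form on a normed space:
`da(X, Y) = (D_X a)(Y) - (D_Y a)(X)`. -/
def extdVec (a : E → E →L[ℝ] ℝ) (y X Y : E) : ℝ := fderiv ℝ a y X Y - fderiv ℝ a y Y X

lemma extdVec_congr {a b : E → E →L[ℝ] ℝ} {y : E} (h : a =ᶠ[𝓝 y] b) (X Y : E) :
    extdVec a y X Y = extdVec b y X Y := by
  simp only [extdVec, h.fderiv_eq]

/-- Naturality of the exterior derivative on normed spaces: the terms with the second derivative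
of `u` cancel by symmetry. -/
lemma extdVec_pullback {a : E' → E' →L[ℝ] ℝ} {u : E → E'} {y : E} (hu : ContDiffAt ℝ ∞ u y)
    (ha : DifferentiableAt ℝ a (u y)) (X Y : E) :
    extdVec (fun z => (a (u z)).comp (fderiv ℝ u z)) y X Y
      = extdVec a (u y) (fderiv ℝ u y X) (fderiv ℝ u y Y) := by
  have hu1 : DifferentiableAt ℝ u y := hu.differentiableAt (by simp)
  have hu2 : DifferentiableAt ℝ (fderiv ℝ u) y :=
    (hu.fderiv_right (m := ∞) (by simp)).differentiableAt (by simp)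
  have hs : IsSymmSndFDerivAt ℝ u y := hu.isSymmSndFDerivAt (by simpa using WithTop.coe_le_coe.2 (le_top (a := (2 : ℕ∞))))
  have h := ((ha.hasFDerivAt.comp y hu1.hasFDerivAt).clm_comp hu2.hasFDerivAt).fderiv
  have h' : fderiv ℝ (fun z => (a (u z)).comp (fderiv ℝ u z)) y = _ := h
  simp only [extdVec, h']
  simp [hs.eq X Y]

end VectorSpace

section Coordinates

variable {E : Type*} [NormedAddCommGroup E] [NormedSpace ℝ E]
  {M : Type*} [TopologicalSpace M] [ChartedSpace E M] [IsManifold 𝓘(ℝ, E) ∞ M]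

lemma localExpr_apply (α : OneForm E M) (q : M) (y v : E) :
    localExpr α q y v = α ((extChartAt 𝓘(ℝ, E) q).symm y) (chartDs q y v) := rfl

/-- The value of a 1-form, as a functional on the model space. -/
def covE (α : OneForm E M) (p : M) : E →L[ℝ] ℝ := α p

/-- The value of the exterior derivative, as a bilinear form on the model space. -/
def extdE (α : OneForm E M) (p : M) : E →L[ℝ] E →L[ℝ] ℝ := extd α p

lemma oneForm_eq_localExpr (α : OneForm E M) {q p : M} (hp : p ∈ (extChartAt 𝓘(ℝ, E) q).source)
    (v : E) : covE α p v = localExpr α q (extChartAt 𝓘(ℝ, E) q p) (chartD E q p v) := by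
  rw [localExpr_apply, (extChartAt 𝓘(ℝ, E) q).left_inv hp, chartDs_chartD hp]
  rfl

lemma vecLoc_chart (X : VField E M) {q p : M} (hp : p ∈ (extChartAt 𝓘(ℝ, E) q).source) :
    vecLoc X q (extChartAt 𝓘(ℝ, E) q p) = chartD E q p (X p) := by
  rw [vecLoc, (extChartAt 𝓘(ℝ, E) q).left_inv hp]

lemma extd_eq_extdVec (α : OneForm E M) (q : M) (X Y : E) :
    extdE α q X Y = extdVec (localExpr α q) (extChartAt 𝓘(ℝ, E) q q)
      (chartD E q q X) (chartD E q q Y) := rfl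

variable {M' : Type*} [TopologicalSpace M'] [ChartedSpace E M'] [IsManifold 𝓘(ℝ, E) ∞ M']

variable (E) in
/-- The tangent map, as an endomorphism of the model space. -/
def tmap (f : M → M') (p : M) : E →L[ℝ] E := mfderiv 𝓘(ℝ, E) 𝓘(ℝ, E) f p

/-- The pull-back of a 1-form by a map. -/
def pullForm (f : M → M') (α : OneForm E M') : OneForm E M :=
  fun p => (α (f p)).comp (mfderiv 𝓘(ℝ, E) 𝓘(ℝ, E) f p)

/-- The expression of a map between manifolds in preferred charts. -/
def mapLoc (f : M → M') (q : M) (r : M') (y : E) : E :=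
  extChartAt 𝓘(ℝ, E) r (f ((extChartAt 𝓘(ℝ, E) q).symm y))

lemma contDiffAt_mapLoc {f : M → M'} {q p : M} {r : M'}
    (hp : p ∈ (extChartAt 𝓘(ℝ, E) q).source) (hr : f p ∈ (extChartAt 𝓘(ℝ, E) r).source)
    (hf : ContMDiffAt 𝓘(ℝ, E) 𝓘(ℝ, E) ∞ f p) :
    ContDiffAt ℝ ∞ (mapLoc f q r) (extChartAt 𝓘(ℝ, E) q p) :=
  (contMDiffAt_iff_contDiffAt_chart hp).1 ((contMDiffAt_chart hr).comp p hf)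

/-- The derivative of the expression of `f` in charts is the tangent map conjugated by the
differentials of the charts. -/
lemma fderiv_mapLoc {f : M → M'} {q p : M} {r : M'}
    (hp : p ∈ (extChartAt 𝓘(ℝ, E) q).source) (hr : f p ∈ (extChartAt 𝓘(ℝ, E) r).source)
    (hf : MDifferentiableAt 𝓘(ℝ, E) 𝓘(ℝ, E) f p) (v : E) :
    fderiv ℝ (mapLoc f q r) (extChartAt 𝓘(ℝ, E) q p) v =
      chartD E r (f p) (tmap E f p
        (chartDs q (extChartAt 𝓘(ℝ, E) q p) v)) := by
  set y := extChartAt 𝓘(ℝ, E) q p with hy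
  have hyp : (extChartAt 𝓘(ℝ, E) q).symm y = p := (extChartAt 𝓘(ℝ, E) q).left_inv hp
  have h1 : HasMFDerivAt 𝓘(ℝ, E) 𝓘(ℝ, E) (extChartAt 𝓘(ℝ, E) q).symm y
      (mfderiv 𝓘(ℝ, E) 𝓘(ℝ, E) (extChartAt 𝓘(ℝ, E) q).symm y) :=
    ((contMDiffAt_chart_symm ((extChartAt 𝓘(ℝ, E) q).map_source hp)).mdifferentiableAt
      (by simp)).hasMFDerivAt
  have h2 : HasMFDerivAt 𝓘(ℝ, E) 𝓘(ℝ, E) f ((extChartAt 𝓘(ℝ, E) q).symm y)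
      (mfderiv 𝓘(ℝ, E) 𝓘(ℝ, E) f ((extChartAt 𝓘(ℝ, E) q).symm y)) := by
    rw [hyp]; exact hf.hasMFDerivAt
  have h3 : HasMFDerivAt 𝓘(ℝ, E) 𝓘(ℝ, E) (extChartAt 𝓘(ℝ, E) r)
      (f ((extChartAt 𝓘(ℝ, E) q).symm y)) (mfderiv 𝓘(ℝ, E) 𝓘(ℝ, E) (extChartAt 𝓘(ℝ, E) r)
      (f ((extChartAt 𝓘(ℝ, E) q).symm y))) := by
    rw [hyp]; exact ((contMDiffAt_chart hr).mdifferentiableAt (by simp)).hasMFDerivAt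
  obtain ⟨L, hL⟩ : ∃ L : E →L[ℝ] E, L = (chartD E r (f ((extChartAt 𝓘(ℝ, E) q).symm y))).comp
      ((tmap E f ((extChartAt 𝓘(ℝ, E) q).symm y)).comp (chartDs q y)) := ⟨_, rfl⟩
  have h4 : HasMFDerivAt 𝓘(ℝ, E) 𝓘(ℝ, E) (mapLoc f q r) y L := by
    rw [hL]
    exact HasMFDerivAt.comp (g := extChartAt 𝓘(ℝ, E) r) y h3 (HasMFDerivAt.comp (g := f) y h2 h1)
  have h5 : HasFDerivAt (mapLoc f q r) L y := hasMFDerivAt_iff_hasFDerivAt.1 h4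
  rw [h5.fderiv, hL, hyp]
  rfl

lemma localExpr_pullForm {f : M → M'} {q p : M} {r : M'} (α : OneForm E M')
    (hp : p ∈ (extChartAt 𝓘(ℝ, E) q).source) (hr : f p ∈ (extChartAt 𝓘(ℝ, E) r).source)
    (hf : MDifferentiableAt 𝓘(ℝ, E) 𝓘(ℝ, E) f p) :
    localExpr (pullForm f α) q (extChartAt 𝓘(ℝ, E) q p) =
      (localExpr α r (mapLoc f q r (extChartAt 𝓘(ℝ, E) q p))).comp
        (fderiv ℝ (mapLoc f q r) (extChartAt 𝓘(ℝ, E) q p)) := by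
  ext v
  rw [ContinuousLinearMap.comp_apply, fderiv_mapLoc hp hr hf, mapLoc, localExpr_apply,
    (extChartAt 𝓘(ℝ, E) q).left_inv hp, ← oneForm_eq_localExpr α hr]
  rfl

lemma localExpr_pullForm_eventuallyEq {f : M → M'} {q p : M} {r : M'} (α : OneForm E M')
    (hp : p ∈ (extChartAt 𝓘(ℝ, E) q).source) (hr : f p ∈ (extChartAt 𝓘(ℝ, E) r).source)
    (hf : ContMDiffAt 𝓘(ℝ, E) 𝓘(ℝ, E) ∞ f p) :
    localExpr (pullForm f α) q =ᶠ[𝓝 (extChartAt 𝓘(ℝ, E) q p)]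
      fun y => (localExpr α r (mapLoc f q r y)).comp (fderiv ℝ (mapLoc f q r) y) := by
  have h1 : ∀ᶠ x in 𝓝 p, x ∈ (extChartAt 𝓘(ℝ, E) q).source ∧
      f x ∈ (extChartAt 𝓘(ℝ, E) r).source ∧ MDifferentiableAt 𝓘(ℝ, E) 𝓘(ℝ, E) f x := by
    have h2 := (contMDiffAt_iff_contMDiffAt_nhds (by simp)).1
      (ContMDiffAt.of_le (m := 1) hf (by simp))
    filter_upwards [(isOpen_extChartAt_source q).mem_nhds hp,
      hf.continuousAt.eventually ((isOpen_extChartAt_source r).mem_nhds hr), h2] with x h3 h4 h5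
    exact ⟨h3, h4, h5.mdifferentiableAt (by simp)⟩
  have hy := (extChartAt 𝓘(ℝ, E) q).map_source hp
  have hc : ContinuousAt (extChartAt 𝓘(ℝ, E) q).symm (extChartAt 𝓘(ℝ, E) q p) :=
    (contMDiffAt_chart_symm hy).continuousAt
  rw [ContinuousAt, (extChartAt 𝓘(ℝ, E) q).left_inv hp] at hc
  filter_upwards [hc.eventually h1, (isOpen_extChartAt_target q).mem_nhds hy] with y ⟨h3, h4, h5⟩ h6
  have := localExpr_pullForm α h3 h4 h5
  rwa [(extChartAt 𝓘(ℝ, E) q).right_inv h6] at this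

/-- Naturality of the exterior derivative, between arbitrary preferred charts of the two
manifolds. The identity map gives independence of the chart. -/
lemma extdVec_pullForm {f : M → M'} {q p : M} {r : M'} {α : OneForm E M'} (hα : SmoothOneForm α)
    (hp : p ∈ (extChartAt 𝓘(ℝ, E) q).source) (hr : f p ∈ (extChartAt 𝓘(ℝ, E) r).source)
    (hf : ContMDiffAt 𝓘(ℝ, E) 𝓘(ℝ, E) ∞ f p) (X Y : E) :
    extdVec (localExpr (pullForm f α) q) (extChartAt 𝓘(ℝ, E) q p) X Y =
      extdVec (localExpr α r) (extChartAt 𝓘(ℝ, E) r (f p))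
        (fderiv ℝ (mapLoc f q r) (extChartAt 𝓘(ℝ, E) q p) X)
        (fderiv ℝ (mapLoc f q r) (extChartAt 𝓘(ℝ, E) q p) Y) := by
  rw [extdVec_congr (localExpr_pullForm_eventuallyEq α hp hr hf)]
  have h0 : mapLoc f q r (extChartAt 𝓘(ℝ, E) q p) = extChartAt 𝓘(ℝ, E) r (f p) := by
    rw [mapLoc, (extChartAt 𝓘(ℝ, E) q).left_inv hp]
  rw [extdVec_pullback (contDiffAt_mapLoc hp hr hf), h0]
  rw [h0]
  exact ((smoothOneForm_iff.1 hα) r (f p) hr).differentiableAt (by simp)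

lemma pullForm_id (α : OneForm E M) : pullForm (fun p : M => p) α = α := by
  funext p
  have h := mfderiv_id (I := 𝓘(ℝ, E)) (x := p)
  change (α p).comp (mfderiv 𝓘(ℝ, E) 𝓘(ℝ, E) (fun p : M => p) p) = α p
  have h' : mfderiv 𝓘(ℝ, E) 𝓘(ℝ, E) (fun p : M => p) p =
    ContinuousLinearMap.id ℝ (TangentSpace 𝓘(ℝ, E) p) := h
  rw [h']
  rfl

/-- The exterior derivative can be computed in any preferred chart. -/
lemma extd_eq_of_mem_source {α : OneForm E M} (hα : SmoothOneForm α) {q p : M}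
    (hp : p ∈ (extChartAt 𝓘(ℝ, E) q).source) (X Y : E) :
    extdE α p X Y = extdVec (localExpr α q) (extChartAt 𝓘(ℝ, E) q p)
      (chartD E q p X) (chartD E q p Y) := by
  have h := extdVec_pullForm (f := fun p : M => p) (q := p) (p := p) (r := q) hα
    (mem_extChartAt_source p) hp contMDiffAt_id (chartD E p p X) (chartD E p p Y)
  rw [pullForm_id] at h
  rw [extd_eq_extdVec, h]
  have h2 : ∀ v : E, fderiv ℝ (mapLoc (fun p : M => p) p q) (extChartAt 𝓘(ℝ, E) p p)
      (chartD E p p v) = chartD E q p v := by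
    intro v
    rw [fderiv_mapLoc (f := fun p : M => p) (mem_extChartAt_source p) hp mdifferentiableAt_id]
    rw [chartDs_chartD (mem_extChartAt_source p)]
    exact congrArg (chartD E q p) (DFunLike.congr_fun (mfderiv_id (I := 𝓘(ℝ, E)) (x := p)) v)
  rw [h2, h2]

/-- Naturality of the exterior derivative: `d(f^* α) = f^* dα`. -/
lemma extd_pullForm {f : M → M'} {p : M} {α : OneForm E M'} (hα : SmoothOneForm α)
    (hf : ContMDiffAt 𝓘(ℝ, E) 𝓘(ℝ, E) ∞ f p) (X Y : E) :
    extdE (pullForm f α) p X Y = extdE α (f p) (tmap E f p X) (tmap E f p Y) := by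
  have h := extdVec_pullForm (q := p) (p := p) (r := f p) hα
    (mem_extChartAt_source p) (mem_extChartAt_source _) hf (chartD E p p X) (chartD E p p Y)
  rw [extd_eq_extdVec, extd_eq_extdVec, h]
  have h2 : ∀ v : E, fderiv ℝ (mapLoc f p (f p)) (extChartAt 𝓘(ℝ, E) p p)
      (chartD E p p v) = chartD E (f p) (f p) (tmap E f p v) := by
    intro v
    rw [fderiv_mapLoc (f := f) (mem_extChartAt_source p) (mem_extChartAt_source _)
      (hf.mdifferentiableAt (by simp)), chartDs_chartD (mem_extChartAt_source p)]
  rw [h2, h2]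

/-- The Lie bracket of vector fields at the centre of a preferred chart. -/
lemma chartD_mlieBracket (X Y : VField E M) (q : M) :
    chartD E q q (VectorField.mlieBracket 𝓘(ℝ, E) X Y q) =
      fderiv ℝ (vecLoc Y q) (extChartAt 𝓘(ℝ, E) q q) (vecLoc X q (extChartAt 𝓘(ℝ, E) q q)) -
      fderiv ℝ (vecLoc X q) (extChartAt 𝓘(ℝ, E) q q) (vecLoc Y q (extChartAt 𝓘(ℝ, E) q q)) := by
  have key : ∀ Z : VField E M, VectorField.mpullbackWithin 𝓘(ℝ, E) 𝓘(ℝ, E)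
      (extChartAt 𝓘(ℝ, E) q).symm Z (Set.range 𝓘(ℝ, E)) =ᶠ[𝓝 (extChartAt 𝓘(ℝ, E) q q)]
      vecLoc Z q := by
    intro Z
    filter_upwards [(isOpen_extChartAt_target q).mem_nhds (mem_extChartAt_target q)] with y hy
    have hs := (extChartAt 𝓘(ℝ, E) q).map_target hy
    have h1 : ∀ v, chartDs q y (chartD E q ((extChartAt 𝓘(ℝ, E) q).symm y) v) = v := by
      intro v
      have := chartDs_chartD hs v
      rwa [(extChartAt 𝓘(ℝ, E) q).right_inv hy] at this
    have h2 : ∀ v, chartD E q ((extChartAt 𝓘(ℝ, E) q).symm y) (chartDs q y v) = v := by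
      intro v
      have := chartD_chartDs hs v
      rwa [(extChartAt 𝓘(ℝ, E) q).right_inv hy] at this
    have h3 : (mfderivWithin 𝓘(ℝ, E) 𝓘(ℝ, E) (extChartAt 𝓘(ℝ, E) q).symm
        (Set.range 𝓘(ℝ, E)) y).inverse = mfderiv 𝓘(ℝ, E) 𝓘(ℝ, E) (extChartAt 𝓘(ℝ, E) q)
          ((extChartAt 𝓘(ℝ, E) q).symm y) := by
      simp only [modelWithCornersSelf_coe, Set.range_id, mfderivWithin_univ]
      apply ContinuousLinearMap.inverse_eq
      · ext v; exact h1 v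
      · ext v; exact h2 v
    rw [VectorField.mpullbackWithin_apply, h3]
    rfl
  have h4 : VectorField.mlieBracket 𝓘(ℝ, E) X Y q = _ :=
    VectorField.mlieBracketWithin_apply (I := 𝓘(ℝ, E)) (V := X) (W := Y) (s := Set.univ) (x₀ := q)
  rw [h4]
  have h5 : (mfderiv 𝓘(ℝ, E) 𝓘(ℝ, E) (extChartAt 𝓘(ℝ, E) q) q).inverse =
      mfderiv 𝓘(ℝ, E) 𝓘(ℝ, E) (extChartAt 𝓘(ℝ, E) q).symm (extChartAt 𝓘(ℝ, E) q q) := by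
    apply ContinuousLinearMap.inverse_eq
    · ext v; exact chartD_chartDs (mem_extChartAt_source (I := 𝓘(ℝ, E)) q) v
    · ext v; exact chartDs_chartD (mem_extChartAt_source (I := 𝓘(ℝ, E)) q) v
  rw [h5]
  refine (chartD_chartDs (mem_extChartAt_source q) _).trans ?_
  have h6 : (extChartAt 𝓘(ℝ, E) q).symm ⁻¹' Set.univ ∩ Set.range 𝓘(ℝ, E) = Set.univ := by simp
  have h7 : ∀ V W : E → E, V =ᶠ[𝓝 (extChartAt 𝓘(ℝ, E) q q)] vecLoc X q →
      W =ᶠ[𝓝 (extChartAt 𝓘(ℝ, E) q q)] vecLoc Y q →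
      VectorField.lieBracketWithin ℝ V W Set.univ (extChartAt 𝓘(ℝ, E) q q) =
      fderiv ℝ (vecLoc Y q) (extChartAt 𝓘(ℝ, E) q q) (vecLoc X q (extChartAt 𝓘(ℝ, E) q q)) -
      fderiv ℝ (vecLoc X q) (extChartAt 𝓘(ℝ, E) q q) (vecLoc Y q (extChartAt 𝓘(ℝ, E) q q)) := by
    intro V W hV hW
    rw [VectorField.lieBracketWithin_univ, VectorField.lieBracket, hV.fderiv_eq, hW.fderiv_eq,
      hV.eq_of_nhds, hW.eq_of_nhds]
  rw [h6]
  exact h7 _ _ (key X) (key Y)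

end Coordinates

/-! ### Forms and tensors on a normed space -/

section VectorSpace

variable {E : Type*} [NormedAddCommGroup E] [NormedSpace ℝ E]

/-- The exterior derivative of a 1-form on a normed space, as a bilinear form. -/
def extdBil (a : E → E →L[ℝ] ℝ) (y : E) : E →L[ℝ] E →L[ℝ] ℝ := fderiv ℝ a y - (fderiv ℝ a y).flip

lemma extdBil_apply (a : E → E →L[ℝ] ℝ) (y X Y : E) : extdBil a y X Y = extdVec a y X Y := rfl

lemma extdVec_swap (a : E → E →L[ℝ] ℝ) (y X Y : E) : extdVec a y X Y = - extdVec a y Y X := by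
  simp [extdVec]

lemma hasFDerivAt_clm_eval {V W : Type*} [NormedAddCommGroup V] [NormedSpace ℝ V]
    [NormedAddCommGroup W] [NormedSpace ℝ W] {T : E → V →L[ℝ] W} {y : E}
    (hT : DifferentiableAt ℝ T y) (m : V) :
    HasFDerivAt (fun z => T z m) ((fderiv ℝ T y).flip m) y := by
  have h := hT.hasFDerivAt.clm_apply (hasFDerivAt_const m y)
  refine h.congr_fderiv ?_
  ext v
  simp

lemma fderiv_clm_eval₂ {B : E → E →L[ℝ] E →L[ℝ] ℝ} {y : E} (hB : DifferentiableAt ℝ B y)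
    (u v w : E) : fderiv ℝ (fun z => B z v w) y u = fderiv ℝ B y u v w := by
  have h6 := hasFDerivAt_clm_eval hB v
  rw [(hasFDerivAt_clm_eval h6.differentiableAt w).fderiv, h6.fderiv]
  rfl

/-- A family of linear maps on a finite-dimensional space is smooth at a point when all its
evaluations are. -/
lemma contDiffAt_clm_apply_iff {D V W : Type*} [NormedAddCommGroup D] [NormedSpace ℝ D]
    [NormedAddCommGroup V] [NormedSpace ℝ V] [FiniteDimensional ℝ V] [NormedAddCommGroup W]
    [NormedSpace ℝ W] {f : D → V →L[ℝ] W} {x : D} :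
    ContDiffAt ℝ ∞ f x ↔ ∀ v, ContDiffAt ℝ ∞ (fun z => f z v) x := by
  refine ⟨fun h v => h.clm_apply contDiffAt_const, fun h => ?_⟩
  let d := Module.finrank ℝ V
  have hd : d = Module.finrank ℝ (Fin d → ℝ) := (Module.finrank_fin_fun ℝ).symm
  let e₁ := ContinuousLinearEquiv.ofFinrankEq hd
  let e₂ := (e₁.arrowCongr (1 : W ≃L[ℝ] W)).trans (ContinuousLinearEquiv.piRing (Fin d))
  rw [← Function.id_comp f, ← e₂.symm_comp_self]
  exact e₂.symm.contDiff.contDiffAt.comp x (contDiffAt_pi.mpr fun i => h _)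

lemma contDiffAt_extdBil [FiniteDimensional ℝ E] {a : E → E →L[ℝ] ℝ} {y : E}
    (ha : ContDiffAt ℝ ∞ a y) : ContDiffAt ℝ ∞ (extdBil a) y := by
  have h : ContDiffAt ℝ ∞ (fderiv ℝ a) y := ha.fderiv_right (m := ∞) (by simp)
  refine contDiffAt_clm_apply_iff.2 fun u => contDiffAt_clm_apply_iff.2 fun v => ?_
  exact ((h.clm_apply contDiffAt_const).clm_apply contDiffAt_const).sub
    ((h.clm_apply contDiffAt_const).clm_apply contDiffAt_const)

/-- The exterior derivative of a 1-form is closed. -/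
lemma extdBil_closed [FiniteDimensional ℝ E] {a : E → E →L[ℝ] ℝ} {y : E}
    (ha : ContDiffAt ℝ ∞ a y) (u v w : E) :
    fderiv ℝ (extdBil a) y u v w + fderiv ℝ (extdBil a) y v w u
      + fderiv ℝ (extdBil a) y w u v = 0 := by
  have hs : IsSymmSndFDerivAt ℝ a y := ha.isSymmSndFDerivAt
    (by simpa using WithTop.coe_le_coe.2 (le_top (a := (2 : ℕ∞))))
  have h : DifferentiableAt ℝ (fderiv ℝ a) y :=
    (ha.fderiv_right (m := ∞) (by simp)).differentiableAt (by simp)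
  have hd : DifferentiableAt ℝ (extdBil a) y := (contDiffAt_extdBil ha).differentiableAt (by simp)
  have key : ∀ u v w, fderiv ℝ (extdBil a) y u v w =
      fderiv ℝ (fderiv ℝ a) y u v w - fderiv ℝ (fderiv ℝ a) y u w v := by
    intro u v w
    rw [← fderiv_clm_eval₂ hd, ← fderiv_clm_eval₂ h, ← fderiv_clm_eval₂ h]
    have h1 : ∀ v w, DifferentiableAt ℝ (fun z => fderiv ℝ a z v w) y := fun v w =>
      (h.clm_apply (differentiableAt_const v)).clm_apply (differentiableAt_const w)
    exact DFunLike.congr_fun (fderiv_fun_sub (h1 v w) (h1 w v)) u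
  simp only [key, hs.eq u v, hs.eq u w, hs.eq v w]
  ring

/-- The Courant bracket of two sections of the graph of a Poisson tensor belongs to the graph: the
first derivatives of the 1-forms cancel, and what remains is the Jacobi identity for the
components of the tensor. -/
lemma lieBracket_graph_vec {T : E → (E →L[ℝ] ℝ) →L[ℝ] E} {a b : E → E →L[ℝ] ℝ} {y : E}
    (hT : DifferentiableAt ℝ T y) (ha : DifferentiableAt ℝ a y) (hb : DifferentiableAt ℝ b y)
    (hskew : ∀ᶠ z in 𝓝 y, ∀ l m : E →L[ℝ] ℝ, l (T z m) = - m (T z l))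
    (hjac : ∀ l m n : E →L[ℝ] ℝ, n (fderiv ℝ T y (T y l) m) + l (fderiv ℝ T y (T y m) n)
      + m (fderiv ℝ T y (T y n) l) = 0) {X Y : E → E}
    (hX : X =ᶠ[𝓝 y] fun z => T z (a z)) (hY : Y =ᶠ[𝓝 y] fun z => T z (b z)) :
    fderiv ℝ Y y (X y) - fderiv ℝ X y (Y y) =
      T y (extdBil b y (X y) - extdBil a y (Y y)
        + (1 / 2 : ℝ) • fderiv ℝ (fun z => b z (X z) - a z (Y z)) y) := by
  have hdX : ∀ v, fderiv ℝ X y v = fderiv ℝ T y v (a y) + T y (fderiv ℝ a y v) := by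
    intro v
    rw [hX.fderiv_eq, (hT.hasFDerivAt.clm_apply ha.hasFDerivAt).fderiv]
    simp [add_comm]
  have hdY : ∀ v, fderiv ℝ Y y v = fderiv ℝ T y v (b y) + T y (fderiv ℝ b y v) := by
    intro v
    rw [hY.fderiv_eq, (hT.hasFDerivAt.clm_apply hb.hasFDerivAt).fderiv]
    simp [add_comm]
  have hXd : DifferentiableAt ℝ X y :=
    (hT.clm_apply ha).congr_of_eventuallyEq hX
  have hYd : DifferentiableAt ℝ Y y :=
    (hT.clm_apply hb).congr_of_eventuallyEq hY
  have hsk := hskew.self_of_nhds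
  have hdsk : ∀ v, ∀ l m : E →L[ℝ] ℝ, l (fderiv ℝ T y v m) = - m (fderiv ℝ T y v l) := by
    intro v l m
    have h1 : (fun z => l (T z m)) =ᶠ[𝓝 y] fun z => - m (T z l) := by
      filter_upwards [hskew] with z hz using hz l m
    have h2 : ∀ l m : E →L[ℝ] ℝ, HasFDerivAt (fun z => l (T z m))
        (l.comp ((fderiv ℝ T y).flip m)) y := by
      intro l m
      refine ((hasFDerivAt_const l y).clm_apply (hasFDerivAt_clm_eval hT m)).congr_fderiv ?_
      ext v
      simp
    have h3 := h1.fderiv_eq (𝕜 := ℝ)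
    rw [(h2 l m).fderiv, (h2 m l).fun_neg.fderiv] at h3
    simpa using DFunLike.congr_fun h3 v
  have hd : ∀ v, fderiv ℝ (fun z => b z (X z) - a z (Y z)) y v =
      fderiv ℝ b y v (X y) + b y (fderiv ℝ X y v) - (fderiv ℝ a y v (Y y)
        + a y (fderiv ℝ Y y v)) := by
    intro v
    have h := ((hb.hasFDerivAt.clm_apply hXd.hasFDerivAt).sub
      (ha.hasFDerivAt.clm_apply hYd.hasFDerivAt)).fderiv
    have h' : fderiv ℝ (fun z => b z (X z) - a z (Y z)) y = _ := h
    rw [h']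
    simp [add_comm]
  refine (SeparatingDual.eq_iff_forall_dual_eq (R := ℝ)).2 fun n => ?_
  rw [hsk n]
  have hX0 : X y = T y (a y) := hX.self_of_nhds
  have hY0 : Y y = T y (b y) := hY.self_of_nhds
  simp only [map_sub, hdX, hdY, map_add, add_apply,
    sub_apply, smul_apply, extdBil_apply, extdVec, hd,
    smul_eq_mul]
  rw [hsk n (fderiv ℝ b y (X y)), hsk n (fderiv ℝ a y (Y y)), hsk (b y) (fderiv ℝ a y (T y n)),
    hsk (a y) (fderiv ℝ b y (T y n)), ← hX0, ← hY0]
  have hj := hjac (a y) (b y) n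
  rw [← hX0, ← hY0, hdsk (Y y) (a y) n] at hj
  have h5 := hdsk (T y n) (a y) (b y)
  linarith

/-- The gauge transformation by a closed 2-form `B` is compatible with the Courant bracket. -/
lemma contr_lieBracket_vec {B : E → E →L[ℝ] E →L[ℝ] ℝ} {X Y : E → E} {y : E}
    (hB : DifferentiableAt ℝ B y) (hX : DifferentiableAt ℝ X y) (hY : DifferentiableAt ℝ Y y)
    (hskew : ∀ z u v, B z u v = - B z v u)
    (hclosed : ∀ u v w, fderiv ℝ B y u v w + fderiv ℝ B y v w u + fderiv ℝ B y w u v = 0) (v : E) :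
    extdVec (fun z => B z (Y z)) y (X y) v - extdVec (fun z => B z (X z)) y (Y y) v
      - fderiv ℝ (fun z => B z (X z) (Y z)) y v =
      B y (fderiv ℝ Y y (X y) - fderiv ℝ X y (Y y)) v := by
  have h1 : ∀ {Z : E → E}, DifferentiableAt ℝ Z y → ∀ u w, fderiv ℝ (fun z => B z (Z z)) y u w =
      fderiv ℝ B y u (Z y) w + B y (fderiv ℝ Z y u) w := by
    intro Z hZ u w
    have h := (hB.hasFDerivAt.clm_apply hZ.hasFDerivAt).fderiv
    have h' : fderiv ℝ (fun z => B z (Z z)) y = _ := h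
    rw [h']
    simp [add_comm]
  have h2 : fderiv ℝ (fun z => B z (X z) (Y z)) y v =
      fderiv ℝ B y v (X y) (Y y) + B y (fderiv ℝ X y v) (Y y) + B y (X y) (fderiv ℝ Y y v) := by
    have h := ((hB.hasFDerivAt.clm_apply hX.hasFDerivAt).clm_apply hY.hasFDerivAt).fderiv
    have h' : fderiv ℝ (fun z => B z (X z) (Y z)) y = _ := h
    rw [h']
    simp
    ring
  have h3 : ∀ u v w, fderiv ℝ B y u v w = - fderiv ℝ B y u w v := by
    intro u v w
    have h4 : (fun z => B z v w) = fun z => - B z w v := funext fun z => hskew z v w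
    rw [← fderiv_clm_eval₂ hB, h4, fderiv_fun_neg, ← fderiv_clm_eval₂ hB]
    rfl
  simp only [extdVec, h1 hX, h1 hY, h2, map_sub, sub_apply]
  have h7 := hclosed (X y) (Y y) v
  have h8 := hskew y (fderiv ℝ Y y v) (X y)
  have h9 := h3 (Y y) (X y) v
  have h10 := h3 v (Y y) (X y)
  linarith

end VectorSpace

/-! ### Smooth forms on a manifold -/

section Fields

variable {E : Type*} [NormedAddCommGroup E] [NormedSpace ℝ E] [FiniteDimensional ℝ E]
  {M : Type*} [TopologicalSpace M] [ChartedSpace E M] [IsManifold 𝓘(ℝ, E) ∞ M]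

lemma smoothOneForm_of_center {α : OneForm E M}
    (h : ∀ q : M, ContDiffAt ℝ ∞ (localExpr α q) (extChartAt 𝓘(ℝ, E) q q)) : SmoothOneForm α :=
  fun p => (contMDiffAt_oneForm_iff (mem_extChartAt_source p)).2 (h p)

lemma SmoothVField.contDiffAt {X : VField E M} (hX : SmoothVField X) (q : M) :
    ContDiffAt ℝ ∞ (vecLoc X q) (extChartAt 𝓘(ℝ, E) q q) :=
  smoothVField_iff.1 hX q q (mem_extChartAt_source q)

lemma SmoothOneForm.contDiffAt {α : OneForm E M} (hα : SmoothOneForm α) (q : M) :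
    ContDiffAt ℝ ∞ (localExpr α q) (extChartAt 𝓘(ℝ, E) q q) :=
  smoothOneForm_iff.1 hα q q (mem_extChartAt_source q)

lemma target_mem_nhds (q : M) :
    (extChartAt 𝓘(ℝ, E) q).target ∈ 𝓝 (extChartAt 𝓘(ℝ, E) q q) :=
  (isOpen_extChartAt_target q).mem_nhds (mem_extChartAt_target q)

/-- The value of a vector field, as a vector of the model space. -/
def vecE (X : VField E M) (p : M) : E := X p

lemma pairing_eq (α : OneForm E M) (X : VField E M) {q : M} {y : E}
    (hy : y ∈ (extChartAt 𝓘(ℝ, E) q).target) :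
    covE α ((extChartAt 𝓘(ℝ, E) q).symm y) (vecE X ((extChartAt 𝓘(ℝ, E) q).symm y)) =
      localExpr α q y (vecLoc X q y) := by
  rw [oneForm_eq_localExpr α ((extChartAt 𝓘(ℝ, E) q).map_target hy),
    (extChartAt 𝓘(ℝ, E) q).right_inv hy]
  rfl

lemma localExpr_dfun {f : M → ℝ} (hf : ContMDiff 𝓘(ℝ, E) 𝓘(ℝ, ℝ) ∞ f) {q : M} {y : E}
    (hy : y ∈ (extChartAt 𝓘(ℝ, E) q).target) :
    localExpr (dfun (E := E) f) q y =
      fderiv ℝ (fun z => f ((extChartAt 𝓘(ℝ, E) q).symm z)) y := by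
  obtain ⟨L, hL⟩ : ∃ L : E →L[ℝ] ℝ, L = localExpr (dfun (E := E) f) q y := ⟨_, rfl⟩
  have h1 : HasMFDerivAt 𝓘(ℝ, E) 𝓘(ℝ, E) (extChartAt 𝓘(ℝ, E) q).symm y
      (mfderiv 𝓘(ℝ, E) 𝓘(ℝ, E) (extChartAt 𝓘(ℝ, E) q).symm y) :=
    ((contMDiffAt_chart_symm hy).mdifferentiableAt (by simp)).hasMFDerivAt
  have h2 := ((hf ((extChartAt 𝓘(ℝ, E) q).symm y)).mdifferentiableAt (by simp)).hasMFDerivAt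
  have h4 : HasMFDerivAt 𝓘(ℝ, E) 𝓘(ℝ, ℝ) (fun z => f ((extChartAt 𝓘(ℝ, E) q).symm z)) y L := by
    rw [hL]
    exact HasMFDerivAt.comp (g := f) y h2 h1
  have h5 : HasFDerivAt (fun z => f ((extChartAt 𝓘(ℝ, E) q).symm z)) L y :=
    hasMFDerivAt_iff_hasFDerivAt.1 h4
  rw [h5.fderiv, hL]

lemma SmoothOneForm.dfun {f : M → ℝ} (hf : ContMDiff 𝓘(ℝ, E) 𝓘(ℝ, ℝ) ∞ f) :
    SmoothOneForm (dfun (E := E) f) := by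
  refine smoothOneForm_of_center fun q => ?_
  have h1 : ContDiffAt ℝ ∞ (fun z => f ((extChartAt 𝓘(ℝ, E) q).symm z))
      (extChartAt 𝓘(ℝ, E) q q) :=
    (contMDiffAt_iff_contDiffAt_chart (mem_extChartAt_source q)).1 (hf q)
  refine (contDiffAt_congr_nhds ?_).2 (h1.fderiv_right (m := ∞) (by simp))
  filter_upwards [target_mem_nhds (E := E) q] with y hy using localExpr_dfun hf hy

lemma contMDiff_pairing {α : OneForm E M} {X : VField E M} (hα : SmoothOneForm α)
    (hX : SmoothVField X) : ContMDiff 𝓘(ℝ, E) 𝓘(ℝ, ℝ) ∞ (fun p => α p (X p)) := by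
  intro q
  refine (contMDiffAt_iff_contDiffAt_chart (mem_extChartAt_source q)).2 ?_
  refine (contDiffAt_congr_nhds ?_).2 ((hα.contDiffAt q).clm_apply (hX.contDiffAt q))
  filter_upwards [target_mem_nhds (E := E) q] with y hy using pairing_eq α X hy

/-- The contraction `i_X dα`. -/
def contr (α : OneForm E M) (X : VField E M) : OneForm E M := fun p => extd α p (X p)

lemma localExpr_contr {α : OneForm E M} (hα : SmoothOneForm α) (X : VField E M) {q : M} {y : E}
    (hy : y ∈ (extChartAt 𝓘(ℝ, E) q).target) :
    localExpr (contr α X) q y = extdBil (localExpr α q) y (vecLoc X q y) := by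
  ext v
  have hp := (extChartAt 𝓘(ℝ, E) q).map_target hy
  have h := extd_eq_of_mem_source hα hp (vecE X ((extChartAt 𝓘(ℝ, E) q).symm y)) (chartDs q y v)
  have h1 := chartD_chartDs hp v
  rw [(extChartAt 𝓘(ℝ, E) q).right_inv hy] at h h1
  rw [h1] at h
  exact h

lemma SmoothOneForm.contr {α : OneForm E M} (hα : SmoothOneForm α) {X : VField E M}
    (hX : SmoothVField X) : SmoothOneForm (contr α X) := by
  refine smoothOneForm_of_center fun q => ?_
  refine (contDiffAt_congr_nhds ?_).2
    ((contDiffAt_extdBil (hα.contDiffAt q)).clm_apply (hX.contDiffAt q))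
  filter_upwards [target_mem_nhds (E := E) q] with y hy using localExpr_contr hα X hy

lemma localExpr_add (α β : OneForm E M) (q : M) (y : E) :
    localExpr (α + β) q y = localExpr α q y + localExpr β q y := rfl

lemma localExpr_sub (α β : OneForm E M) (q : M) (y : E) :
    localExpr (α - β) q y = localExpr α q y - localExpr β q y := rfl

lemma localExpr_smul (c : ℝ) (α : OneForm E M) (q : M) (y : E) :
    localExpr (c • α) q y = c • localExpr α q y := rfl

lemma SmoothOneForm.add {α β : OneForm E M} (hα : SmoothOneForm α) (hβ : SmoothOneForm β) :
    SmoothOneForm (α + β) :=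
  smoothOneForm_of_center fun q => (hα.contDiffAt q).add (hβ.contDiffAt q)

lemma SmoothOneForm.sub {α β : OneForm E M} (hα : SmoothOneForm α) (hβ : SmoothOneForm β) :
    SmoothOneForm (α - β) :=
  smoothOneForm_of_center fun q => (hα.contDiffAt q).sub (hβ.contDiffAt q)

lemma SmoothOneForm.smul (c : ℝ) {α : OneForm E M} (hα : SmoothOneForm α) :
    SmoothOneForm (c • α) :=
  smoothOneForm_of_center fun q => (hα.contDiffAt q).const_smul c

lemma courantForm_eq (X : VField E M) (α : OneForm E M) (Y : VField E M) (β : OneForm E M) :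
    courantForm X α Y β = DiracAveraging.contr β X - DiracAveraging.contr α Y
      + (1 / 2 : ℝ) • DiracAveraging.dfun (fun p => β p (X p) - α p (Y p)) := rfl

lemma SmoothOneForm.courantForm {X Y : VField E M} {α β : OneForm E M} (hX : SmoothVField X)
    (hα : SmoothOneForm α) (hY : SmoothVField Y) (hβ : SmoothOneForm β) :
    SmoothOneForm (courantForm X α Y β) := by
  rw [courantForm_eq]
  exact ((hβ.contr hX).sub (hα.contr hY)).add (SmoothOneForm.smul _
    (SmoothOneForm.dfun ((contMDiff_pairing hβ hX).sub (contMDiff_pairing hα hY))))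

/-- The local expression of the 1-form component of the Courant bracket. -/
lemma localExpr_courantForm {X Y : VField E M} {α β : OneForm E M} (hX : SmoothVField X)
    (hα : SmoothOneForm α) (hY : SmoothVField Y) (hβ : SmoothOneForm β) (q : M) :
    localExpr (courantForm X α Y β) q (extChartAt 𝓘(ℝ, E) q q) =
      extdBil (localExpr β q) (extChartAt 𝓘(ℝ, E) q q) (vecLoc X q (extChartAt 𝓘(ℝ, E) q q))
      - extdBil (localExpr α q) (extChartAt 𝓘(ℝ, E) q q) (vecLoc Y q (extChartAt 𝓘(ℝ, E) q q))
      + (1 / 2 : ℝ) • fderiv ℝ (fun z => localExpr β q z (vecLoc X q z)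
        - localExpr α q z (vecLoc Y q z)) (extChartAt 𝓘(ℝ, E) q q) := by
  rw [courantForm_eq, localExpr_add, localExpr_sub, localExpr_smul,
    localExpr_contr hβ X (mem_extChartAt_target q), localExpr_contr hα Y (mem_extChartAt_target q),
    localExpr_dfun ((contMDiff_pairing hβ hX).sub (contMDiff_pairing hα hY))
      (mem_extChartAt_target q)]
  congr 2
  apply Filter.EventuallyEq.fderiv_eq
  filter_upwards [target_mem_nhds (E := E) q] with y hy
  exact congrArg₂ (· - ·) (pairing_eq β X hy) (pairing_eq α Y hy)

lemma SmoothVField.mlieBracket {X Y : VField E M} (hX : SmoothVField X) (hY : SmoothVField Y) :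
    SmoothVField (VectorField.mlieBracket 𝓘(ℝ, E) X Y) := by
  intro q
  have : IsManifold 𝓘(ℝ, E) (minSmoothness ℝ 2) M :=
    IsManifold.of_le (n := ∞) (by simpa using WithTop.coe_le_coe.2 (le_top (a := (2 : ℕ∞))))
  have : IsManifold 𝓘(ℝ, E) (((⊤ : ℕ∞) : WithTop ℕ∞) + 1) M := by simpa
  exact ContMDiffAt.mlieBracket_vectorField (m := ⊤) (n := ⊤) (hX q) (hY q) (by simp)

/-- Every covector is, near a given point, the differential of a globally defined smooth function
which is linear in the preferred chart. -/
lemma exists_linear_function [T2Space M] (q : M) (l : E →L[ℝ] ℝ) :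
    ∃ f : M → ℝ, ContMDiff 𝓘(ℝ, E) 𝓘(ℝ, ℝ) ∞ f ∧
      ∀ᶠ p in 𝓝 q, f p = l (extChartAt 𝓘(ℝ, E) q p) := by
  obtain ⟨χ⟩ : Nonempty (SmoothBumpFunction 𝓘(ℝ, E) q) := inferInstance
  refine ⟨fun p => χ p • l (extChartAt 𝓘(ℝ, E) q p), χ.contMDiff_smul ?_, ?_⟩
  · exact l.contMDiff.comp_contMDiffOn (contMDiffOn_extChartAt (x := q))
  · filter_upwards [χ.eventuallyEq_one] with p hp
    simp [hp]

lemma localExpr_dfun_linear {q : M} {l : E →L[ℝ] ℝ} {f : M → ℝ}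
    (hf : ContMDiff 𝓘(ℝ, E) 𝓘(ℝ, ℝ) ∞ f) (h : ∀ᶠ p in 𝓝 q, f p = l (extChartAt 𝓘(ℝ, E) q p)) :
    localExpr (dfun (E := E) f) q =ᶠ[𝓝 (extChartAt 𝓘(ℝ, E) q q)] fun _ => l := by
  have hc : Filter.Tendsto (extChartAt 𝓘(ℝ, E) q).symm (𝓝 (extChartAt 𝓘(ℝ, E) q q)) (𝓝 q) := by
    have := (contMDiffAt_chart_symm (mem_extChartAt_target (I := 𝓘(ℝ, E)) q)).continuousAt
    rwa [ContinuousAt, (extChartAt 𝓘(ℝ, E) q).left_inv (mem_extChartAt_source q)] at this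
  have h1 : (fun z => f ((extChartAt 𝓘(ℝ, E) q).symm z)) =ᶠ[𝓝 (extChartAt 𝓘(ℝ, E) q q)]
      fun z => l z := by
    filter_upwards [hc.eventually h, target_mem_nhds (E := E) q] with z hz hz'
    rw [hz, (extChartAt 𝓘(ℝ, E) q).right_inv hz']
  filter_upwards [h1.eventuallyEq_nhds, target_mem_nhds (E := E) q] with z hz hz'
  rw [localExpr_dfun hf hz', hz.fderiv_eq]
  exact l.fderiv

end Fields

/-! ### Poisson tensors, Dirac structures and gauge transformations -/

section Tensors

variable {E : Type*} [NormedAddCommGroup E] [NormedSpace ℝ E] [FiniteDimensional ℝ E]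
  {M : Type*} [TopologicalSpace M] [ChartedSpace E M] [IsManifold 𝓘(ℝ, E) ∞ M]

lemma chartD_injective {q p : M} (hp : p ∈ (extChartAt 𝓘(ℝ, E) q).source) :
    Function.Injective (chartD E q p) :=
  Function.LeftInverse.injective (g := chartDs q (extChartAt 𝓘(ℝ, E) q p)) (chartDs_chartD hp)

/-- The value of a 2-tensor, as a linear map between the dual model space and the model space. -/
def tensE (P : TwoTensor E M) (p : M) : (E →L[ℝ] ℝ) →L[ℝ] E :=
  LinearMap.toContinuousLinearMap (P p : (E →L[ℝ] ℝ) →ₗ[ℝ] E)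

/-- The local expression of a 2-tensor in the preferred chart at `q`. -/
def tensLoc (P : TwoTensor E M) (q : M) (y : E) : (E →L[ℝ] ℝ) →L[ℝ] E :=
  LinearMap.toContinuousLinearMap
    { toFun := fun l => chartD E q ((extChartAt 𝓘(ℝ, E) q).symm y)
        (tensE P ((extChartAt 𝓘(ℝ, E) q).symm y)
          (l.comp (chartD E q ((extChartAt 𝓘(ℝ, E) q).symm y))))
      map_add' := fun l m => by simp [ContinuousLinearMap.add_comp]
      map_smul' := fun c l => by simp [ContinuousLinearMap.smul_comp] }

lemma tensLoc_apply (P : TwoTensor E M) (q : M) (y : E) (l : E →L[ℝ] ℝ) :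
    tensLoc P q y l = chartD E q ((extChartAt 𝓘(ℝ, E) q).symm y)
        (tensE P ((extChartAt 𝓘(ℝ, E) q).symm y)
          (l.comp (chartD E q ((extChartAt 𝓘(ℝ, E) q).symm y)))) := rfl

lemma covE_eq_comp (α : OneForm E M) {q : M} {y : E} (hy : y ∈ (extChartAt 𝓘(ℝ, E) q).target) :
    covE α ((extChartAt 𝓘(ℝ, E) q).symm y) =
      (localExpr α q y).comp (chartD E q ((extChartAt 𝓘(ℝ, E) q).symm y)) := by
  ext v
  rw [oneForm_eq_localExpr α ((extChartAt 𝓘(ℝ, E) q).map_target hy),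
    (extChartAt 𝓘(ℝ, E) q).right_inv hy]
  rfl

/-- The vector field `P^♯ α` associated with a 1-form. -/
def sharp (P : TwoTensor E M) (α : OneForm E M) : VField E M := fun p => P p (α p)

lemma vecLoc_sharp (P : TwoTensor E M) (α : OneForm E M) {q : M} {y : E}
    (hy : y ∈ (extChartAt 𝓘(ℝ, E) q).target) :
    vecLoc (sharp P α) q y = tensLoc P q y (localExpr α q y) := by
  rw [tensLoc_apply, ← covE_eq_comp α hy]
  rfl

variable [T2Space M]

lemma IsBivectorField.contDiffAt_tensLoc {P : TwoTensor E M} (hP : IsBivectorField P) (q : M) :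
    ContDiffAt ℝ ∞ (tensLoc P q) (extChartAt 𝓘(ℝ, E) q q) := by
  refine contDiffAt_clm_apply_iff.2 fun l => ?_
  obtain ⟨f, hf, hl⟩ := exists_linear_function q l
  have h1 : SmoothVField (sharp P (dfun f)) := hP.smooth _ (SmoothOneForm.dfun hf)
  refine (contDiffAt_congr_nhds ?_).2 (h1.contDiffAt q)
  filter_upwards [localExpr_dfun_linear hf hl, target_mem_nhds (E := E) q] with y hy hy'
  rw [vecLoc_sharp _ _ hy', hy]

lemma IsBivectorField.tensLoc_skew {P : TwoTensor E M} (hP : IsBivectorField P) (q : M) (y : E)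
    (l m : E →L[ℝ] ℝ) : l (tensLoc P q y m) = - m (tensLoc P q y l) :=
  hP.skew _ (m.comp (chartD E q ((extChartAt 𝓘(ℝ, E) q).symm y)))
    (l.comp (chartD E q ((extChartAt 𝓘(ℝ, E) q).symm y)))

lemma pbracket_eq (P : TwoTensor E M) (f g : M → ℝ) {q : M} {y : E}
    (hy : y ∈ (extChartAt 𝓘(ℝ, E) q).target) :
    pbracket P f g ((extChartAt 𝓘(ℝ, E) q).symm y) =
      localExpr (dfun (E := E) g) q y (tensLoc P q y (localExpr (dfun (E := E) f) q y)) := by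
  rw [← vecLoc_sharp P _ hy]
  exact pairing_eq (dfun g) (sharp P (dfun f)) hy

/-- The Jacobi identity for the components of a Poisson tensor in a chart. -/
lemma IsPoisson.tensLoc_jacobi {P : TwoTensor E M} (hP : IsPoisson P) (q : M)
    (l m n : E →L[ℝ] ℝ) :
    n (fderiv ℝ (tensLoc P q) (extChartAt 𝓘(ℝ, E) q q)
        (tensLoc P q (extChartAt 𝓘(ℝ, E) q q) l) m)
      + l (fderiv ℝ (tensLoc P q) (extChartAt 𝓘(ℝ, E) q q)
        (tensLoc P q (extChartAt 𝓘(ℝ, E) q q) m) n)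
      + m (fderiv ℝ (tensLoc P q) (extChartAt 𝓘(ℝ, E) q q)
        (tensLoc P q (extChartAt 𝓘(ℝ, E) q q) n) l) = 0 := by
  have hT := (hP.toIsBivectorField.contDiffAt_tensLoc q).differentiableAt (by simp)
  have hs : ∀ f g : M → ℝ, ContMDiff 𝓘(ℝ, E) 𝓘(ℝ, ℝ) ∞ f → ContMDiff 𝓘(ℝ, E) 𝓘(ℝ, ℝ) ∞ g →
      ContMDiff 𝓘(ℝ, E) 𝓘(ℝ, ℝ) ∞ (pbracket P f g) := fun f g hf hg =>
    contMDiff_pairing (SmoothOneForm.dfun hg) (hP.smooth _ (SmoothOneForm.dfun hf))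
  have key : ∀ (l m n : E →L[ℝ] ℝ) (f g h : M → ℝ), ContMDiff 𝓘(ℝ, E) 𝓘(ℝ, ℝ) ∞ f →
      ContMDiff 𝓘(ℝ, E) 𝓘(ℝ, ℝ) ∞ g → ContMDiff 𝓘(ℝ, E) 𝓘(ℝ, ℝ) ∞ h →
      (∀ᶠ p in 𝓝 q, f p = l (extChartAt 𝓘(ℝ, E) q p)) →
      (∀ᶠ p in 𝓝 q, g p = m (extChartAt 𝓘(ℝ, E) q p)) →
      (∀ᶠ p in 𝓝 q, h p = n (extChartAt 𝓘(ℝ, E) q p)) →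
      pbracket P f (pbracket P g h) q = n (fderiv ℝ (tensLoc P q) (extChartAt 𝓘(ℝ, E) q q)
        (tensLoc P q (extChartAt 𝓘(ℝ, E) q q) l) m) := by
    intro l m n f g h hf hg hh hl hm hn
    have h1 := pbracket_eq P f (pbracket P g h) (mem_extChartAt_target (I := 𝓘(ℝ, E)) q)
    rw [(extChartAt 𝓘(ℝ, E) q).left_inv (mem_extChartAt_source q),
      localExpr_dfun (hs g h hg hh) (mem_extChartAt_target q),
      (localExpr_dfun_linear hf hl).self_of_nhds] at h1
    rw [h1]
    have h2 : (fun z => pbracket P g h ((extChartAt 𝓘(ℝ, E) q).symm z)) =ᶠ[𝓝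
        (extChartAt 𝓘(ℝ, E) q q)] fun z => n (tensLoc P q z m) := by
      filter_upwards [localExpr_dfun_linear hg hm, localExpr_dfun_linear hh hn,
        target_mem_nhds (E := E) q] with y h3 h4 h5
      rw [pbracket_eq P g h h5, h3, h4]
    rw [h2.fderiv_eq, ((hasFDerivAt_const n _).clm_apply (hasFDerivAt_clm_eval hT m)).fderiv]
    simp
  obtain ⟨f, hf, hl⟩ := exists_linear_function q l
  obtain ⟨g, hg, hm⟩ := exists_linear_function q m
  obtain ⟨h, hh, hn⟩ := exists_linear_function q n
  have := hP.jacobi f g h hf hg hh q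
  rwa [key l m n f g h hf hg hh hl hm hn, key m n l g h f hg hh hf hm hn hl,
    key n l m h f g hh hf hg hn hl hm] at this

lemma mem_graph {P : TwoTensor E M} {q : M} {X : Tan E q} {α : Cot E q} :
    (X, α) ∈ graph P q ↔ X = P q α := by
  constructor
  · rintro ⟨β, hβ⟩
    have h1 : P q β = X := congrArg Prod.fst hβ
    have h2 : β = α := congrArg Prod.snd hβ
    rw [← h1, h2]
  · rintro rfl
    exact ⟨α, rfl⟩

lemma eq_of_forall_cot {q : M} {X Y : Tan E q} (h : ∀ l : Cot E q, l X = l Y) : X = Y :=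
  (SeparatingDual.eq_iff_forall_dual_eq (R := ℝ) (V := E)).2 h

/-- A covector at a point is the value of a globally defined exact 1-form. -/
lemma exists_dfun_eq (q : M) (α : Cot E q) :
    ∃ f : M → ℝ, ContMDiff 𝓘(ℝ, E) 𝓘(ℝ, ℝ) ∞ f ∧ dfun (E := E) f q = α := by
  obtain ⟨α', hα'⟩ : ∃ α' : E →L[ℝ] ℝ, α' = α := ⟨α, rfl⟩
  obtain ⟨f, hf, hl⟩ := exists_linear_function q
    (α'.comp (chartDs q (extChartAt 𝓘(ℝ, E) q q)))
  refine ⟨f, hf, ?_⟩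
  have h := (localExpr_dfun_linear hf hl).self_of_nhds
  have h2 : covE (dfun (E := E) f) q = α' := by
    ext v
    rw [oneForm_eq_localExpr _ (mem_extChartAt_source q), h, ContinuousLinearMap.comp_apply,
      chartDs_chartD (mem_extChartAt_source q)]
  exact h2.trans hα'

/-- The graph of a Poisson tensor is a Dirac structure. -/
theorem IsPoisson.isDirac_graph {P : TwoTensor E M} (hP : IsPoisson P) : IsDirac (graph P) where
  smooth := by
    rintro q ⟨X, α⟩ he
    rw [mem_graph] at he
    obtain ⟨f, hf, hα⟩ := exists_dfun_eq q α
    refine ⟨sharp P (dfun f), dfun f, ⟨hP.smooth _ (SmoothOneForm.dfun hf),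
      SmoothOneForm.dfun hf, fun p => mem_graph.2 rfl⟩, ?_⟩
    rw [he, ← hα]
    rfl
  lagrangian := by
    intro q X α
    rw [mem_graph]
    constructor
    · rintro rfl Y β hY
      rw [mem_graph.1 hY, hP.skew]
      ring
    · intro h
      refine eq_of_forall_cot fun β => ?_
      have := h (P q β) β (mem_graph.2 rfl)
      rw [hP.skew]
      linarith
  involutive := by
    rintro X α Y β ⟨hX, hα, hXα⟩ ⟨hY, hβ, hYβ⟩
    refine ⟨hX.mlieBracket hY, SmoothOneForm.courantForm hX hα hY hβ, fun q => ?_⟩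
    have hX' : X = sharp P α := funext fun p => mem_graph.1 (hXα p)
    have hY' : Y = sharp P β := funext fun p => mem_graph.1 (hYβ p)
    have hB := hP.toIsBivectorField
    have h1 := lieBracket_graph_vec
      ((hB.contDiffAt_tensLoc q).differentiableAt (by simp))
      ((hα.contDiffAt q).differentiableAt (by simp)) ((hβ.contDiffAt q).differentiableAt (by simp))
      (Filter.Eventually.of_forall fun z => hB.tensLoc_skew q z) (hP.tensLoc_jacobi q)
      (X := vecLoc X q) (Y := vecLoc Y q)
      (by
        filter_upwards [target_mem_nhds (E := E) q] with y hy
        rw [hX', vecLoc_sharp _ _ hy])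
      (by
        filter_upwards [target_mem_nhds (E := E) q] with y hy
        rw [hY', vecLoc_sharp _ _ hy])
    rw [← localExpr_courantForm hX hα hY hβ, ← chartD_mlieBracket,
      ← vecLoc_sharp _ _ (mem_extChartAt_target q), vecLoc_chart _ (mem_extChartAt_source q)] at h1
    rw [mem_graph]
    exact chartD_injective (E := E) (mem_extChartAt_source q) h1

lemma mem_exactGauge {D : GenDistribution E M} {Θ : OneForm E M} {q : M} {X : Tan E q}
    {α : Cot E q} : (X, α) ∈ exactGauge D Θ q ↔ (X, α - extd Θ q X) ∈ D q := by
  constructor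
  · rintro ⟨⟨Y, β⟩, hY, h⟩
    have h1 : Y = X := congrArg Prod.fst h
    have h2 : β + extd Θ q Y = α := congrArg Prod.snd h
    rw [← h2, ← h1, add_sub_cancel_right]
    exact hY
  · intro h
    refine ⟨(X, α - extd Θ q X), h, ?_⟩
    simp

lemma extd_skew (Θ : OneForm E M) (q : M) (X Y : Tan E q) : extd Θ q X Y = - extd Θ q Y X :=
  extdVec_swap (localExpr Θ q) (extChartAt 𝓘(ℝ, E) q q) (chartD E q q X) (chartD E q q Y)

/-- A gauge transformation by an exact 2-form is compatible with the 1-form component of the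
Courant bracket. -/
lemma courantForm_gauge {Θ : OneForm E M} (hΘ : SmoothOneForm Θ) {X Y : VField E M}
    {α β : OneForm E M} (hX : SmoothVField X)
    (hα : SmoothOneForm α) (hY : SmoothVField Y) (hβ : SmoothOneForm β) (q : M) :
    courantForm X (α - contr Θ X) Y (β - contr Θ Y) q =
      courantForm X α Y β q - extd Θ q (VectorField.mlieBracket 𝓘(ℝ, E) X Y q) := by
  have hα' := hα.sub (hΘ.contr hX)
  have hβ' := hβ.sub (hΘ.contr hY)
  set y := extChartAt 𝓘(ℝ, E) q q with hy
  set B := extdBil (localExpr Θ q)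
  have hBs : ContDiffAt ℝ ∞ B y := contDiffAt_extdBil (hΘ.contDiffAt q)
  have hB : DifferentiableAt ℝ B y := hBs.differentiableAt (by simp)
  have hXd := (hX.contDiffAt q).differentiableAt (by simp)
  have hYd := (hY.contDiffAt q).differentiableAt (by simp)
  have hαd := (hα.contDiffAt q).differentiableAt (by simp)
  have hβd := (hβ.contDiffAt q).differentiableAt (by simp)
  have h1 : ∀ {γ : OneForm E M} {Z : VField E M},
      localExpr (γ - contr Θ Z) q =ᶠ[𝓝 y] fun z => localExpr γ q z - B z (vecLoc Z q z) := by
    intro γ Z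
    filter_upwards [target_mem_nhds (E := E) q] with z hz
    rw [localExpr_sub, localExpr_contr hΘ Z hz]
  have h2 : ∀ {γ : OneForm E M} {Z : VField E M}, DifferentiableAt ℝ (localExpr γ q) y →
      DifferentiableAt ℝ (vecLoc Z q) y → ∀ u v,
      extdBil (localExpr (γ - contr Θ Z) q) y u v = extdBil (localExpr γ q) y u v
        - extdVec (fun z => B z (vecLoc Z q z)) y u v := by
    intro γ Z hγ hZ u v
    rw [extdBil_apply, extdVec_congr h1]
    have h3 := fderiv_fun_sub hγ (hB.clm_apply hZ)
    simp only [extdVec, h3, sub_apply, extdBil_apply]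
    ring
  have h3 : fderiv ℝ (fun z => localExpr (β - contr Θ Y) q z (vecLoc X q z)
        - localExpr (α - contr Θ X) q z (vecLoc Y q z)) y =
      fderiv ℝ (fun z => localExpr β q z (vecLoc X q z)
        - localExpr α q z (vecLoc Y q z)) y
      + (2 : ℝ) • fderiv ℝ (fun z => B z (vecLoc X q z) (vecLoc Y q z)) y := by
    have h4 : (fun z => localExpr (β - contr Θ Y) q z (vecLoc X q z)
        - localExpr (α - contr Θ X) q z (vecLoc Y q z)) =ᶠ[𝓝 y] fun z =>
        (localExpr β q z (vecLoc X q z) - localExpr α q z (vecLoc Y q z))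
        + (2 : ℝ) • B z (vecLoc X q z) (vecLoc Y q z) := by
      filter_upwards [h1 (γ := β) (Z := Y), h1 (γ := α) (Z := X)] with z h5 h6
      rw [h5, h6]
      simp only [sub_apply, smul_eq_mul]
      have := extdVec_swap (localExpr Θ q) z (vecLoc X q z) (vecLoc Y q z)
      simp only [B, extdBil_apply]
      linarith
    have h7 : DifferentiableAt ℝ (fun z => B z (vecLoc X q z) (vecLoc Y q z)) y :=
      (hB.clm_apply hXd).clm_apply hYd
    rw [h4.fderiv_eq]
    refine (fderiv_fun_add ((hβd.clm_apply hXd).sub (hαd.clm_apply hYd))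
      (h7.const_smul (2 : ℝ))).trans ?_
    exact congrArg _ (fderiv_const_smul h7 (2 : ℝ))
  have h5 : localExpr (courantForm X (α - contr Θ X) Y (β - contr Θ Y)) q y =
      localExpr (courantForm X α Y β) q y -
        B y (chartD E q q (VectorField.mlieBracket 𝓘(ℝ, E) X Y q)) := by
    ext v
    rw [localExpr_courantForm hX hα' hY hβ', localExpr_courantForm hX hα hY hβ,
      chartD_mlieBracket, ← hy, h3]
    have h6 := contr_lieBracket_vec hB hXd hYd (fun z u v => extdVec_swap _ _ _ _)
      (extdBil_closed (hΘ.contDiffAt q)) v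
    simp only [sub_apply, add_apply, smul_apply, smul_eq_mul, h2 hβd hYd, h2 hαd hXd]
    simp only [B] at h6 ⊢
    linarith
  have h6 : covE (courantForm X (α - contr Θ X) Y (β - contr Θ Y)) q =
      covE (courantForm X α Y β) q -
        extdE Θ q (vecE (VectorField.mlieBracket 𝓘(ℝ, E) X Y) q) := by
    ext v
    rw [sub_apply, oneForm_eq_localExpr _ (mem_extChartAt_source q),
      oneForm_eq_localExpr _ (mem_extChartAt_source q), h5, extd_eq_extdVec]
    rfl
  exact h6

/-- Exact gauge transformations preserve Dirac structures. -/
theorem IsDirac.exactGauge {D : GenDistribution E M} (hD : IsDirac D) {Θ : OneForm E M}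
    (hΘ : SmoothOneForm Θ) : IsDirac (exactGauge D Θ) where
  smooth := by
    rintro q ⟨X, α⟩ he
    rw [mem_exactGauge] at he
    obtain ⟨Y, β, hs, h⟩ := hD.smooth q _ he
    refine ⟨Y, β + contr Θ Y, ⟨hs.smooth_fst, hs.smooth_snd.add (hΘ.contr hs.smooth_fst),
      fun p => ?_⟩, ?_⟩
    · rw [mem_exactGauge]
      simpa [contr] using hs.mem p
    · simp only [Prod.mk.injEq] at h
      simp [contr, h.1, h.2]
  lagrangian := by
    intro q X α
    rw [mem_exactGauge, hD.lagrangian]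
    constructor
    · intro h Y β hY
      have h1 := h Y _ (mem_exactGauge.1 hY)
      have h2 := extd_skew Θ q X Y
      simp only [sub_apply] at h1
      linarith
    · intro h Y β hY
      have h1 := h Y (β + extd Θ q Y) (mem_exactGauge.2 (by simpa using hY))
      have h2 := extd_skew Θ q X Y
      simp only [add_apply] at h1
      simp only [sub_apply]
      linarith
  involutive := by
    rintro X α Y β ⟨hX, hα, hXα⟩ ⟨hY, hβ, hYβ⟩
    refine ⟨hX.mlieBracket hY, SmoothOneForm.courantForm hX hα hY hβ, fun q => ?_⟩
    have h1 : IsSection D X (α - contr Θ X) :=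
      ⟨hX, hα.sub (hΘ.contr hX), fun p => mem_exactGauge.1 (hXα p)⟩
    have h2 : IsSection D Y (β - contr Θ Y) :=
      ⟨hY, hβ.sub (hΘ.contr hY), fun p => mem_exactGauge.1 (hYβ p)⟩
    have h3 := (hD.involutive _ _ _ _ h1 h2).mem q
    rw [mem_exactGauge, ← courantForm_gauge hΘ hX hα hY hβ]
    exact h3

/-- A Dirac structure is determined by its characteristic distribution and its leafwise form. -/
lemma IsDirac.mem_iff {D : GenDistribution E M} (hD : IsDirac D) {q : M} {X : Tan E q}
    {α : Cot E q} :
    (X, α) ∈ D q ↔ X ∈ charDist D q ∧ ∀ Y ∈ charDist D q, α Y = - leafForm D q X Y := by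
  have hform : ∀ {X : Tan E q} {α : Cot E q}, (X, α) ∈ D q → ∀ Y ∈ charDist D q,
      leafForm D q X Y = - α Y := by
    rintro X α hX Y ⟨⟨Y', β⟩, hY, rfl⟩
    have h : ∃ α : Cot E q, (X, α) ∈ D q := ⟨α, hX⟩
    rw [leafForm, dif_pos h]
    have h1 := (hD.lagrangian q X α).1 hX Y' β hY
    have h2 := (hD.lagrangian q X h.choose).1 h.choose_spec Y' β hY
    change - h.choose Y' = - α Y'
    linarith
  constructor
  · intro h
    refine ⟨⟨(X, α), h, rfl⟩, fun Y hY => ?_⟩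
    rw [hform h Y hY, neg_neg]
  · rintro ⟨⟨⟨X', β⟩, hX, rfl⟩, hα⟩
    change (X', α) ∈ D q
    refine (hD.lagrangian q X' α).2 fun Y γ hY => ?_
    have h1 := (hD.lagrangian q X' β).1 hX Y γ hY
    have hYC : Y ∈ charDist D q := ⟨(Y, γ), hY, rfl⟩
    have h2 := hα Y hYC
    have h3 := hform hX Y hYC
    change α Y = - leafForm D q X' Y at h2
    linarith

/-- The leafwise form does not depend on the covector chosen in its definition. -/
lemma IsDirac.leafForm_eq {D : GenDistribution E M} (hD : IsDirac D) {q : M} {X Y : Tan E q}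
    {α : Cot E q} (h : (X, α) ∈ D q) (hY : Y ∈ charDist D q) : leafForm D q X Y = - α Y := by
  have := (hD.mem_iff.1 h).2 Y hY
  linarith

lemma IsDirac.ext {D D' : GenDistribution E M} (hD : IsDirac D) (hD' : IsDirac D')
    (hC : charDist D = charDist D') (hω : ∀ q, ∀ X ∈ charDist D q, ∀ Y ∈ charDist D q,
      leafForm D q X Y = leafForm D' q X Y) : D = D' := by
  funext q
  ext ⟨X, α⟩
  rw [hD.mem_iff, hD'.mem_iff, ← hC]
  refine and_congr_right fun hX => forall₂_congr fun Y hY => ?_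
  rw [hω q X hX Y hY]

end Tensors

/-! ### Integrals depending smoothly on a parameter -/

section ParametricIntegral

open MeasureTheory

variable {F : Type*} [NormedAddCommGroup F] [NormedSpace ℝ F] {HZ : Type*} [TopologicalSpace HZ]
  {I : ModelWithCorners ℝ F HZ} {Z : Type*} [TopologicalSpace Z] [ChartedSpace HZ Z]
  [IsManifold I ∞ Z] [IsManifold I 1 Z]
  {E : Type*} [NormedAddCommGroup E] [NormedSpace ℝ E]
  {W : Type*} [NormedAddCommGroup W] [NormedSpace ℝ W]

/-- The derivative in the vector variable of a jointly smooth family is jointly smooth. -/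
lemma contMDiffAt_partial_fderiv {k : Z → E → W} {z : Z} {y : E}
    (hk : ContMDiffAt (I.prod 𝓘(ℝ, E)) 𝓘(ℝ, W) ∞ (Function.uncurry k) (z, y)) :
    ContMDiffAt (I.prod 𝓘(ℝ, E)) 𝓘(ℝ, E →L[ℝ] W) ∞ (fun p : Z × E => fderiv ℝ (k p.1) p.2)
      (z, y) := by
  have h1 : ContMDiffAt ((I.prod 𝓘(ℝ, E)).prod 𝓘(ℝ, E)) 𝓘(ℝ, W) ∞
      (Function.uncurry fun (p : Z × E) (x : E) => k p.1 x) ((z, y), y) := by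
    have h2 : ContMDiffAt ((I.prod 𝓘(ℝ, E)).prod 𝓘(ℝ, E)) (I.prod 𝓘(ℝ, E)) ∞
        (fun p : (Z × E) × E => (p.1.1, p.2)) ((z, y), y) :=
      (contMDiffAt_fst.comp _ contMDiffAt_fst).prodMk contMDiffAt_snd
    exact ContMDiffAt.comp (g := Function.uncurry k) ((z, y), y) hk h2
  have h3 := ContMDiffAt.mfderiv (m := ∞) (fun (p : Z × E) (x : E) => k p.1 x) Prod.snd
    (x₀ := (z, y)) h1 contMDiffAt_snd (by simp)
  simp only [mfderiv_eq_fderiv] at h3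
  refine h3.congr_of_eventuallyEq (Filter.Eventually.of_forall fun p => ?_)
  ext v
  simp only [inTangentCoordinates, inCoordinates_tangent_bundle_core_model_space]

lemma contMDiffOn_partial_fderiv_apply {k : Z → E → W} {U : Set E} (hU : IsOpen U)
    (hk : ContMDiffOn (I.prod 𝓘(ℝ, E)) 𝓘(ℝ, W) ∞ (Function.uncurry k) (Set.univ ×ˢ U)) (v : E) :
    ContMDiffOn (I.prod 𝓘(ℝ, E)) 𝓘(ℝ, W) ∞ (Function.uncurry fun z y => fderiv ℝ (k z) y v)
      (Set.univ ×ˢ U) := by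
  rintro ⟨z, y⟩ hp
  have h := contMDiffAt_partial_fderiv
    (hk.contMDiffAt ((isOpen_univ.prod hU).mem_nhds hp))
  exact (h.clm_apply contMDiffAt_const).contMDiffWithinAt

lemma differentiableAt_of_contMDiffOn {k : Z → E → W} {U : Set E} (hU : IsOpen U)
    (hk : ContMDiffOn (I.prod 𝓘(ℝ, E)) 𝓘(ℝ, W) ∞ (Function.uncurry k) (Set.univ ×ˢ U)) (z : Z)
    {y : E} (hy : y ∈ U) : DifferentiableAt ℝ (k z) y := by
  have h1 := hk.contMDiffAt ((isOpen_univ.prod hU).mem_nhds (Set.mk_mem_prod (Set.mem_univ z) hy))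
  have h2 : ContMDiffAt 𝓘(ℝ, E) 𝓘(ℝ, W) ∞ (k z) y :=
    ContMDiffAt.comp (g := Function.uncurry k) (f := fun x : E => (z, x)) y h1
      (contMDiffAt_const.prodMk contMDiffAt_id)
  exact (contMDiffAt_iff_contDiffAt.1 h2).differentiableAt (by simp)

variable {S : Type*} [MeasurableSpace S] {m : Measure S} [IsFiniteMeasure m]

lemma aestronglyMeasurable_comp_of_continuousOn {k : Z → E → W} {U : Set E}
    (hk : ContinuousOn (Function.uncurry k) (Set.univ ×ˢ U))
    {z : S → Z} (hz : AEStronglyMeasurable z m) {y : E} (hy : y ∈ U) :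
    AEStronglyMeasurable (fun s => k (z s) y) m := by
  have : Continuous fun x => k x y := by
    rw [← continuousOn_univ]
    exact hk.comp (g := Function.uncurry k) (f := fun x => (x, y)) (by fun_prop)
      fun x _ => ⟨trivial, hy⟩
  exact this.comp_aestronglyMeasurable hz

/-- On a finite measure space, an integral of functions of `y` that depend smoothly on a parameter
ranging in a compact set may be differentiated under the integral sign. -/
lemma hasFDerivAt_integral_of_contMDiffOn [FiniteDimensional ℝ E] {k : Z → E → W} {U : Set E}
    (hU : IsOpen U)
    (hk : ContMDiffOn (I.prod 𝓘(ℝ, E)) 𝓘(ℝ, W) ∞ (Function.uncurry k) (Set.univ ×ˢ U))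
    {z : S → Z} (hz : AEStronglyMeasurable z m) {K : Set Z} (hK : IsCompact K)
    (hzK : ∀ s, z s ∈ K) {y : E} (hy : y ∈ U) :
    HasFDerivAt (fun x => ∫ s, k (z s) x ∂m) (∫ s, fderiv ℝ (k (z s)) y ∂m) y := by
  obtain ⟨r, hr, hrU⟩ := Metric.nhds_basis_closedBall.mem_iff.1 (hU.mem_nhds hy)
  have hd : ContinuousOn (Function.uncurry fun z y => fderiv ℝ (k z) y) (Set.univ ×ˢ U) :=
    fun p hp => (contMDiffAt_partial_fderiv
      (hk.contMDiffAt ((isOpen_univ.prod hU).mem_nhds hp))).continuousAt.continuousWithinAt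
  obtain ⟨C, hC⟩ := (hK.prod (isCompact_closedBall y r)).exists_bound_of_continuousOn
    (hd.mono (Set.prod_mono (Set.subset_univ _) hrU))
  obtain ⟨C₀, hC₀⟩ := (hK.prod (isCompact_singleton (x := y))).exists_bound_of_continuousOn
    (hk.continuousOn.mono (Set.prod_mono (Set.subset_univ _) (Set.singleton_subset_iff.2 hy)))
  refine hasFDerivAt_integral_of_dominated_of_fderiv_le
    (F' := fun x s => fderiv ℝ (k (z s)) x) (bound := fun _ => C)
    (Metric.closedBall_mem_nhds y hr) ?_ ?_ ?_ ?_ (integrable_const C) ?_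
  · filter_upwards [hU.mem_nhds hy] with x hx
    exact aestronglyMeasurable_comp_of_continuousOn hk.continuousOn hz hx
  · exact Integrable.of_bound (aestronglyMeasurable_comp_of_continuousOn hk.continuousOn hz hy)
      C₀ (Filter.Eventually.of_forall fun s => hC₀ (z s, y) ⟨hzK s, rfl⟩)
  · exact aestronglyMeasurable_comp_of_continuousOn hd hz hy
  · exact Filter.Eventually.of_forall fun s x hx => hC (z s, x) ⟨hzK s, hx⟩
  · exact Filter.Eventually.of_forall fun s x hx =>
      (differentiableAt_of_contMDiffOn hU hk (z s) (hrU hx)).hasFDerivAt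

lemma integrable_of_contMDiffOn {k : Z → E → W} {U : Set E}
    (hk : ContMDiffOn (I.prod 𝓘(ℝ, E)) 𝓘(ℝ, W) ∞ (Function.uncurry k) (Set.univ ×ˢ U))
    {z : S → Z} (hz : AEStronglyMeasurable z m) {K : Set Z} (hK : IsCompact K)
    (hzK : ∀ s, z s ∈ K) {y : E} (hy : y ∈ U) : Integrable (fun s => k (z s) y) m := by
  obtain ⟨C₀, hC₀⟩ := (hK.prod (isCompact_singleton (x := y))).exists_bound_of_continuousOn
    (hk.continuousOn.mono (Set.prod_mono (Set.subset_univ _) (Set.singleton_subset_iff.2 hy)))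
  exact Integrable.of_bound (aestronglyMeasurable_comp_of_continuousOn hk.continuousOn hz hy)
      C₀ (Filter.Eventually.of_forall fun s => hC₀ (z s, y) ⟨hzK s, rfl⟩)

lemma integrable_fderiv_of_contMDiffOn {k : Z → E → W} {U : Set E}
    (hU : IsOpen U)
    (hk : ContMDiffOn (I.prod 𝓘(ℝ, E)) 𝓘(ℝ, W) ∞ (Function.uncurry k) (Set.univ ×ˢ U))
    {z : S → Z} (hz : AEStronglyMeasurable z m) {K : Set Z} (hK : IsCompact K)
    (hzK : ∀ s, z s ∈ K) {y : E} (hy : y ∈ U) : Integrable (fun s => fderiv ℝ (k (z s)) y) m := by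
  refine integrable_of_contMDiffOn (I := I) (U := U) (k := fun z y => fderiv ℝ (k z) y) ?_
    hz hK hzK hy
  exact fun p hp => (contMDiffAt_partial_fderiv
      (hk.contMDiffAt ((isOpen_univ.prod hU).mem_nhds hp))).contMDiffWithinAt

/-- An integral of functions depending smoothly on a parameter in a compact set is smooth. In the
induction on the order, the directional derivatives of the integral are integrals of the same
type. -/
lemma contDiffOn_integral_of_contMDiffOn [FiniteDimensional ℝ E] {k : Z → E → W} {U : Set E}
    (hU : IsOpen U)
    (hk : ContMDiffOn (I.prod 𝓘(ℝ, E)) 𝓘(ℝ, W) ∞ (Function.uncurry k) (Set.univ ×ˢ U))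
    {z : S → Z} (hz : AEStronglyMeasurable z m) {K : Set Z} (hK : IsCompact K)
    (hzK : ∀ s, z s ∈ K) : ContDiffOn ℝ ∞ (fun x => ∫ s, k (z s) x ∂m) U := by
  refine contDiffOn_infty.2 fun n => ?_
  induction n generalizing k with
  | zero =>
    exact contDiffOn_zero.2 fun y hy =>
      (hasFDerivAt_integral_of_contMDiffOn hU hk hz hK hzK hy).continuousAt.continuousWithinAt
  | succ n ih =>
    rw [Nat.cast_succ]
    refine (contDiffOn_succ_iff_fderiv_apply hU.uniqueDiffOn).2
      ⟨fun y hy => (hasFDerivAt_integral_of_contMDiffOn hU hk hz hK hzK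
        hy).differentiableAt.differentiableWithinAt, fun h => absurd h (WithTop.coe_ne_top (a := (n : ℕ∞))), fun v => ?_⟩
    refine (ih (contMDiffOn_partial_fderiv_apply hU hk v)).congr fun y hy => ?_
    rw [fderivWithin_of_isOpen hU hy,
      (hasFDerivAt_integral_of_contMDiffOn hU hk hz hK hzK hy).fderiv,
      ContinuousLinearMap.integral_apply (integrable_fderiv_of_contMDiffOn hU hk hz hK hzK hy)]

end ParametricIntegral

/-! ### Left-invariant vector fields in a chart -/

section Exponential

variable {F : Type*} [NormedAddCommGroup F] [NormedSpace ℝ F] [FiniteDimensional ℝ F]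
  {G : Type*} [TopologicalSpace G] [ChartedSpace F G] [Group G] [LieGroup 𝓘(ℝ, F) ∞ G]

instance isManifold_of_lieGroup : IsManifold 𝓘(ℝ, F) ∞ G :=
  LieGroup.toContMDiffMul.toIsManifold

variable (F G) in
/-- The coordinates of the identity in the preferred chart at the identity. -/
def unitLoc : F := extChartAt 𝓘(ℝ, F) (1 : G) 1

variable (F G) in
/-- The multiplication in the preferred chart at the identity. -/
def mulLoc (y x : F) : F :=
  extChartAt 𝓘(ℝ, F) (1 : G) ((extChartAt 𝓘(ℝ, F) (1 : G)).symm y *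
    (extChartAt 𝓘(ℝ, F) (1 : G)).symm x)

variable (F G) in
/-- In the preferred chart at the identity, the left-invariant vector field generated by `a` takes
the value `leftLoc F G y a` at `y`. -/
def leftLoc (y : F) : F →L[ℝ] F :=
  (fderiv ℝ (mulLoc F G y) (unitLoc F G)).comp (chartD F (1 : G) 1)

lemma unitLoc_symm : (extChartAt 𝓘(ℝ, F) (1 : G)).symm (unitLoc F G) = 1 :=
  (extChartAt 𝓘(ℝ, F) (1 : G)).left_inv (mem_extChartAt_source 1)

lemma unitLoc_mem : unitLoc F G ∈ (extChartAt 𝓘(ℝ, F) (1 : G)).target := mem_extChartAt_target 1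

lemma contDiffAt_mulLoc {y : F} (hy : y ∈ (extChartAt 𝓘(ℝ, F) (1 : G)).target) :
    ContDiffAt ℝ ∞ (Function.uncurry (mulLoc F G)) (y, unitLoc F G) := by
  have h1 : ContMDiffAt (𝓘(ℝ, F).prod 𝓘(ℝ, F)) 𝓘(ℝ, F) ∞
      (fun p : F × F => (extChartAt 𝓘(ℝ, F) (1 : G)).symm p.1 *
        (extChartAt 𝓘(ℝ, F) (1 : G)).symm p.2) (y, unitLoc F G) :=
    ContMDiffAt.mul (ContMDiffAt.comp (y, unitLoc F G) (contMDiffAt_chart_symm hy) contMDiffAt_fst)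
      (ContMDiffAt.comp (y, unitLoc F G) (contMDiffAt_chart_symm unitLoc_mem) contMDiffAt_snd)
  have h2 : (extChartAt 𝓘(ℝ, F) (1 : G)).symm y * (extChartAt 𝓘(ℝ, F) (1 : G)).symm (unitLoc F G)
      ∈ (extChartAt 𝓘(ℝ, F) (1 : G)).source := by
    rw [unitLoc_symm, mul_one]
    exact (extChartAt 𝓘(ℝ, F) (1 : G)).map_target hy
  have h3 : ContMDiffAt (𝓘(ℝ, F).prod 𝓘(ℝ, F)) 𝓘(ℝ, F) ∞ (Function.uncurry (mulLoc F G))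
      (y, unitLoc F G) := ContMDiffAt.comp (I' := 𝓘(ℝ, F)) (y, unitLoc F G)
        (contMDiffAt_chart h2) h1
  rw [← modelWithCornersSelf_prod, chartedSpaceSelf_prod] at h3
  exact contMDiffAt_iff_contDiffAt.1 h3

lemma contDiffAt_leftLoc {y : F} (hy : y ∈ (extChartAt 𝓘(ℝ, F) (1 : G)).target) :
    ContDiffAt ℝ ∞ (leftLoc F G) y := by
  have h := ContDiffAt.fderiv (m := ∞) (n := ∞) (f := mulLoc F G) (g := fun _ => unitLoc F G)
    (x₀ := y) (contDiffAt_mulLoc hy) contDiffAt_const (by simp)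
  exact h.clm_comp contDiffAt_const

/-- The left-invariant vector field, with values in the model space. -/
def leftField (a : F) (g : G) : F := tmap F (fun h : G => g * h) 1 a

lemma chartD_leftField {y : F} (hy : y ∈ (extChartAt 𝓘(ℝ, F) (1 : G)).target) (a : F) :
    chartD F (1 : G) ((extChartAt 𝓘(ℝ, F) (1 : G)).symm y)
      (leftField a ((extChartAt 𝓘(ℝ, F) (1 : G)).symm y)) = leftLoc F G y a := by
  set g := (extChartAt 𝓘(ℝ, F) (1 : G)).symm y with hg
  have h1 := fderiv_mapLoc (f := fun h : G => g * h) (q := 1) (p := 1) (r := 1)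
    (mem_extChartAt_source 1)
    (by rw [mul_one]; exact (extChartAt 𝓘(ℝ, F) (1 : G)).map_target hy)
    ((contMDiff_mul_left (I := 𝓘(ℝ, F)) (n := ∞) (a := g)).contMDiffAt.mdifferentiableAt
      (by simp)) (chartD F (1 : G) 1 a)
  rw [chartDs_chartD (mem_extChartAt_source 1)] at h1
  have h2 : chartD F (1 : G) (g * 1) (tmap F (fun h : G => g * h) 1 a) =
      chartD F (1 : G) g (tmap F (fun h : G => g * h) 1 a) := by rw [mul_one]
  exact (h1.trans h2).symm

lemma leftField_one (a : F) : leftField a (1 : G) = a := by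
  have h1 : (fun h : G => 1 * h) = fun h => h := by funext h; rw [one_mul]
  rw [leftField, h1]
  exact DFunLike.congr_fun (mfderiv_id (I := 𝓘(ℝ, F)) (x := (1 : G))) a

lemma leftLoc_unitLoc (a : F) : leftLoc F G (unitLoc F G) a = chartD F (1 : G) 1 a := by
  rw [← chartD_leftField (G := G) unitLoc_mem a, unitLoc_symm, leftField_one]

lemma eq_of_hasDerivWithinAt_zero {V : Type*} [NormedAddCommGroup V] [NormedSpace ℝ V]
    {f : ℝ → V} {s : Set ℝ} (hs : Convex ℝ s) (hf : ∀ t ∈ s, HasDerivWithinAt f 0 s t) {x y : ℝ}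
    (hx : x ∈ s) (hy : y ∈ s) : f y = f x := by
  have := hs.norm_image_sub_le_of_norm_hasDerivWithin_le (C := 0) hf (by simp) hx hy
  rw [zero_mul, norm_le_zero_iff, sub_eq_zero] at this
  exact this

variable (F G) in
/-- The local flow of the left-invariant vector fields through the identity, in the preferred
chart: it is defined for a uniform time and Lipschitz in the generating vector. -/
lemma exists_local_flow : ∃ ε > (0 : ℝ), ∃ r > (0 : ℝ), ∃ (L : NNReal) (Y : F → ℝ → F),
    (∀ a ∈ Metric.closedBall (0 : F) r, Y a 0 = unitLoc F G ∧
      ∀ t ∈ Set.Icc (-ε) ε, Y a t ∈ (extChartAt 𝓘(ℝ, F) (1 : G)).target ∧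
        HasDerivWithinAt (Y a) (leftLoc F G (Y a t) a) (Set.Icc (-ε) ε) t) ∧
    ∀ t ∈ Set.Icc (-ε) ε, Y 0 t = unitLoc F G ∧
      LipschitzOnWith L (fun a => Y a t) (Metric.closedBall 0 r) := by
  -- The generating vector is added to the unknowns, with zero velocity, so that the dependence on
  -- it is the dependence of an autonomous system on its initial value.
  have hf : ContDiffAt ℝ 1 (fun p : F × F => (leftLoc F G p.1 p.2, (0 : F))) (unitLoc F G, 0) := by
    have h1 : ContDiffAt ℝ 1 (fun p : F × F => leftLoc F G p.1) (unitLoc F G, 0) :=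
      ContDiffAt.comp (g := leftLoc F G) (unitLoc F G, (0 : F))
        ((contDiffAt_leftLoc unitLoc_mem).of_le (by simp)) contDiffAt_fst
    exact (h1.clm_apply contDiffAt_snd).prodMk contDiffAt_const
  obtain ⟨ε, hε, a, r, L₀, K₀, hr, hpl⟩ := IsPicardLindelof.of_contDiffAt_one hf
  obtain ⟨α, hα, L, hL⟩ := (hpl 0).exists_forall_mem_closedBall_eq_hasDerivWithinAt_lipschitzOnWith
  simp only [zero_sub, zero_add] at hα hL
  have h0 : (0 : ℝ) ∈ Set.Icc (-ε) ε := ⟨by linarith, hε.le⟩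
  have hmem : ∀ {a : F} {r' : ℝ}, a ∈ Metric.closedBall (0 : F) r' →
      ((unitLoc F G, a) : F × F) ∈ Metric.closedBall (unitLoc F G, (0 : F)) r' := by
    intro a r' ha
    rw [← closedBall_prod_same]
    exact ⟨Metric.mem_closedBall_self (dist_nonneg.trans ha), ha⟩
  have hsnd : ∀ a ∈ Metric.closedBall (0 : F) r, ∀ t ∈ Set.Icc (-ε) ε,
      (α (unitLoc F G, a) t).2 = a := by
    intro a ha t ht
    obtain ⟨h1, h2⟩ := hα _ (hmem ha)
    have h3 := eq_of_hasDerivWithinAt_zero (f := fun t => (α (unitLoc F G, a) t).2)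
      (convex_Icc (-ε) ε) (fun s hs => (h2 s hs).snd) h0 ht
    rw [h3, h1]
  have hfst : ∀ a ∈ Metric.closedBall (0 : F) r, ∀ t ∈ Set.Icc (-ε) ε,
      HasDerivWithinAt (fun t => (α (unitLoc F G, a) t).1)
        (leftLoc F G (α (unitLoc F G, a) t).1 a) (Set.Icc (-ε) ε) t := by
    intro a ha t ht
    have h := ((hα _ (hmem ha)).2 t ht).fst
    rwa [hsnd a ha t ht] at h
  have h0r : (0 : F) ∈ Metric.closedBall (0 : F) r := Metric.mem_closedBall_self r.2
  have hzero : ∀ t ∈ Set.Icc (-ε) ε, (α (unitLoc F G, 0) t).1 = unitLoc F G := by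
    intro t ht
    have h3 := eq_of_hasDerivWithinAt_zero (f := fun t => (α (unitLoc F G, 0) t).1)
      (convex_Icc (-ε) ε) (fun s hs => by simpa using hfst 0 h0r s hs) h0 ht
    rw [h3, (hα _ (hmem h0r)).1]
  have hlip : ∀ t ∈ Set.Icc (-ε) ε,
      LipschitzOnWith L (fun a => (α (unitLoc F G, a) t).1) (Metric.closedBall (0 : F) r) := by
    intro t ht
    refine LipschitzOnWith.of_dist_le_mul fun a ha b hb => ?_
    refine le_trans ?_ (((hL t ht).dist_le_mul _ (hmem ha) _ (hmem hb)).trans_eq ?_)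
    · rw [Prod.dist_eq]; exact le_max_left _ _
    · rw [Prod.dist_eq, dist_self, max_eq_right dist_nonneg]
  -- The ball of generating vectors is shrunk so that, by the Lipschitz bound, the curves do not
  -- leave the target of the chart.
  obtain ⟨δ, hδ, hδt⟩ := Metric.mem_nhds_iff.1 (target_mem_nhds (E := F) (1 : G))
  have hL1 : (0 : ℝ) < L + 1 := by positivity
  have hr' : 0 < min (r : ℝ) (δ / (2 * (L + 1))) := lt_min hr (by positivity)
  have hsub : Metric.closedBall (0 : F) (min (r : ℝ) (δ / (2 * (L + 1)))) ⊆
      Metric.closedBall (0 : F) r := Metric.closedBall_subset_closedBall (min_le_left _ _)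
  refine ⟨ε, hε, min (r : ℝ) (δ / (2 * (L + 1))), hr', L, fun a t => (α (unitLoc F G, a) t).1,
    fun a ha => ⟨?_, fun t ht => ⟨hδt ?_, hfst a (hsub ha) t ht⟩⟩,
    fun t ht => ⟨hzero t ht, (hlip t ht).mono hsub⟩⟩
  · change (α (unitLoc F G, a) 0).1 = _
    rw [(hα _ (hmem (hsub ha))).1]
  · have h1 := (hlip t ht).dist_le_mul a (hsub ha) 0 h0r
    simp only [hzero t ht] at h1
    have h2 : dist a 0 ≤ δ / (2 * (L + 1)) := (Metric.mem_closedBall.1 ha).trans (min_le_right _ _)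
    have h3 : (L : ℝ) * dist a 0 ≤ (L + 1) * (δ / (2 * (L + 1))) := by
      gcongr
      linarith
    have h4 : ((L : ℝ) + 1) * (δ / (2 * (L + 1))) = δ / 2 := by field_simp
    rw [Metric.mem_ball]
    change dist (α (unitLoc F G, a) t).1 (unitLoc F G) < δ
    linarith

end Exponential

/-! ### Integral curves of left-invariant vector fields -/

section Exponential

variable {F : Type*} [NormedAddCommGroup F] [NormedSpace ℝ F] [FiniteDimensional ℝ F]
  {G : Type*} [TopologicalSpace G] [ChartedSpace F G] [Group G] [LieGroup 𝓘(ℝ, F) ∞ G]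

/-- The left-invariant vector field with value `a` at the identity. -/
def leftVF (a : F) : VField F G := fun g => leftField (F := F) a g

lemma contMDiff_leftVF (a : F) : ContMDiff 𝓘(ℝ, F) 𝓘(ℝ, F).tangent 1
    (fun g : G => (⟨g, leftVF a g⟩ : TangentBundle 𝓘(ℝ, F) G)) := by
  have : LieGroup 𝓘(ℝ, F) (minSmoothness ℝ 3) G := LieGroup.of_le (n := ∞) (by
    rw [minSmoothness_of_isRCLikeNormedField]
    exact WithTop.coe_le_coe.2 (le_top (a := (3 : ℕ∞))))
  exact (contMDiff_mulInvariantVectorField (I := 𝓘(ℝ, F)) (G := G) a).of_le (by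
    rw [minSmoothness_of_isRCLikeNormedField]; exact one_le_two)

/-- Left-invariance of `leftField`. -/
lemma tmap_mul_left (g h : G) (a : F) :
    tmap F (fun x : G => g * x) h (leftField a h) = leftField a (g * h) := by
  have hd : ∀ (k : G) (x : G), MDifferentiableAt 𝓘(ℝ, F) 𝓘(ℝ, F) (fun x : G => k * x) x :=
    fun k x => (contMDiff_mul_left (I := 𝓘(ℝ, F)) (n := ∞)).contMDiffAt.mdifferentiableAt (by simp)
  have h1 := mfderiv_comp (I' := 𝓘(ℝ, F)) (1 : G) (g := fun x : G => g * x)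
    (f := fun x : G => h * x) (hd g _) (hd h 1)
  have h2 : (fun x : G => g * x) ∘ (fun x : G => h * x) = fun x => g * h * x := by
    funext x; simp [mul_assoc]
  rw [h2] at h1
  have h3 : tmap F (fun x : G => g * h * x) 1 a =
      tmap F (fun x : G => g * x) (h * 1) (tmap F (fun x : G => h * x) 1 a) :=
    DFunLike.congr_fun h1 a
  rw [mul_one] at h3
  exact h3.symm

lemma HasMFDerivAt.mul_left_curve {γ : ℝ → G} {t : ℝ} {a : F} (g : G)
    (h : HasMFDerivAt 𝓘(ℝ, ℝ) 𝓘(ℝ, F) γ t ((1 : ℝ →L[ℝ] ℝ).smulRight (leftVF a (γ t)))) :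
    HasMFDerivAt 𝓘(ℝ, ℝ) 𝓘(ℝ, F) (fun s => g * γ s) t
      ((1 : ℝ →L[ℝ] ℝ).smulRight (leftVF a (g * γ t))) := by
  have hd : HasMFDerivAt 𝓘(ℝ, F) 𝓘(ℝ, F) (fun x : G => g * x) (γ t)
      (mfderiv 𝓘(ℝ, F) 𝓘(ℝ, F) (fun x : G => g * x) (γ t)) :=
    ((contMDiff_mul_left (I := 𝓘(ℝ, F)) (n := ∞)).contMDiffAt.mdifferentiableAt
      (by simp)).hasMFDerivAt
  refine (HasMFDerivAt.comp t hd h).congr_mfderiv ?_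
  refine ContinuousLinearMap.ext fun (s : ℝ) => ?_
  change tmap F (fun x : G => g * x) (γ t) (s • leftField a (γ t)) = s • leftField a (g * γ t)
  rw [map_smul, tmap_mul_left]

lemma isMIntegralCurveOn_iff_of_isOpen {a : F} {γ : ℝ → G} {s : Set ℝ} (hs : IsOpen s) :
    IsMIntegralCurveOn (I := 𝓘(ℝ, F)) γ (leftVF a) s ↔ ∀ t ∈ s,
      HasMFDerivAt 𝓘(ℝ, ℝ) 𝓘(ℝ, F) γ t ((1 : ℝ →L[ℝ] ℝ).smulRight (leftVF a (γ t))) :=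
  ⟨fun h t ht => (h t ht).hasMFDerivAt (hs.mem_nhds ht),
    fun h t ht => (h t ht).hasMFDerivWithinAt⟩

/-- A curve in the preferred chart at the identity that solves the equation of the left-invariant
field gives an integral curve of that field. -/
lemma hasMFDerivAt_symm_curve {a : F} {y : ℝ → F} {t : ℝ}
    (ht : y t ∈ (extChartAt 𝓘(ℝ, F) (1 : G)).target)
    (h : HasDerivAt y (leftLoc F G (y t) a) t) :
    HasMFDerivAt 𝓘(ℝ, ℝ) 𝓘(ℝ, F) (fun s => (extChartAt 𝓘(ℝ, F) (1 : G)).symm (y s)) t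
      ((1 : ℝ →L[ℝ] ℝ).smulRight (leftVF a ((extChartAt 𝓘(ℝ, F) (1 : G)).symm (y t)))) := by
  have h1 : HasMFDerivAt 𝓘(ℝ, F) 𝓘(ℝ, F) (extChartAt 𝓘(ℝ, F) (1 : G)).symm (y t)
      (mfderiv 𝓘(ℝ, F) 𝓘(ℝ, F) (extChartAt 𝓘(ℝ, F) (1 : G)).symm (y t)) :=
    ((contMDiffAt_chart_symm ht).mdifferentiableAt (by simp)).hasMFDerivAt
  refine (HasMFDerivAt.comp t h1 (h.hasFDerivAt.hasMFDerivAt)).congr_mfderiv ?_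
  refine ContinuousLinearMap.ext fun (s : ℝ) => ?_
  change chartDs (1 : G) (y t) (s • leftLoc F G (y t) a) =
    s • leftField a ((extChartAt 𝓘(ℝ, F) (1 : G)).symm (y t))
  have h2 := chartDs_chartD ((extChartAt 𝓘(ℝ, F) (1 : G)).map_target ht)
    (leftField a ((extChartAt 𝓘(ℝ, F) (1 : G)).symm (y t)))
  rw [chartD_leftField ht, (extChartAt 𝓘(ℝ, F) (1 : G)).right_inv ht] at h2
  rw [map_smul, h2]

variable [T2Space G]

/-- Integral curves of a left-invariant field are determined by their value at `0`. -/
lemma leftCurve_unique {a : F} {γ γ' : ℝ → G} {ε : ℝ} (hε : 0 < ε)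
    (h : ∀ t ∈ Set.Ioo (-ε) ε,
      HasMFDerivAt 𝓘(ℝ, ℝ) 𝓘(ℝ, F) γ t ((1 : ℝ →L[ℝ] ℝ).smulRight (leftVF a (γ t))))
    (h' : ∀ t ∈ Set.Ioo (-ε) ε,
      HasMFDerivAt 𝓘(ℝ, ℝ) 𝓘(ℝ, F) γ' t ((1 : ℝ →L[ℝ] ℝ).smulRight (leftVF a (γ' t))))
    (h0 : γ 0 = γ' 0) : Set.EqOn γ γ' (Set.Ioo (-ε) ε) :=
  isMIntegralCurveOn_Ioo_eqOn_of_contMDiff_boundaryless (I := 𝓘(ℝ, F)) (v := leftVF a)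
    (⟨by linarith, hε⟩ : (0 : ℝ) ∈ Set.Ioo (-ε) ε)
    (contMDiff_leftVF a) ((isMIntegralCurveOn_iff_of_isOpen isOpen_Ioo).2 h)
    ((isMIntegralCurveOn_iff_of_isOpen isOpen_Ioo).2 h') h0

/-- One-parameter subgroups are integral curves of left-invariant vector fields. -/
lemma IsOneParameterSubgroup.hasMFDerivAt {a : F} {γ : ℝ → G}
    (hγ : IsOneParameterSubgroup (F := F) a γ) (t : ℝ) :
    HasMFDerivAt 𝓘(ℝ, ℝ) 𝓘(ℝ, F) γ t ((1 : ℝ →L[ℝ] ℝ).smulRight (leftVF a (γ t))) := by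
  have h0 : HasMFDerivAt 𝓘(ℝ, ℝ) 𝓘(ℝ, F) γ 0 ((1 : ℝ →L[ℝ] ℝ).smulRight (leftVF a (γ 0))) := by
    refine hγ.velocity.congr_mfderiv ?_
    have : leftField a (γ 0) = a := by rw [hγ.map_zero, leftField_one]
    exact congrArg (fun v : F => (1 : ℝ →L[ℝ] ℝ).smulRight v) this.symm
  have h1 := HasMFDerivAt.mul_left_curve (γ t) h0
  have h2 : (fun s => γ t * γ s) = fun s => γ (s + t) := by
    funext s; rw [add_comm, hγ.map_add]
  rw [h2, ← hγ.map_add, add_zero] at h1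
  have h4 : HasMFDerivAt 𝓘(ℝ, ℝ) 𝓘(ℝ, ℝ) (fun s : ℝ => s - t) t (ContinuousLinearMap.id ℝ ℝ) :=
    ((hasFDerivAt_id t).sub_const t).hasMFDerivAt
  have h1' : HasMFDerivAt 𝓘(ℝ, ℝ) 𝓘(ℝ, F) (fun s => γ (s + t)) (t - t)
    ((1 : ℝ →L[ℝ] ℝ).smulRight (leftVF a (γ t))) := by rw [sub_self]; exact h1
  have h3 := HasMFDerivAt.comp (f := fun s : ℝ => s - t) t h1' h4
  have h5 : (fun s => γ (s + t)) ∘ (fun s : ℝ => s - t) = γ := by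
    funext s; simp
  rw [h5] at h3
  exact h3

lemma IsOneParameterSubgroup.eq {a : F} {γ γ' : ℝ → G}
    (hγ : IsOneParameterSubgroup (F := F) a γ) (hγ' : IsOneParameterSubgroup (F := F) a γ') :
    γ = γ' := by
  funext t
  have ht := abs_lt.1 (lt_add_one |t|)
  exact leftCurve_unique (lt_of_le_of_lt (abs_nonneg t) (lt_add_one |t|))
    (fun s _ => hγ.hasMFDerivAt s) (fun s _ => hγ'.hasMFDerivAt s)
    (by rw [hγ.map_zero, hγ'.map_zero]) ⟨ht.1, ht.2⟩

lemma IsOneParameterSubgroup.comp_mul {a : F} {γ : ℝ → G}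
    (hγ : IsOneParameterSubgroup (F := F) a γ) (c : ℝ) :
    IsOneParameterSubgroup (F := F) (G := G) (c • a : F) (fun t => γ (c * t)) where
  smooth := hγ.smooth.comp (f := fun t : ℝ => c * t) (contMDiff_iff_contDiff.2 (by fun_prop))
  map_add s t := by rw [mul_add, hγ.map_add]
  map_zero := by rw [mul_zero, hγ.map_zero]
  velocity := by
    have h1 : HasMFDerivAt 𝓘(ℝ, ℝ) 𝓘(ℝ, ℝ) (fun s : ℝ => c * s) 0
        (c • ContinuousLinearMap.id ℝ ℝ) :=
      ((hasFDerivAt_id (0 : ℝ)).const_mul c).hasMFDerivAt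
    have h2 : HasMFDerivAt 𝓘(ℝ, ℝ) 𝓘(ℝ, F) γ (c * 0)
        ((1 : ℝ →L[ℝ] ℝ).smulRight (leftVF a (γ (c * 0)))) := hγ.hasMFDerivAt _
    rw [mul_zero] at h2
    have h3 : leftField a (γ 0) = a := by rw [hγ.map_zero, leftField_one]
    have h2' : HasMFDerivAt 𝓘(ℝ, ℝ) 𝓘(ℝ, F) γ (c * 0)
        ((1 : ℝ →L[ℝ] ℝ).smulRight (leftVF a (γ 0))) := by rw [mul_zero]; exact h2
    refine (HasMFDerivAt.comp (f := fun s : ℝ => c * s) (0 : ℝ) h2' h1).congr_mfderiv ?_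
    refine ContinuousLinearMap.ext fun (s : ℝ) => ?_
    change (c * s) • leftField a (γ 0) = s • (c • a)
    rw [h3, smul_smul, mul_comm]

end Exponential

/-! ### One-parameter subgroups and the exponential map -/

section Exponential

variable {F : Type*} [NormedAddCommGroup F] [NormedSpace ℝ F] [FiniteDimensional ℝ F]
  {G : Type*} [TopologicalSpace G] [ChartedSpace F G] [Group G] [LieGroup 𝓘(ℝ, F) ∞ G] [T2Space G]

/-- An integral curve through the identity of a left-invariant vector field, smooth at time `0`, is
a one-parameter subgroup. -/
lemma isOneParameterSubgroup_of_hasMFDerivAt {a : F} {γ : ℝ → G} (h1 : γ 0 = 1)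
    (h : ∀ t, HasMFDerivAt 𝓘(ℝ, ℝ) 𝓘(ℝ, F) γ t ((1 : ℝ →L[ℝ] ℝ).smulRight (leftVF a (γ t))))
    (hs : ContMDiffAt 𝓘(ℝ, ℝ) 𝓘(ℝ, F) ∞ γ 0) : IsOneParameterSubgroup (F := F) a γ := by
  have hadd : ∀ s t, γ (s + t) = γ s * γ t := by
    intro s t
    have ht := abs_lt.1 (lt_add_one |t|)
    refine leftCurve_unique (a := a) (γ := fun t => γ (s + t)) (γ' := fun t => γ s * γ t)
      (lt_of_le_of_lt (abs_nonneg t) (lt_add_one |t|)) (fun u _ => ?_)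
      (fun u _ => HasMFDerivAt.mul_left_curve (γ s) (h u)) ?_ ⟨ht.1, ht.2⟩
    · have h4 : HasMFDerivAt 𝓘(ℝ, ℝ) 𝓘(ℝ, ℝ) (fun u : ℝ => s + u) u (ContinuousLinearMap.id ℝ ℝ) :=
        ((hasFDerivAt_id u).const_add s).hasMFDerivAt
      exact HasMFDerivAt.comp (f := fun u : ℝ => s + u) u (h (s + u)) h4
    · simp [h1]
  refine ⟨fun t => ?_, hadd, h1, ?_⟩
  · have h2 : γ = fun u => γ t * γ (u - t) := by
      funext u
      rw [← hadd]
      congr 1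
      ring
    rw [h2]
    refine ContMDiffAt.mul contMDiffAt_const ?_
    have h3 : ContMDiffAt 𝓘(ℝ, ℝ) 𝓘(ℝ, ℝ) ∞ (fun u : ℝ => u - t) t :=
      contMDiffAt_iff_contDiffAt.2 (by fun_prop)
    refine ContMDiffAt.comp (f := fun u : ℝ => u - t) t ?_ h3
    rw [sub_self]
    exact hs
  · have h3 := h 0
    refine h3.congr_mfderiv ?_
    have h4 : leftField a (γ 0) = a := by rw [h1, leftField_one]
    exact congrArg (fun v : F => (1 : ℝ →L[ℝ] ℝ).smulRight v) h4

/-- A left-invariant field whose integral curve through the identity exists for a short time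
generates a one-parameter subgroup. -/
lemma exists_isOneParameterSubgroup_of_local {a : F} {ε : ℝ} (hε : 0 < ε) {y : ℝ → F}
    (h0 : y 0 = unitLoc F G)
    (hy : ∀ t ∈ Set.Icc (-ε) ε, y t ∈ (extChartAt 𝓘(ℝ, F) (1 : G)).target ∧
      HasDerivWithinAt y (leftLoc F G (y t) a) (Set.Icc (-ε) ε) t) :
    ∃ γ : ℝ → G, IsOneParameterSubgroup (F := F) a γ ∧
      ∀ t ∈ Set.Ioo (-ε) ε, γ t = (extChartAt 𝓘(ℝ, F) (1 : G)).symm (y t) := by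
  have hloc : ∀ t ∈ Set.Ioo (-ε) ε, HasMFDerivAt 𝓘(ℝ, ℝ) 𝓘(ℝ, F)
      (fun s => (extChartAt 𝓘(ℝ, F) (1 : G)).symm (y s)) t
      ((1 : ℝ →L[ℝ] ℝ).smulRight (leftVF a ((extChartAt 𝓘(ℝ, F) (1 : G)).symm (y t)))) := by
    intro t ht
    obtain ⟨h1, h2⟩ := hy t (Set.Ioo_subset_Icc_self ht)
    exact hasMFDerivAt_symm_curve h1 (h2.hasDerivAt (Icc_mem_nhds ht.1 ht.2))
  -- The left translates of the local curve are integral curves through every point that exist for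
  -- the same time, so the field is complete.
  obtain ⟨γ, hγ0, hγ⟩ := exists_isMIntegralCurve_of_isMIntegralCurveOn (I := 𝓘(ℝ, F))
    (contMDiff_leftVF (G := G) a) hε (fun g =>
      ⟨fun s => g * (extChartAt 𝓘(ℝ, F) (1 : G)).symm (y s), by beta_reduce; rw [h0, unitLoc_symm, mul_one],
        (isMIntegralCurveOn_iff_of_isOpen isOpen_Ioo).2 fun t ht =>
          HasMFDerivAt.mul_left_curve g (hloc t ht)⟩) 1
  have heq : Set.EqOn γ (fun s => (extChartAt 𝓘(ℝ, F) (1 : G)).symm (y s)) (Set.Ioo (-ε) ε) :=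
    leftCurve_unique hε (fun t _ => hγ t) hloc (by rw [hγ0, h0, unitLoc_symm])
  refine ⟨γ, isOneParameterSubgroup_of_hasMFDerivAt hγ0 hγ ?_, heq⟩
  have hcd : ContDiffOn ℝ ∞ y (Set.Icc (-ε) ε) :=
    ODE.contDiffOn_enat_Icc_of_hasDerivWithinAt (n := ⊤) (f := fun _ x => leftLoc F G x a)
      (u := (extChartAt 𝓘(ℝ, F) (1 : G)).target)
      (fun p hp => ContDiffAt.contDiffWithinAt
        (ContDiffAt.comp (g := fun x => leftLoc F G x a) p
          ((contDiffAt_leftLoc hp.2).clm_apply contDiffAt_const) contDiffAt_snd))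
      (fun t ht => (hy t ht).2) (fun t ht => (hy t ht).1)
  have hcd0 : ContDiffAt ℝ ∞ y 0 := hcd.contDiffAt (Icc_mem_nhds (by linarith) hε)
  have h3 : ContMDiffAt 𝓘(ℝ, ℝ) 𝓘(ℝ, F) ∞ (fun s => (extChartAt 𝓘(ℝ, F) (1 : G)).symm (y s)) 0 :=
    ContMDiffAt.comp (I' := 𝓘(ℝ, F)) (0 : ℝ)
      (contMDiffAt_chart_symm (hy 0 ⟨by linarith, hε.le⟩).1) (contMDiffAt_iff_contDiffAt.2 hcd0)
  refine h3.congr_of_eventuallyEq ?_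
  filter_upwards [Ioo_mem_nhds (by linarith : -ε < 0) hε] with t ht using heq ht

/-- Every vector generates a one-parameter subgroup: scale the vector into the ball on which the
local flow exists, and rescale the time. -/
lemma exists_isOneParameterSubgroup (a : F) :
    ∃ γ : ℝ → G, IsOneParameterSubgroup (F := F) a γ := by
  obtain ⟨ε, hε, r, hr, L, Y, hY, -⟩ := exists_local_flow F G
  have h1 : 0 < ‖a‖ + 1 := by positivity
  have ha : (r / (‖a‖ + 1)) • a ∈ Metric.closedBall (0 : F) r := by
    rw [mem_closedBall_zero_iff, norm_smul, Real.norm_of_nonneg (by positivity), div_mul_eq_mul_div,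
      div_le_iff₀ h1]
    nlinarith [norm_nonneg a]
  obtain ⟨γ, hγ, -⟩ := exists_isOneParameterSubgroup_of_local hε (hY _ ha).1 (hY _ ha).2
  have h2 := hγ.comp_mul ((‖a‖ + 1) / r)
  refine ⟨fun t => γ ((‖a‖ + 1) / r * t), ?_⟩
  have h3 : ((‖a‖ + 1) / r) • (r / (‖a‖ + 1)) • a = a := by
    rw [smul_smul]
    have : (‖a‖ + 1) / r * (r / (‖a‖ + 1)) = 1 := by field_simp
    rw [this, one_smul]
  rw [h3] at h2
  exact h2

variable (G) in
/-- The exponential map, on the model space. -/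
def expE (a : F) : G := lieExp (F := F) (G := G) a

lemma IsOneParameterSubgroup.expE_eq {a : F} {γ : ℝ → G}
    (hγ : IsOneParameterSubgroup (F := F) a γ) : expE G a = γ 1 := by
  have h : ∃ γ : ℝ → G, IsOneParameterSubgroup (F := F) a γ := ⟨γ, hγ⟩
  have h1 : expE G a = h.choose 1 := dif_pos h
  rw [h1]
  exact congrFun (h.choose_spec.eq hγ) 1

lemma isOneParameterSubgroup_expE (a : F) :
    IsOneParameterSubgroup (F := F) (G := G) a (fun t : ℝ => expE G (t • a)) := by
  obtain ⟨γ, hγ⟩ := exists_isOneParameterSubgroup (G := G) a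
  have h : (fun t : ℝ => expE G (t • a)) = γ := by
    funext t
    rw [(hγ.comp_mul t).expE_eq, mul_one]
  rwa [h]

lemma expE_zero : expE G (0 : F) = 1 := by
  have := (isOneParameterSubgroup_expE (G := G) (0 : F)).map_zero
  simpa using this

lemma expE_add_smul (a : F) (s t : ℝ) : expE G ((s + t) • a) = expE G (s • a) * expE G (t • a) :=
  (isOneParameterSubgroup_expE (G := G) a).map_add s t

lemma expE_nsmul (a : F) (n : ℕ) : expE G ((n : ℝ) • a) = expE G a ^ n := by
  induction n with
  | zero => simp [expE_zero]
  | succ n ih => rw [Nat.cast_succ, expE_add_smul, ih, one_smul, pow_succ]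

lemma expE_neg (b : F) : expE G (-b) = (expE G b)⁻¹ := by
  rw [eq_inv_iff_mul_eq_one]
  have h := expE_add_smul (G := G) b (-1) 1
  rw [neg_smul, one_smul, neg_add_cancel, zero_smul, expE_zero] at h
  exact h.symm

end Exponential

/-! ### Local behaviour of the exponential map -/

section Exponential

variable {F : Type*} [NormedAddCommGroup F] [NormedSpace ℝ F] [FiniteDimensional ℝ F]
  {G : Type*} [TopologicalSpace G] [ChartedSpace F G] [Group G] [LieGroup 𝓘(ℝ, F) ∞ G]

/-- The time-`τ` value of the local flow is strictly differentiable at `0` in the generating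
vector. -/
lemma hasStrictFDerivAt_local_flow {ε r τ : ℝ} (hr : 0 < r) (hτ : 0 ≤ τ) (hτε : τ ≤ ε) {L : NNReal}
    {Y : F → ℝ → F}
    (hY : ∀ a ∈ Metric.closedBall (0 : F) r, Y a 0 = unitLoc F G ∧
      ∀ t ∈ Set.Icc (-ε) ε, Y a t ∈ (extChartAt 𝓘(ℝ, F) (1 : G)).target ∧
        HasDerivWithinAt (Y a) (leftLoc F G (Y a t) a) (Set.Icc (-ε) ε) t)
    (hL : ∀ t ∈ Set.Icc (-ε) ε, Y 0 t = unitLoc F G ∧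
      LipschitzOnWith L (fun a => Y a t) (Metric.closedBall 0 r)) :
    HasStrictFDerivAt (fun a => Y a τ) (τ • leftLoc F G (unitLoc F G)) 0 := by
  rw [hasStrictFDerivAt_iff_isLittleO, Asymptotics.isLittleO_iff]
  intro η hη
  obtain ⟨K, s, hs, hK⟩ := ((contDiffAt_leftLoc (F := F) (G := G) unitLoc_mem).of_le
    (by simp : (1 : WithTop ℕ∞) ≤ ∞)).exists_lipschitzOnWith
  obtain ⟨ρ, hρ, hρs⟩ := Metric.mem_nhds_iff.1 hs
  have hev : ∀ᶠ a : F in 𝓝 0, ‖a‖ < r ∧ L * ‖a‖ < ρ ∧ K * L * (‖a‖ + ‖a‖) * τ < η := by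
    have h1 : Filter.Tendsto (fun a : F => ‖a‖) (𝓝 0) (𝓝 0) := tendsto_norm_zero
    refine (h1.eventually_lt_const hr).and (Filter.Eventually.and ?_ ?_)
    · have := h1.const_mul (L : ℝ)
      rw [mul_zero] at this
      exact this.eventually_lt_const hρ
    · have := ((h1.add h1).const_mul (K * L : ℝ)).mul_const τ
      simp only [add_zero, mul_zero, zero_mul] at this
      exact this.eventually_lt_const hη
  filter_upwards [hev.prod_nhds hev] with p ⟨⟨ha1, ha2, ha3⟩, ⟨hb1, hb2, hb3⟩⟩
  obtain ⟨a, b⟩ := p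
  simp only at *
  set A := leftLoc F G (unitLoc F G) with hA
  have ha : a ∈ Metric.closedBall (0 : F) r := by simpa using ha1.le
  have hb : b ∈ Metric.closedBall (0 : F) r := by simpa using hb1.le
  have h0 : (0 : F) ∈ Metric.closedBall (0 : F) r := Metric.mem_closedBall_self hr.le
  have hsub : Set.Icc 0 τ ⊆ Set.Icc (-ε) ε := Set.Icc_subset_Icc (by linarith) hτε
  have hnear : ∀ c ∈ Metric.closedBall (0 : F) r, L * ‖c‖ < ρ → ∀ t ∈ Set.Icc (-ε) ε,
      Y c t ∈ s ∧ ‖leftLoc F G (Y c t) - A‖ ≤ K * (L * ‖c‖) := by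
    intro c hc hcρ t ht
    have h1 : dist (Y c t) (unitLoc F G) ≤ L * ‖c‖ := by
      have := (hL t ht).2.dist_le_mul c hc 0 h0
      simpa [(hL t ht).1] using this
    have h2 : Y c t ∈ s := hρs (lt_of_le_of_lt h1 hcρ)
    refine ⟨h2, ?_⟩
    rw [← dist_eq_norm]
    exact (hK.dist_le_mul _ h2 _ (mem_of_mem_nhds hs)).trans (by gcongr)
  -- The error `Y a t - Y b t - t • A (a - b)` vanishes at `t = 0`, and its velocity is bounded by
  -- a multiple of `(‖a‖ + ‖b‖) * ‖a - b‖`.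
  have hD : ∀ t ∈ Set.Icc 0 τ, HasDerivWithinAt (fun t => Y a t - Y b t - t • A (a - b))
      (leftLoc F G (Y a t) a - leftLoc F G (Y b t) b - A (a - b)) (Set.Icc 0 τ) t := by
    intro t ht
    have h1 := ((hY a ha).2 t (hsub ht)).2.mono hsub
    have h2 := ((hY b hb).2 t (hsub ht)).2.mono hsub
    have h3 : HasDerivWithinAt (fun t : ℝ => t • A (a - b)) (A (a - b)) (Set.Icc 0 τ) t := by
      simpa using (hasDerivWithinAt_id t (Set.Icc 0 τ)).smul_const (A (a - b))
    exact (h1.sub h2).sub h3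
  have hbd : ∀ t ∈ Set.Ico 0 τ, ‖leftLoc F G (Y a t) a - leftLoc F G (Y b t) b - A (a - b)‖ ≤
      K * L * (‖a‖ + ‖b‖) * ‖a - b‖ := by
    intro t ht
    have ht' := hsub (Set.Ico_subset_Icc_self ht)
    obtain ⟨h1, h2⟩ := hnear a ha ha2 t ht'
    obtain ⟨h3, h4⟩ := hnear b hb hb2 t ht'
    have h5 : ‖leftLoc F G (Y a t) - leftLoc F G (Y b t)‖ ≤ K * (L * ‖a - b‖) := by
      rw [← dist_eq_norm]
      refine (hK.dist_le_mul _ h1 _ h3).trans ?_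
      gcongr
      rw [← dist_eq_norm]
      exact (hL t ht').2.dist_le_mul a ha b hb
    have h6 : leftLoc F G (Y a t) a - leftLoc F G (Y b t) b - A (a - b) =
        (leftLoc F G (Y a t) - A) (a - b) + (leftLoc F G (Y a t) - leftLoc F G (Y b t)) b := by
      simp only [map_sub, sub_apply]
      abel
    rw [h6]
    refine (norm_add_le _ _).trans ?_
    refine (add_le_add (ContinuousLinearMap.le_of_opNorm_le _ h2 _)
      (ContinuousLinearMap.le_of_opNorm_le _ h5 _)).trans_eq ?_
    ring
  have hfin := norm_image_sub_le_of_norm_deriv_le_segment' hD hbd τ ⟨hτ, le_rfl⟩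
  have hzero : Y a 0 - Y b 0 - (0 : ℝ) • A (a - b) = 0 := by
    rw [(hY a ha).1, (hY b hb).1]; simp
  rw [hzero, sub_zero, sub_zero] at hfin
  refine le_trans (le_of_eq ?_) (hfin.trans ?_)
  · simp
  · have : K * L * (‖a‖ + ‖b‖) * τ ≤ η := by linarith
    calc K * L * (‖a‖ + ‖b‖) * ‖a - b‖ * τ = K * L * (‖a‖ + ‖b‖) * τ * ‖a - b‖ := by ring
      _ ≤ η * ‖a - b‖ := by gcongr

variable [T2Space G]

variable (F G) in
/-- Near `0`, the exponential map is continuous and, in the preferred chart at the identity,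
strictly differentiable at `0` with invertible derivative. -/
lemma exists_local_exp : ∃ (e : F → F) (A : F ≃L[ℝ] F), HasStrictFDerivAt e (A : F →L[ℝ] F) 0 ∧
    e 0 = unitLoc F G ∧ ∃ δ > 0, ContinuousOn e (Metric.ball 0 δ) ∧ ∀ b ∈ Metric.ball (0 : F) δ,
      e b ∈ (extChartAt 𝓘(ℝ, F) (1 : G)).target ∧
      expE G b = (extChartAt 𝓘(ℝ, F) (1 : G)).symm (e b) := by
  obtain ⟨ε, hε, r, hr, L, Y, hY, hL⟩ := exists_local_flow F G
  have hτ : 0 < ε / 2 := by linarith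
  have hτ' : ε / 2 ∈ Set.Icc (-ε) ε := ⟨by linarith, by linarith⟩
  have h1 := hasStrictFDerivAt_local_flow hr hτ.le (by linarith : ε / 2 ≤ ε) hY hL
  have h0 : (0 : F) ∈ Metric.closedBall (0 : F) r := Metric.mem_closedBall_self hr.le
  have hinj : Function.Injective (leftLoc F G (unitLoc F G)) := by
    intro a b hab
    rw [leftLoc_unitLoc, leftLoc_unitLoc] at hab
    exact chartD_injective (mem_extChartAt_source (1 : G)) hab
  let A : F ≃L[ℝ] F := LinearEquiv.toContinuousLinearEquiv
    (LinearEquiv.ofInjectiveEndo (leftLoc F G (unitLoc F G) : F →ₗ[ℝ] F) hinj)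
  have hA : ((A : F →L[ℝ] F)) = leftLoc F G (unitLoc F G) := by
    ext v; rfl
  -- `exp b` is the value at time `ε / 2` of the curve generated by `(ε / 2)⁻¹ • b`.
  have h2 : HasStrictFDerivAt (fun b : F => Y ((ε / 2)⁻¹ • b) (ε / 2)) (A : F →L[ℝ] F) 0 := by
    have h3 : HasStrictFDerivAt (fun b : F => (ε / 2)⁻¹ • b)
        ((ε / 2)⁻¹ • ContinuousLinearMap.id ℝ F) 0 :=
      ((ε / 2)⁻¹ • ContinuousLinearMap.id ℝ F).hasStrictFDerivAt
    have h1' : HasStrictFDerivAt (fun a => Y a (ε / 2)) ((ε / 2) • leftLoc F G (unitLoc F G))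
      ((ε / 2)⁻¹ • (0 : F)) := by rwa [smul_zero]
    refine (h1'.comp (0 : F) h3).congr_fderiv ?_
    rw [hA]
    ext v
    simp only [ContinuousLinearMap.comp_apply, smul_apply, map_smul, ContinuousLinearMap.id_apply,
      smul_smul]
    rw [inv_mul_cancel₀ hτ.ne', one_smul]
  have hball : ∀ b ∈ Metric.ball (0 : F) (ε / 2 * r),
      (ε / 2)⁻¹ • b ∈ Metric.closedBall (0 : F) r := by
    intro b hb
    rw [mem_ball_zero_iff] at hb
    rw [mem_closedBall_zero_iff, norm_smul, norm_inv, Real.norm_of_nonneg hτ.le,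
      inv_mul_le_iff₀ hτ]
    exact hb.le
  refine ⟨_, A, h2, by rw [smul_zero]; exact (hL _ hτ').1, ε / 2 * r, by positivity, ?_, ?_⟩
  · exact (hL _ hτ').2.continuousOn.comp (by fun_prop) hball
  · intro b hb
    obtain ⟨h4, h5⟩ := hY _ (hball b hb)
    refine ⟨(h5 _ hτ').1, ?_⟩
    obtain ⟨γ, hγ, hγY⟩ := exists_isOneParameterSubgroup_of_local hε h4 h5
    rw [← hγY (ε / 2) ⟨by linarith, by linarith⟩]
    have h6 := (hγ.comp_mul (ε / 2)).expE_eq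
    rw [smul_smul, mul_inv_cancel₀ hτ.ne', one_smul, mul_one] at h6
    exact h6

variable (F G) in
/-- The exponential map is continuous and open at `0`. -/
lemma map_expE_nhds_zero : Filter.map (expE G) (𝓝 (0 : F)) = 𝓝 1 := by
  obtain ⟨e, A, he, he0, δ, hδ, -, hexp⟩ := exists_local_exp F G
  have h1 : expE G =ᶠ[𝓝 (0 : F)] (extChartAt 𝓘(ℝ, F) (1 : G)).symm ∘ e := by
    filter_upwards [Metric.ball_mem_nhds (0 : F) hδ] with b hb using (hexp b hb).2
  rw [Filter.map_congr h1, ← Filter.map_map, he.map_nhds_eq_of_equiv, he0, unitLoc]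
  have := map_extChartAt_symm_nhdsWithin_range (I := 𝓘(ℝ, F)) (1 : G)
  simpa using this

variable (F G) in
/-- The exponential map is continuous: it is so near `0`, and `exp a = exp (a / n) ^ n`. -/
lemma continuous_expE : Continuous (expE G : F → G) := by
  have : ContinuousMul G := continuousMul_of_contMDiffMul 𝓘(ℝ, F) ∞
  obtain ⟨e, A, -, -, δ, hδ, hcont, hexp⟩ := exists_local_exp F G
  have hloc : ∀ b ∈ Metric.ball (0 : F) δ, ContinuousAt (expE G) b := by
    intro b hb
    have hnb := Metric.isOpen_ball.mem_nhds hb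
    have h1 : expE G =ᶠ[𝓝 b] (extChartAt 𝓘(ℝ, F) (1 : G)).symm ∘ e := by
      filter_upwards [hnb] with c hc using (hexp c hc).2
    refine ContinuousAt.congr ?_ h1.symm
    exact ContinuousAt.comp (g := (extChartAt 𝓘(ℝ, F) (1 : G)).symm)
      (contMDiffAt_chart_symm (hexp b hb).1).continuousAt (hcont.continuousAt hnb)
  rw [continuous_iff_continuousAt]
  intro a
  obtain ⟨n, hn⟩ := exists_nat_gt (‖a‖ / δ)
  have hn0 : (0 : ℝ) < n := lt_of_le_of_lt (by positivity) hn
  have h1 : (expE G : F → G) = fun b => expE G ((n : ℝ)⁻¹ • b) ^ n := by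
    funext b
    rw [← expE_nsmul, smul_smul, mul_inv_cancel₀ hn0.ne', one_smul]
  rw [h1]
  have h2 : (n : ℝ)⁻¹ • a ∈ Metric.ball (0 : F) δ := by
    rw [mem_ball_zero_iff, norm_smul, norm_inv, Real.norm_of_nonneg hn0.le, inv_mul_lt_iff₀ hn0]
    exact (div_lt_iff₀ hδ).1 hn
  exact (ContinuousAt.comp (f := fun b : F => (n : ℝ)⁻¹ • b) (hloc _ h2) (by fun_prop)).pow n

end Exponential

/-! ### Maps separating the identity -/

section Energy

open MeasureTheory

variable {F : Type*} [NormedAddCommGroup F] [NormedSpace ℝ F] [FiniteDimensional ℝ F]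
  {G : Type*} [TopologicalSpace G] [ChartedSpace F G] [Group G] [LieGroup 𝓘(ℝ, F) ∞ G]

variable (F G) in
/-- A smooth map to a Euclidean space that vanishes exactly at the identity and is immersive
there. -/
lemma exists_separating_map [T2Space G] :
    ∃ ψ : G → EuclideanSpace ℝ (Fin (Module.finrank ℝ (F × ℝ))),
      ContMDiff 𝓘(ℝ, F) 𝓘(ℝ, EuclideanSpace ℝ (Fin (Module.finrank ℝ (F × ℝ)))) ∞ ψ ∧
      (∀ x, ψ x = 0 ↔ x = 1) ∧ Function.Injective
        (fderiv ℝ (fun y => ψ ((extChartAt 𝓘(ℝ, F) (1 : G)).symm y)) (unitLoc F G)) := by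
  obtain ⟨χ⟩ : Nonempty (SmoothBumpFunction 𝓘(ℝ, F) (1 : G)) := inferInstance
  set φ := extChartAt 𝓘(ℝ, F) (1 : G) with hφ
  -- With a bump function `χ` at the identity: `χ x = 1` forces `x` into the chart domain, where
  -- the first component vanishes only at the identity.
  let Ψ : G → F × ℝ := fun x => (χ x • (φ x - unitLoc F G), 1 - χ x)
  have hχ1 : χ 1 = 1 := χ.eq_one
  refine ⟨fun x => toEuclidean (Ψ x), ?_, ?_, ?_⟩
  · have h1 : ContMDiff 𝓘(ℝ, F) 𝓘(ℝ, F) ∞ (fun x => χ x • (φ x - unitLoc F G)) :=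
      χ.contMDiff_smul (contMDiffOn_extChartAt.sub contMDiffOn_const)
    have h2 : ContMDiff 𝓘(ℝ, F) 𝓘(ℝ, ℝ) ∞ (fun x => 1 - χ x) := contMDiff_const.sub χ.contMDiff
    exact (toEuclidean (E := F × ℝ)).contDiff.contMDiff.comp (h1.prodMk_space h2)
  · intro x
    rw [EmbeddingLike.map_eq_zero_iff, Prod.mk_eq_zero]
    constructor
    · rintro ⟨h1, h2⟩
      have h3 : χ x = 1 := by linarith
      have h4 : x ∈ Function.support χ := by
        rw [Function.mem_support, h3]; exact one_ne_zero
      rw [χ.support_eq_inter_preimage] at h4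
      rw [h3, one_smul, sub_eq_zero] at h1
      refine φ.injOn ?_ (mem_extChartAt_source 1) h1
      rw [hφ, extChartAt_source]
      exact h4.1
    · rintro rfl
      rw [hχ1, unitLoc]
      simp [hφ]
  · have hev : ∀ᶠ y in 𝓝 (unitLoc F G), Ψ (φ.symm y) = (y - unitLoc F G, 0) := by
      have hc : Filter.Tendsto φ.symm (𝓝 (unitLoc F G)) (𝓝 1) := by
        have := (contMDiffAt_chart_symm (E := F) (q := (1 : G)) unitLoc_mem).continuousAt
        rwa [ContinuousAt, unitLoc_symm] at this
      filter_upwards [hc.eventually χ.eventuallyEq_one, target_mem_nhds (E := F) (1 : G)]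
        with y hy hyt
      change χ (φ.symm y) = 1 at hy
      simp only [Ψ]
      rw [hy, φ.right_inv hyt]
      simp
    have hd : HasFDerivAt (fun y => toEuclidean (Ψ (φ.symm y)))
        (((toEuclidean (E := F × ℝ)) : (F × ℝ) →L[ℝ] _).comp (ContinuousLinearMap.inl ℝ F ℝ))
        (unitLoc F G) := by
      have h1 : HasFDerivAt (fun y : F => ((y - unitLoc F G, 0) : F × ℝ))
          (ContinuousLinearMap.inl ℝ F ℝ) (unitLoc F G) :=
        ((hasFDerivAt_id (unitLoc F G)).sub_const _).prodMk (hasFDerivAt_const 0 _)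
      exact ((toEuclidean (E := F × ℝ)).hasFDerivAt.comp _ (h1.congr_of_eventuallyEq hev))
    rw [hd.fderiv]
    exact (toEuclidean (E := F × ℝ)).injective.comp (LinearMap.inl_injective (R := ℝ))

/-- A map with injective strict derivative is locally injective. -/
lemma HasStrictFDerivAt.exists_injOn {V W : Type*} [NormedAddCommGroup V] [NormedSpace ℝ V]
    [FiniteDimensional ℝ V] [NormedAddCommGroup W] [NormedSpace ℝ W] {f : V → W} {f' : V →L[ℝ] W}
    {x : V} (hf : HasStrictFDerivAt f f' x) (hinj : Function.Injective f') :
    ∃ s ∈ 𝓝 x, Set.InjOn f s := by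
  obtain ⟨K, hK, hanti⟩ := LinearMap.exists_antilipschitzWith (f' : V →ₗ[ℝ] W)
    (LinearMap.ker_eq_bot.2 hinj)
  have hK' : (0 : ℝ) < K := hK
  rw [hasStrictFDerivAt_iff_isLittleO, Asymptotics.isLittleO_iff] at hf
  have h1 := hf (show (0 : ℝ) < (K : ℝ)⁻¹ / 2 by positivity)
  rw [nhds_prod_eq] at h1
  obtain ⟨s, hs, h2⟩ := Filter.mem_prod_same_iff.1 h1
  refine ⟨s, hs, fun a ha b hb hab => ?_⟩
  have h3 : ‖f a - f b - f' (a - b)‖ ≤ (K : ℝ)⁻¹ / 2 * ‖a - b‖ := h2 (Set.mk_mem_prod ha hb)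
  rw [hab, sub_self, zero_sub, norm_neg] at h3
  have h4 : dist a b ≤ K * dist (f' a) (f' b) := hanti.le_mul_dist a b
  rw [dist_eq_norm, dist_eq_norm, ← map_sub] at h4
  have h5 : (K : ℝ) * ‖f' (a - b)‖ ≤ ‖a - b‖ / 2 := by
    calc (K : ℝ) * ‖f' (a - b)‖ ≤ K * ((K : ℝ)⁻¹ / 2 * ‖a - b‖) := by gcongr
      _ = ‖a - b‖ / 2 := by field_simp
  have h6 : ‖a - b‖ ≤ 0 := by linarith
  exact sub_eq_zero.1 (norm_le_zero_iff.1 h6)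

end Energy

/-! ### A conjugation-invariant energy -/

section Energy

open MeasureTheory

variable {F : Type*} [NormedAddCommGroup F] [NormedSpace ℝ F] [FiniteDimensional ℝ F]
  {G : Type*} [TopologicalSpace G] [ChartedSpace F G] [Group G] [LieGroup 𝓘(ℝ, F) ∞ G]
  {V : Type*} [NormedAddCommGroup V] [InnerProductSpace ℝ V]

/-- The conjugate by `k` of a product of two group elements, given by coordinates in the preferred
chart at the identity, evaluated by `ψ`. -/
def conjMap (ψ : G → V) (k : G) (y x : F) : V :=
  ψ (k⁻¹ * ((extChartAt 𝓘(ℝ, F) (1 : G)).symm y * (extChartAt 𝓘(ℝ, F) (1 : G)).symm x) * k)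

/-- The derivative in the second factor, at the identity, of the squared norm of `conjMap`. -/
def energyDens (ψ : G → V) (k : G) (y : F) : F →L[ℝ] ℝ :=
  fderiv ℝ (fun x => ‖conjMap ψ k y x‖ ^ 2) (unitLoc F G)

/-- The conjugation-invariant energy `h ↦ ∫ ‖ψ(k⁻¹ h k)‖² dk`. -/
def conjEnergy [MeasurableSpace G] (ψ : G → V) (ν : Measure G) (h : G) : ℝ :=
  ∫ k, ‖ψ (k⁻¹ * h * k)‖ ^ 2 ∂ν

/-- The left-trivialized differential of the energy, in the preferred chart at the identity. -/
def energyGrad [MeasurableSpace G] (ψ : G → V) (ν : Measure G) (y : F) : F →L[ℝ] ℝ :=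
  ∫ k, energyDens ψ k y ∂ν

variable {ψ : G → V}

lemma contMDiffAt_conjMap (hψ : ContMDiff 𝓘(ℝ, F) 𝓘(ℝ, V) ∞ ψ) (k : G) {y x : F}
    (hy : y ∈ (extChartAt 𝓘(ℝ, F) (1 : G)).target) (hx : x ∈ (extChartAt 𝓘(ℝ, F) (1 : G)).target) :
    ContMDiffAt ((𝓘(ℝ, F).prod 𝓘(ℝ, F)).prod 𝓘(ℝ, F)) 𝓘(ℝ, V) ∞
      (fun p : (G × F) × F => conjMap ψ p.1.1 p.1.2 p.2) ((k, y), x) := by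
  have hk : ContMDiffAt ((𝓘(ℝ, F).prod 𝓘(ℝ, F)).prod 𝓘(ℝ, F)) 𝓘(ℝ, F) ∞
      (fun p : (G × F) × F => p.1.1) ((k, y), x) := contMDiffAt_fst.comp _ contMDiffAt_fst
  have h1 : ContMDiffAt ((𝓘(ℝ, F).prod 𝓘(ℝ, F)).prod 𝓘(ℝ, F)) 𝓘(ℝ, F) ∞
      (fun p : (G × F) × F => (extChartAt 𝓘(ℝ, F) (1 : G)).symm p.1.2) ((k, y), x) :=
    ContMDiffAt.comp (I' := 𝓘(ℝ, F)) ((k, y), x) (contMDiffAt_chart_symm hy)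
      (contMDiffAt_snd.comp _ contMDiffAt_fst)
  have h2 : ContMDiffAt ((𝓘(ℝ, F).prod 𝓘(ℝ, F)).prod 𝓘(ℝ, F)) 𝓘(ℝ, F) ∞
      (fun p : (G × F) × F => (extChartAt 𝓘(ℝ, F) (1 : G)).symm p.2) ((k, y), x) :=
    ContMDiffAt.comp (I' := 𝓘(ℝ, F)) ((k, y), x) (contMDiffAt_chart_symm hx) contMDiffAt_snd
  exact hψ.contMDiffAt.comp ((k, y), x) ((hk.inv.mul (h1.mul h2)).mul hk)

lemma contMDiffAt_energyDens (hψ : ContMDiff 𝓘(ℝ, F) 𝓘(ℝ, V) ∞ ψ) (k : G) {y : F}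
    (hy : y ∈ (extChartAt 𝓘(ℝ, F) (1 : G)).target) :
    ContMDiffAt (𝓘(ℝ, F).prod 𝓘(ℝ, F)) 𝓘(ℝ, F →L[ℝ] ℝ) ∞
      (fun p : G × F => energyDens ψ p.1 p.2) (k, y) := by
  have h1 : ContMDiffAt ((𝓘(ℝ, F).prod 𝓘(ℝ, F)).prod 𝓘(ℝ, F)) 𝓘(ℝ, ℝ) ∞
      (Function.uncurry fun (p : G × F) (x : F) => ‖conjMap ψ p.1 p.2 x‖ ^ 2)
      ((k, y), unitLoc F G) :=
    ContMDiffAt.comp (I' := 𝓘(ℝ, V)) (g := fun v : V => ‖v‖ ^ 2) ((k, y), unitLoc F G)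
      (contDiff_norm_sq ℝ).contMDiff.contMDiffAt (contMDiffAt_conjMap hψ k hy unitLoc_mem)
  have h2 := contMDiffAt_partial_fderiv h1
  exact ContMDiffAt.comp (f := fun p : G × F => (p, unitLoc F G)) (k, y) h2
    (contMDiffAt_id.prodMk contMDiffAt_const)

/-- The two conjugation maps at the identity coincide, as a product with the identity does not
depend on which factor is the identity. -/
lemma conjMap_swap (k : G) (y : F) :
    conjMap ψ k (unitLoc F G) y = conjMap ψ k y (unitLoc F G) := by
  simp only [conjMap, unitLoc_symm, mul_one, one_mul]

lemma differentiableAt_conjMap (hψ : ContMDiff 𝓘(ℝ, F) 𝓘(ℝ, V) ∞ ψ) (k : G) {y x : F}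
    (hy : y ∈ (extChartAt 𝓘(ℝ, F) (1 : G)).target) (hx : x ∈ (extChartAt 𝓘(ℝ, F) (1 : G)).target) :
    DifferentiableAt ℝ (conjMap ψ k y) x := by
  have h : ContMDiffAt 𝓘(ℝ, F) 𝓘(ℝ, V) ∞ (conjMap ψ k y) x :=
    ContMDiffAt.comp (f := fun x : F => ((k, y), x)) x (contMDiffAt_conjMap hψ k hy hx)
      (contMDiffAt_const.prodMk contMDiffAt_id)
  exact (contMDiffAt_iff_contDiffAt.1 h).differentiableAt (by simp)

lemma energyDens_apply (hψ : ContMDiff 𝓘(ℝ, F) 𝓘(ℝ, V) ∞ ψ) (k : G) {y : F}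
    (hy : y ∈ (extChartAt 𝓘(ℝ, F) (1 : G)).target) (w : F) :
    energyDens ψ k y w = 2 * inner ℝ (conjMap ψ k (unitLoc F G) y)
      (fderiv ℝ (conjMap ψ k y) (unitLoc F G) w) := by
  have h1 := ((differentiableAt_conjMap hψ k hy unitLoc_mem).hasFDerivAt).norm_sq
  rw [energyDens, h1.fderiv, conjMap_swap]
  simp

/-- The Hessian at the identity of the squared norm of `x ↦ ψ (k⁻¹ x k)`: the second derivative
of `ψ` is paired with `ψ 1 = 0` and drops out. -/
lemma fderiv_energyDens (hψ : ContMDiff 𝓘(ℝ, F) 𝓘(ℝ, V) ∞ ψ) (h1 : ψ 1 = 0) (k : G) (v : F) :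
    fderiv ℝ (energyDens ψ k) (unitLoc F G) v v =
      2 * ‖fderiv ℝ (conjMap ψ k (unitLoc F G)) (unitLoc F G) v‖ ^ 2 := by
  have hθ : DifferentiableAt ℝ (energyDens ψ k) (unitLoc F G) := by
    have h : ContMDiffAt 𝓘(ℝ, F) 𝓘(ℝ, F →L[ℝ] ℝ) ∞ (energyDens ψ k) (unitLoc F G) :=
      ContMDiffAt.comp (f := fun x : F => (k, x)) (unitLoc F G)
        (contMDiffAt_energyDens hψ k unitLoc_mem) (contMDiffAt_const.prodMk contMDiffAt_id)
    exact (contMDiffAt_iff_contDiffAt.1 h).differentiableAt (by simp)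
  have hA := (differentiableAt_conjMap hψ k (unitLoc_mem (F := F) (G := G)) unitLoc_mem)
  have hB : DifferentiableAt ℝ (fun y => fderiv ℝ (conjMap ψ k y) (unitLoc F G) v)
      (unitLoc F G) := by
    have h2 := contMDiffAt_partial_fderiv (Z := G × F) (k := fun p x => conjMap ψ p.1 p.2 x)
      (contMDiffAt_conjMap hψ k unitLoc_mem unitLoc_mem)
    have h3 : ContMDiffAt 𝓘(ℝ, F) 𝓘(ℝ, F →L[ℝ] V) ∞
        (fun y => fderiv ℝ (conjMap ψ k y) (unitLoc F G)) (unitLoc F G) :=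
      ContMDiffAt.comp (f := fun x : F => ((k, x), unitLoc F G)) (unitLoc F G) h2
        ((contMDiffAt_const.prodMk contMDiffAt_id).prodMk contMDiffAt_const)
    exact ((contMDiffAt_iff_contDiffAt.1 h3).differentiableAt (by simp)).clm_apply
      (differentiableAt_const v)
  have h2 := (hasFDerivAt_clm_eval hθ v).fderiv
  have h3 : (fun y => energyDens ψ k y v) =ᶠ[𝓝 (unitLoc F G)] fun y =>
      2 * inner ℝ (conjMap ψ k (unitLoc F G) y) (fderiv ℝ (conjMap ψ k y) (unitLoc F G) v) := by
    filter_upwards [target_mem_nhds (E := F) (1 : G)] with y hy using energyDens_apply hψ k hy v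
  have h4 := (hA.hasFDerivAt.inner ℝ hB.hasFDerivAt).const_mul 2
  have h5 : conjMap ψ k (unitLoc F G) (unitLoc F G) = 0 := by
    rw [conjMap, unitLoc_symm]; simp [h1]
  have h6 := DFunLike.congr_fun (h2.symm.trans (h3.fderiv_eq.trans h4.fderiv)) v
  refine h6.trans ?_
  simp [h5, fderivInnerCLM_apply]

lemma aestronglyMeasurable_id_of_chartedSpace (F : Type*) [NormedAddCommGroup F] [NormedSpace ℝ F]
    [FiniteDimensional ℝ F] {G : Type*} [TopologicalSpace G] [ChartedSpace F G] [T2Space G]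
    [CompactSpace G] [MeasurableSpace G] [BorelSpace G] {ν : Measure G} :
    AEStronglyMeasurable (fun k : G => k) ν := by
  have : SecondCountableTopology G := ChartedSpace.secondCountable_of_sigmaCompact F G
  exact aestronglyMeasurable_id

variable [T2Space G] [CompactSpace G] [MeasurableSpace G] [BorelSpace G] {ν : Measure G}
  [ν.IsHaarMeasure] [IsProbabilityMeasure ν]

lemma hasFDerivAt_conjEnergy (hψ : ContMDiff 𝓘(ℝ, F) 𝓘(ℝ, V) ∞ ψ) {y : F}
    (hy : y ∈ (extChartAt 𝓘(ℝ, F) (1 : G)).target) :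
    HasFDerivAt (fun x => conjEnergy ψ ν ((extChartAt 𝓘(ℝ, F) (1 : G)).symm y *
      (extChartAt 𝓘(ℝ, F) (1 : G)).symm x)) (energyGrad ψ ν y) (unitLoc F G) := by
  refine hasFDerivAt_integral_of_contMDiffOn (I := 𝓘(ℝ, F)) (Z := G)
    (k := fun k x => ‖conjMap ψ k y x‖ ^ 2) (z := fun k => k) (m := ν)
    (isOpen_extChartAt_target (I := 𝓘(ℝ, F)) (1 : G)) ?_ (aestronglyMeasurable_id_of_chartedSpace F)
    isCompact_univ (fun _ => Set.mem_univ _) unitLoc_mem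
  rintro ⟨k, x⟩ hx
  refine ContMDiffAt.contMDiffWithinAt ?_
  exact ContMDiffAt.comp (I' := 𝓘(ℝ, V)) (g := fun v : V => ‖v‖ ^ 2) (k, x)
    (contDiff_norm_sq ℝ).contMDiff.contMDiffAt
    (ContMDiffAt.comp (f := fun p : G × F => ((p.1, y), p.2)) (k, x)
      (contMDiffAt_conjMap hψ k hy hx.2)
      ((contMDiffAt_fst.prodMk contMDiffAt_const).prodMk contMDiffAt_snd))

/-- The identity is a critical point of the energy. -/
lemma energyGrad_unitLoc (hψ : ContMDiff 𝓘(ℝ, F) 𝓘(ℝ, V) ∞ ψ) (h1 : ψ 1 = 0) :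
    energyGrad ψ ν (unitLoc F G) = 0 := by
  have h : ∀ k : G, energyDens ψ k (unitLoc F G) = 0 := by
    intro k
    ext w
    rw [energyDens_apply hψ k unitLoc_mem]
    have h5 : conjMap ψ k (unitLoc F G) (unitLoc F G) = 0 := by
      rw [conjMap, unitLoc_symm]; simp [h1]
    simp [h5]
  simp [energyGrad, h]

/-- The differential of the energy is locally injective near the identity, because the Hessian of
the energy at the identity is positive definite. -/
lemma exists_injOn_energyGrad (hψ : ContMDiff 𝓘(ℝ, F) 𝓘(ℝ, V) ∞ ψ) (h1 : ψ 1 = 0)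
    (hinj : Function.Injective
      (fderiv ℝ (fun y => ψ ((extChartAt 𝓘(ℝ, F) (1 : G)).symm y)) (unitLoc F G))) :
    ∃ s ∈ 𝓝 (unitLoc F G), Set.InjOn (energyGrad ψ ν) s := by
  have hU := isOpen_extChartAt_target (I := 𝓘(ℝ, F)) (1 : G)
  have hk : ContMDiffOn (𝓘(ℝ, F).prod 𝓘(ℝ, F)) 𝓘(ℝ, F →L[ℝ] ℝ) ∞
      (Function.uncurry (energyDens ψ)) (Set.univ ×ˢ (extChartAt 𝓘(ℝ, F) (1 : G)).target) :=
    fun p hp => (contMDiffAt_energyDens hψ p.1 hp.2).contMDiffWithinAt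
  have hz : AEStronglyMeasurable (fun k : G => k) ν := aestronglyMeasurable_id_of_chartedSpace F
  have hc : ContDiffAt ℝ ∞ (energyGrad ψ ν) (unitLoc F G) :=
    (contDiffOn_integral_of_contMDiffOn (I := 𝓘(ℝ, F)) hU hk hz isCompact_univ
      fun _ => Set.mem_univ _).contDiffAt (hU.mem_nhds unitLoc_mem)
  have hd := hasFDerivAt_integral_of_contMDiffOn (I := 𝓘(ℝ, F)) hU hk hz isCompact_univ
    (fun _ => Set.mem_univ _) unitLoc_mem
  have hs := hc.hasStrictFDerivAt' hd (by simp)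
  have hi := integrable_fderiv_of_contMDiffOn (I := 𝓘(ℝ, F)) hU hk hz isCompact_univ
    (fun _ => Set.mem_univ _) unitLoc_mem
  refine HasStrictFDerivAt.exists_injOn hs ?_
  rw [injective_iff_map_eq_zero]
  intro v hv
  by_contra hv0
  have h2 : ∫ k, 2 * ‖fderiv ℝ (conjMap ψ k (unitLoc F G)) (unitLoc F G) v‖ ^ 2 ∂ν = 0 := by
    have h3 := DFunLike.congr_fun hv v
    rw [ContinuousLinearMap.integral_apply hi, ContinuousLinearMap.integral_apply
      (hi.apply_continuousLinearMap v)] at h3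
    simpa only [fderiv_energyDens hψ h1, zero_apply] using h3
  have hcont : Continuous fun k : G =>
      2 * ‖fderiv ℝ (conjMap ψ k (unitLoc F G)) (unitLoc F G) v‖ ^ 2 := by
    rw [continuous_iff_continuousAt]
    intro k
    have h4 := contMDiffAt_partial_fderiv (Z := G × F) (k := fun p x => conjMap ψ p.1 p.2 x)
      (contMDiffAt_conjMap hψ k unitLoc_mem unitLoc_mem)
    have h5 : ContinuousAt (fun k : G => fderiv ℝ (conjMap ψ k (unitLoc F G)) (unitLoc F G)) k :=
      ContinuousAt.comp (f := fun k : G => ((k, unitLoc F G), unitLoc F G)) h4.continuousAt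
        (by fun_prop)
    fun_prop
  have h6 : (0 : ℝ) < ∫ k, 2 * ‖fderiv ℝ (conjMap ψ k (unitLoc F G)) (unitLoc F G) v‖ ^ 2 ∂ν := by
    refine hcont.integral_pos_of_hasCompactSupport_nonneg_nonzero (x := 1)
      (HasCompactSupport.of_compactSpace _) (fun k => by positivity) ?_
    have h7 : conjMap ψ 1 (unitLoc F G) =
        fun y => ψ ((extChartAt 𝓘(ℝ, F) (1 : G)).symm y) := by
      funext y
      rw [conjMap, unitLoc_symm]; simp
    rw [h7]
    have h8 := (map_ne_zero_iff _ hinj).2 hv0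
    positivity
  exact h6.ne' h2

end Energy

/-! ### Discrete paths -/

section DiscreteGeodesics

open MeasureTheory

section Paths

variable {G : Type*} [Group G] {f : G → ℝ}

/-- The partial products of a list form a discrete path from the identity to the product, whose
steps are the entries of the list. -/
lemma exists_path_of_list (f : G → ℝ) (l : List G) : ∃ p : ℕ → G, p 0 = 1 ∧ p l.length = l.prod ∧
    ∑ i ∈ Finset.range l.length, f ((p i)⁻¹ * p (i + 1)) = (l.map f).sum := by
  induction l with
  | nil => exact ⟨fun _ => 1, by simp⟩
  | cons h t ih =>
    obtain ⟨p, hp0, hp1, hp2⟩ := ih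
    refine ⟨fun i => Nat.casesOn i 1 fun j => h * p j, rfl, ?_, ?_⟩
    · rw [List.length_cons, List.prod_cons, ← hp1]
    · rw [List.length_cons, Finset.sum_range_succ', List.map_cons, List.sum_cons, ← hp2, add_comm]
      simp only [hp0, mul_one, mul_inv_rev, mul_assoc, inv_mul_cancel_left]
      change f ((1 : G)⁻¹ * h) + _ = _
      rw [inv_one, one_mul]

/-- Energy of a discrete path with `n` steps. -/
def pathEnergy (f : G → ℝ) (n : ℕ) (p : ℕ → G) : ℝ :=
  ∑ i ∈ Finset.range n, f ((p i)⁻¹ * p (i + 1))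

/-- Moving one interior vertex of a discrete path changes the energy of the two adjacent steps
only. -/
lemma pathEnergy_update (f : G → ℝ) {n j : ℕ} (hj : j < n) (p : ℕ → G) (x : G) :
    pathEnergy f (n + 1) (Function.update p (j + 1) (p (j + 1) * x)) -
      pathEnergy f (n + 1) p =
      f ((p j)⁻¹ * p (j + 1) * x) + f (x⁻¹ * ((p (j + 1))⁻¹ * p (j + 2)))
        - (f ((p j)⁻¹ * p (j + 1)) + f ((p (j + 1))⁻¹ * p (j + 2))) := by
  have key : ∀ q : ℕ → G, pathEnergy f (n + 1) q =
      f ((q j)⁻¹ * q (j + 1)) + (f ((q (j + 1))⁻¹ * q (j + 2)) +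
        ∑ i ∈ ((Finset.range (n + 1)).erase j).erase (j + 1), f ((q i)⁻¹ * q (i + 1))) := by
    intro q
    rw [Finset.add_sum_erase _ (fun i => f ((q i)⁻¹ * q (i + 1))) (by simp; omega),
      Finset.add_sum_erase _ (fun i => f ((q i)⁻¹ * q (i + 1))) (by simp; omega), pathEnergy]
  have hrest : ∑ i ∈ ((Finset.range (n + 1)).erase j).erase (j + 1),
      f ((Function.update p (j + 1) (p (j + 1) * x) i)⁻¹ *
        Function.update p (j + 1) (p (j + 1) * x) (i + 1)) =
      ∑ i ∈ ((Finset.range (n + 1)).erase j).erase (j + 1), f ((p i)⁻¹ * p (i + 1)) := by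
    refine Finset.sum_congr rfl fun i hi => ?_
    simp only [Finset.mem_erase] at hi
    rw [Function.update_of_ne hi.1, Function.update_of_ne (by omega)]
  rw [key, key p, hrest, Function.update_of_ne (by omega), Function.update_self,
    Function.update_of_ne (by omega)]
  simp only [mul_inv_rev, mul_assoc]
  ring

variable [TopologicalSpace G] [IsTopologicalGroup G]

lemma continuous_pathEnergy (hf : Continuous f) (n : ℕ) : Continuous (pathEnergy f n) :=
  continuous_finsetSum _ fun i _ => hf.comp
    ((continuous_apply i).inv.mul (continuous_apply (i + 1)))

/-- If every element of a compact group is a product of elements with arbitrarily small total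
energy, then the number of factors needed for a given bound is uniform. -/
lemma exists_uniform_path [CompactSpace G] (hf : Continuous f) (hf1 : f 1 = 0) {η : ℝ}
    (h : ∀ g : G, ∃ l : List G, l.prod = g ∧ (l.map f).sum < η) :
    ∃ n : ℕ, ∀ g : G, ∃ p : ℕ → G, p 0 = 1 ∧ p (n + 1) = g ∧ pathEnergy f (n + 1) p < η := by
  -- The endpoints of the admissible paths with `n + 1` steps form an increasing sequence of open
  -- sets, which covers the group.
  let U : ℕ → Set G := fun n =>
    {g | ∃ p : ℕ → G, p 0 = 1 ∧ p (n + 1) = g ∧ pathEnergy f (n + 1) p < η}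
  have hopen : ∀ n, IsOpen (U n) := by
    intro n
    rw [isOpen_iff_mem_nhds]
    rintro g ⟨p, hp0, hp1, hp2⟩
    have hc : Continuous fun g' : G => pathEnergy f (n + 1) (Function.update p (n + 1) g') :=
      (continuous_pathEnergy hf (n + 1)).comp (continuous_const.update (n + 1) continuous_id)
    have hg : pathEnergy f (n + 1) (Function.update p (n + 1) g) < η := by
      rwa [← hp1, Function.update_eq_self]
    filter_upwards [hc.continuousAt.eventually_lt_const hg] with g' hg'
    exact ⟨_, by rw [Function.update_of_ne (by omega), hp0], by rw [Function.update_self], hg'⟩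
  have hmono : Monotone U := by
    refine monotone_nat_of_le_succ fun n => ?_
    rintro g ⟨p, hp0, hp1, hp2⟩
    refine ⟨Function.update p (n + 2) g, by rw [Function.update_of_ne (by omega), hp0],
      by rw [Function.update_self], ?_⟩
    have h1 : pathEnergy f (n + 1 + 1) (Function.update p (n + 2) g) = pathEnergy f (n + 1) p := by
      rw [pathEnergy, Finset.sum_range_succ, Function.update_self, Function.update_of_ne (by omega),
        hp1, inv_mul_cancel, hf1, add_zero]
      refine Finset.sum_congr rfl fun i hi => ?_
      have := Finset.mem_range.1 hi
      rw [Function.update_of_ne (by omega), Function.update_of_ne (by omega)]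
    rwa [h1]
  obtain ⟨n, hn⟩ := isCompact_univ.elim_directed_cover U hopen (fun g _ => by
    obtain ⟨l, hl, hlη⟩ := h g
    -- A trivial first step makes the number of steps positive.
    obtain ⟨p, hp0, hp1, hp2⟩ := exists_path_of_list f (1 :: l)
    refine Set.mem_iUnion.2 ⟨l.length, p, hp0, ?_, ?_⟩
    · rw [← List.length_cons (a := (1 : G)), hp1, List.prod_cons, one_mul, hl]
    · rw [pathEnergy, ← List.length_cons (a := (1 : G)), hp2, List.map_cons, List.sum_cons, hf1,
        zero_add]
      exact hlη) hmono.directed_le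
  exact ⟨n, fun g => hn (Set.mem_univ g)⟩

variable {V : Type*} [NormedAddCommGroup V] [InnerProductSpace ℝ V] {ψ : G → V}
  [MeasurableSpace G] [BorelSpace G] {ν : MeasureTheory.Measure G} [ν.IsHaarMeasure]

/-- The energy is invariant under conjugation, by the left-invariance of the Haar measure. -/
lemma conjEnergy_conj (h c : G) : conjEnergy ψ ν (c⁻¹ * h * c) = conjEnergy ψ ν h := by
  have := integral_mul_left_eq_self (μ := ν) (fun k => ‖ψ (k⁻¹ * h * k)‖ ^ 2) c
  rw [conjEnergy, conjEnergy, ← this]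
  simp only [mul_inv_rev, mul_assoc]

lemma conjEnergy_mul_comm (x h : G) : conjEnergy ψ ν (x * h) = conjEnergy ψ ν (h * x) := by
  rw [← conjEnergy_conj (h * x) x⁻¹]
  simp [mul_assoc]

lemma conjEnergy_nonneg (h : G) : 0 ≤ conjEnergy ψ ν h :=
  integral_nonneg fun _ => by positivity

lemma conjEnergy_one (h1 : ψ 1 = 0) : conjEnergy ψ ν 1 = 0 := by
  simp [conjEnergy, h1]

variable [CompactSpace G] [SecondCountableTopology G] [T2Space G] [IsProbabilityMeasure ν]

lemma continuous_conjEnergy (hψ : Continuous ψ) : Continuous (conjEnergy ψ ν) := by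
  have hc : Continuous fun p : G × G => ‖ψ (p.2⁻¹ * p.1 * p.2)‖ ^ 2 := by fun_prop
  obtain ⟨C, hC⟩ := (isCompact_univ (X := G × G)).exists_bound_of_continuousOn hc.continuousOn
  refine continuous_of_dominated (bound := fun _ => C) (fun h => ?_) (fun h => ?_)
    (integrable_const C) ?_
  · exact (hc.comp (Continuous.prodMk_right h)).aestronglyMeasurable
  · exact Filter.Eventually.of_forall fun k => hC (h, k) trivial
  · exact Filter.Eventually.of_forall fun k => hc.comp (Continuous.prodMk_left k)

lemma conjEnergy_pos (hψ : Continuous ψ) {h : G} (hh : ψ h ≠ 0) : 0 < conjEnergy ψ ν h := by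
  have hc : Continuous fun k : G => ‖ψ (k⁻¹ * h * k)‖ ^ 2 := by fun_prop
  refine hc.integral_pos_of_hasCompactSupport_nonneg_nonzero (x := 1)
    (HasCompactSupport.of_compactSpace _) (fun k => by positivity) ?_
  simpa using hh

end Paths

variable {F : Type*} [NormedAddCommGroup F] [NormedSpace ℝ F] [FiniteDimensional ℝ F]
  {G : Type*} [TopologicalSpace G] [ChartedSpace F G] [Group G] [LieGroup 𝓘(ℝ, F) ∞ G]
  {V : Type*} [NormedAddCommGroup V] [InnerProductSpace ℝ V] {ψ : G → V}
  [T2Space G] [CompactSpace G] [MeasurableSpace G] [BorelSpace G] {ν : Measure G}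
  [ν.IsHaarMeasure] [IsProbabilityMeasure ν]

lemma hasDerivAt_chart_expE (b : F) :
    HasDerivAt (fun s : ℝ => extChartAt 𝓘(ℝ, F) (1 : G) (expE G (s • b)))
      (chartD F (1 : G) 1 b) 0 := by
  have h1 := (isOneParameterSubgroup_expE (G := G) b).velocity
  have h0 : expE G ((0 : ℝ) • b) = 1 := by rw [zero_smul, expE_zero]
  have h2 : HasMFDerivAt 𝓘(ℝ, F) 𝓘(ℝ, F) (extChartAt 𝓘(ℝ, F) (1 : G)) (expE G ((0 : ℝ) • b))
      (mfderiv 𝓘(ℝ, F) 𝓘(ℝ, F) (extChartAt 𝓘(ℝ, F) (1 : G)) 1) := by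
    rw [h0]
    exact ((contMDiffAt_chart (mem_extChartAt_source (1 : G))).mdifferentiableAt
      (by simp)).hasMFDerivAt
  have h3 := HasMFDerivAt.comp (f := fun s : ℝ => expE G (s • b)) (0 : ℝ) h2 h1
  obtain ⟨L, hL⟩ : ∃ L : ℝ →L[ℝ] F, L =
    (1 : ℝ →L[ℝ] ℝ).smulRight (chartD F (1 : G) 1 b) := ⟨_, rfl⟩
  have h4 : HasMFDerivAt 𝓘(ℝ, ℝ) 𝓘(ℝ, F)
      (fun s : ℝ => extChartAt 𝓘(ℝ, F) (1 : G) (expE G (s • b))) 0 L := by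
    refine h3.congr_mfderiv ?_
    rw [hL]
    refine ContinuousLinearMap.ext fun (t : ℝ) => ?_
    exact map_smul (chartD F (1 : G) 1) t b
  have h5 : HasFDerivAt (fun s : ℝ => extChartAt 𝓘(ℝ, F) (1 : G) (expE G (s • b))) L 0 :=
    hasMFDerivAt_iff_hasFDerivAt.1 h4
  have h6 : L 1 = chartD F (1 : G) 1 b := by
    rw [hL]
    simp
  exact h6 ▸ h5.hasDerivAt

/-- The derivative of the energy along a one-parameter subgroup, translated to `h`, is given by
`energyGrad`. -/
lemma hasDerivAt_conjEnergy (hψ : ContMDiff 𝓘(ℝ, F) 𝓘(ℝ, V) ∞ ψ) {h : G}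
    (hh : h ∈ (extChartAt 𝓘(ℝ, F) (1 : G)).source) (b : F) :
    HasDerivAt (fun s : ℝ => conjEnergy ψ ν (h * expE G (s • b)))
      (energyGrad ψ ν (extChartAt 𝓘(ℝ, F) (1 : G) h) (chartD F (1 : G) 1 b)) 0 := by
  have h0 : extChartAt 𝓘(ℝ, F) (1 : G) (expE G ((0 : ℝ) • b)) = unitLoc F G := by
    rw [zero_smul, expE_zero, unitLoc]
  have h1 := hasFDerivAt_conjEnergy (ν := ν) hψ ((extChartAt 𝓘(ℝ, F) (1 : G)).map_source hh)
  rw [(extChartAt 𝓘(ℝ, F) (1 : G)).left_inv hh, ← h0] at h1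
  refine (h1.comp_hasDerivAt (0 : ℝ) (hasDerivAt_chart_expE b)).congr_of_eventuallyEq ?_
  have h2 : Filter.Tendsto (fun s : ℝ => expE G (s • b)) (𝓝 0) (𝓝 1) := by
    have h3 : Continuous fun s : ℝ => expE G (s • b) :=
      (continuous_expE F G).comp (continuous_id.smul continuous_const)
    have h4 := h3.tendsto 0
    rwa [zero_smul, expE_zero] at h4
  filter_upwards [h2.eventually ((isOpen_extChartAt_source (I := 𝓘(ℝ, F)) (1 : G)).mem_nhds
    (mem_extChartAt_source 1))] with s hs
  simp only [Function.comp_apply]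
  rw [(extChartAt 𝓘(ℝ, F) (1 : G)).left_inv hs]

end DiscreteGeodesics

/-! ### Surjectivity of the exponential map -/

section DiscreteGeodesics

open MeasureTheory

variable {F : Type*} [NormedAddCommGroup F] [NormedSpace ℝ F] [FiniteDimensional ℝ F]
  {G : Type*} [TopologicalSpace G] [ChartedSpace F G] [Group G] [LieGroup 𝓘(ℝ, F) ∞ G]
  {V : Type*} [NormedAddCommGroup V] [InnerProductSpace ℝ V] {ψ : G → V}
  [T2Space G] [CompactSpace G] [MeasurableSpace G] [BorelSpace G] {ν : Measure G}
  [ν.IsHaarMeasure] [IsProbabilityMeasure ν]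

/-- At a discrete path that minimizes the energy, consecutive steps have the same differential of
the energy. -/
lemma energyGrad_eq_of_minimal [IsTopologicalGroup G] (hψ : ContMDiff 𝓘(ℝ, F) 𝓘(ℝ, V) ∞ ψ)
    {n j : ℕ} (hj : j < n) {p : ℕ → G}
    (hmin : ∀ x : G, pathEnergy (conjEnergy ψ ν) (n + 1) p ≤
      pathEnergy (conjEnergy ψ ν) (n + 1) (Function.update p (j + 1) (p (j + 1) * x)))
    (h1 : (p j)⁻¹ * p (j + 1) ∈ (extChartAt 𝓘(ℝ, F) (1 : G)).source)
    (h2 : (p (j + 1))⁻¹ * p (j + 2) ∈ (extChartAt 𝓘(ℝ, F) (1 : G)).source) :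
    energyGrad ψ ν (extChartAt 𝓘(ℝ, F) (1 : G) ((p j)⁻¹ * p (j + 1))) =
      energyGrad ψ ν (extChartAt 𝓘(ℝ, F) (1 : G) ((p (j + 1))⁻¹ * p (j + 2))) := by
  ext w
  set b : F := chartDs (1 : G) (unitLoc F G) w
  have hb : chartD F (1 : G) 1 b = w := chartD_chartDs (mem_extChartAt_source (1 : G)) w
  have hd := (hasDerivAt_conjEnergy (ν := ν) hψ h1 b).add (hasDerivAt_conjEnergy (ν := ν) hψ h2 (-b))
  -- Moving the common vertex of the two steps by `exp (s b)` multiplies the first step by `exp (s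
  -- b)` on the right and the second one by `exp (-s b)` on the left. By conjugation-invariance
  -- the latter may be moved to the right.
  have hm : IsLocalMin (fun s : ℝ => conjEnergy ψ ν ((p j)⁻¹ * p (j + 1) * expE G (s • b)) +
      conjEnergy ψ ν ((p (j + 1))⁻¹ * p (j + 2) * expE G (s • -b))) 0 := by
    refine Filter.Eventually.of_forall fun s => ?_
    have h3 := pathEnergy_update (conjEnergy ψ ν) hj p (expE G (s • b))
    have h4 := hmin (expE G (s • b))
    rw [conjEnergy_mul_comm (expE G (s • b))⁻¹, ← expE_neg, ← smul_neg] at h3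
    simp only [zero_smul, expE_zero, mul_one]
    linarith
  have h5 := hm.hasDerivAt_eq_zero hd
  rw [map_neg, map_neg, hb] at h5
  linarith

/-- On a compact group, every element that is the endpoint of a path of sufficiently small energy
is a power of an element near the identity, the common step of an energy-minimizing path. -/
lemma exists_pow_of_path [IsTopologicalGroup G] [SecondCountableTopology G]
    (hψ : ContMDiff 𝓘(ℝ, F) 𝓘(ℝ, V) ∞ ψ) {N : Set G} {s : Set F}
    (hs : Set.InjOn (energyGrad ψ ν) s)
    (hN : ∀ h ∈ N, h ∈ (extChartAt 𝓘(ℝ, F) (1 : G)).source ∧ extChartAt 𝓘(ℝ, F) (1 : G) h ∈ s)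
    {η : ℝ} (hη : ∀ h : G, conjEnergy ψ ν h < η → h ∈ N) {n : ℕ} {g : G}
    (hg : ∃ p : ℕ → G, p 0 = 1 ∧ p (n + 1) = g ∧ pathEnergy (conjEnergy ψ ν) (n + 1) p < η) :
    ∃ h ∈ N, h ^ (n + 1) = g := by
  obtain ⟨q, hq0, hq1, hqη⟩ := hg
  have hcont := continuous_conjEnergy (ν := ν) hψ.continuous
  have hclosed : IsClosed {p : ℕ → G | p 0 = 1 ∧ p (n + 1) = g} :=
    (isClosed_eq (continuous_apply 0) continuous_const).inter
      (isClosed_eq (continuous_apply (n + 1)) continuous_const)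
  obtain ⟨p, ⟨hp0, hp1⟩, hmin⟩ := hclosed.isCompact.exists_isMinOn ⟨q, hq0, hq1⟩
    (continuous_pathEnergy hcont (n + 1)).continuousOn
  have hpη : pathEnergy (conjEnergy ψ ν) (n + 1) p < η :=
    lt_of_le_of_lt (hmin (show q ∈ {p : ℕ → G | p 0 = 1 ∧ p (n + 1) = g} from ⟨hq0, hq1⟩)) hqη
  have hstep : ∀ i ≤ n, (p i)⁻¹ * p (i + 1) ∈ N := fun i hi => hη _ (lt_of_le_of_lt
    (Finset.single_le_sum (f := fun i => conjEnergy ψ ν ((p i)⁻¹ * p (i + 1)))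
      (fun i _ => conjEnergy_nonneg _) (Finset.mem_range.2 (Nat.lt_succ_of_le hi))) hpη)
  -- All the steps are near the identity, where the differential of the energy determines the
  -- step.
  have heq : ∀ i ≤ n, (p i)⁻¹ * p (i + 1) = (p 0)⁻¹ * p 1 := by
    intro i
    induction i with
    | zero => intro _; rfl
    | succ j ih =>
      intro hj
      rw [← ih (by omega)]
      have h1 := hN _ (hstep j (by omega))
      have h2 := hN _ (hstep (j + 1) hj)
      have h3 := energyGrad_eq_of_minimal hψ (ν := ν) (Nat.lt_of_succ_le hj) (p := p) (fun x => hmin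
        (show Function.update p (j + 1) (p (j + 1) * x) ∈ {p : ℕ → G | p 0 = 1 ∧ p (n + 1) = g} from
          ⟨by rw [Function.update_of_ne (by omega), hp0],
            by rw [Function.update_of_ne (by omega), hp1]⟩)) h1.1 h2.1
      exact ((extChartAt 𝓘(ℝ, F) (1 : G)).injOn h1.1 h2.1 (hs h1.2 h2.2 h3)).symm
  have hpow : ∀ i ≤ n + 1, p i = ((p 0)⁻¹ * p 1) ^ i := by
    intro i
    induction i with
    | zero => intro _; rw [hp0, pow_zero]
    | succ j ih =>
      intro hj
      rw [pow_succ, ← ih (by omega), ← heq j (by omega), mul_inv_cancel_left]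
  exact ⟨_, hstep 0 (Nat.zero_le n), by rw [← hpow (n + 1) le_rfl, hp1]⟩

/-- A connected Lie group is generated by the image of the exponential map. -/
lemma closure_range_expE [ConnectedSpace G] [IsTopologicalGroup G] :
    Subgroup.closure (Set.range (expE G : F → G)) = ⊤ := by
  have h1 : Set.range (expE G : F → G) ∈ 𝓝 (1 : G) := by
    rw [← map_expE_nhds_zero F G]
    exact Filter.mem_map.2 (Filter.univ_mem' fun a => ⟨a, rfl⟩)
  have h2 : IsOpen (Subgroup.closure (Set.range (expE G : F → G)) : Set G) :=
    Subgroup.isOpen_of_mem_nhds (g := 1) _ (Filter.mem_of_superset h1 Subgroup.subset_closure)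
  have h3 := Subgroup.isClosed_of_isOpen _ h2
  rw [← Subgroup.coe_eq_univ]
  exact IsClopen.eq_univ ⟨h3, h2⟩ ⟨1, Subgroup.one_mem _⟩

/-- Elements of a compact connected Lie group are products of elements of arbitrarily small total
energy: divide one-parameter subgroups into `k` steps, each of energy `o(1 / k)`. -/
lemma exists_list_energy_lt [ConnectedSpace G] [IsTopologicalGroup G]
    (hψ : ContMDiff 𝓘(ℝ, F) 𝓘(ℝ, V) ∞ ψ) (h1 : ψ 1 = 0) (g : G) {η : ℝ} (hη : 0 < η) :
    ∃ l : List G, l.prod = g ∧ (l.map (conjEnergy ψ ν)).sum < η := by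
  have hexp : ∀ (c : F) {η : ℝ}, 0 < η →
      ∃ l : List G, l.prod = expE G c ∧ (l.map (conjEnergy ψ ν)).sum < η := by
    intro c η hη
    have hd := hasDerivAt_conjEnergy (ν := ν) hψ (mem_extChartAt_source (1 : G)) c
    have hz : energyGrad ψ ν (extChartAt 𝓘(ℝ, F) (1 : G) 1) = 0 := energyGrad_unitLoc hψ h1
    rw [hz, zero_apply] at hd
    simp only [one_mul] at hd
    have ht := hasDerivAt_iff_tendsto_slope_zero.1 hd
    have hn : Filter.Tendsto (fun n : ℕ => ((n : ℝ) + 1)⁻¹) Filter.atTop (𝓝[≠] 0) := by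
      refine tendsto_nhdsWithin_iff.2 ⟨?_, Filter.Eventually.of_forall fun n => ?_⟩
      · simpa using tendsto_one_div_add_atTop_nhds_zero_nat (𝕜 := ℝ)
      · exact inv_ne_zero (by positivity)
    obtain ⟨n, hn⟩ := ((ht.comp hn).eventually_lt_const hη).exists
    simp only [Function.comp_apply, zero_add, zero_smul, expE_zero, conjEnergy_one h1, sub_zero,
      inv_inv, smul_eq_mul] at hn
    refine ⟨List.replicate (n + 1) (expE G (((n : ℝ) + 1)⁻¹ • c)), ?_, ?_⟩
    · have hn0 : ((n : ℝ) + 1) ≠ 0 := by positivity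
      rw [List.prod_replicate, ← expE_nsmul, Nat.cast_succ, smul_smul, mul_inv_cancel₀ hn0, one_smul]
    · rw [List.map_replicate, List.sum_replicate, nsmul_eq_mul, Nat.cast_succ]
      exact hn
  have hg : g ∈ Submonoid.closure
      (Set.range (expE G : F → G) ∪ (Set.range (expE G : F → G))⁻¹) := by
    rw [← Subgroup.closure_toSubmonoid, closure_range_expE]; exact Subgroup.mem_top g
  obtain ⟨L, hL, rfl⟩ := Submonoid.exists_list_of_mem_closure hg
  clear hg
  induction L generalizing η with
  | nil => exact ⟨[], by simpa using hη⟩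
  | cons x t ih =>
    have hx : ∃ c : F, expE G c = x := by
      rcases hL x List.mem_cons_self with ⟨c, hc⟩ | ⟨c, hc⟩
      · exact ⟨c, hc⟩
      · exact ⟨-c, by rw [expE_neg, hc, inv_inv]⟩
    obtain ⟨c, rfl⟩ := hx
    obtain ⟨l₁, h₁, h₁'⟩ := hexp c (half_pos hη)
    obtain ⟨l₂, h₂, h₂'⟩ := ih (half_pos hη) (fun y hy => hL y (List.mem_cons_of_mem _ hy))
    refine ⟨l₁ ++ l₂, by rw [List.prod_append, h₁, h₂, List.prod_cons], ?_⟩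
    rw [List.map_append, List.sum_append]
    linarith

variable (F) in
/-- The exponential map of a compact connected Lie group maps some ball onto the group. -/
theorem exists_expE_surjOn [ConnectedSpace G] (ν : Measure G) [ν.IsHaarMeasure]
    [IsProbabilityMeasure ν] :
    ∃ R : ℝ, ∀ g : G, ∃ a ∈ Metric.closedBall (0 : F) R, expE G a = g := by
  have : IsTopologicalGroup G := topologicalGroup_of_lieGroup 𝓘(ℝ, F) ∞
  have : SecondCountableTopology G := ChartedSpace.secondCountable_of_sigmaCompact F G
  obtain ⟨ψ, hψ, hψ0, hinj⟩ := exists_separating_map F G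
  have hψ1 : ψ 1 = 0 := (hψ0 1).2 rfl
  obtain ⟨s, hs, hsinj⟩ := exists_injOn_energyGrad (ν := ν) hψ hψ1 hinj
  -- a neighbourhood of the identity on which the differential of the energy is injective and
  -- the logarithm exists
  let N : Set G := ((extChartAt 𝓘(ℝ, F) (1 : G)).source ∩ extChartAt 𝓘(ℝ, F) (1 : G) ⁻¹' s) ∩
    expE G '' Metric.ball (0 : F) 1
  have hN : N ∈ 𝓝 (1 : G) := by
    refine Filter.inter_mem (Filter.inter_mem (extChartAt_source_mem_nhds 1)
      ((continuousAt_extChartAt (1 : G)).preimage_mem_nhds hs)) ?_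
    rw [← map_expE_nhds_zero F G]
    exact Filter.image_mem_map (Metric.ball_mem_nhds 0 one_pos)
  have hcont := continuous_conjEnergy (ν := ν) hψ.continuous
  -- By compactness, elements of small energy are in `N`.
  obtain ⟨η, hη, hηN⟩ : ∃ η > 0, ∀ h : G, conjEnergy ψ ν h < η → h ∈ N := by
    by_cases hne : ((interior N)ᶜ : Set G).Nonempty
    · obtain ⟨h₀, hh₀, hmin⟩ := isOpen_interior.isClosed_compl.isCompact.exists_isMinOn hne
        hcont.continuousOn
      refine ⟨conjEnergy ψ ν h₀, conjEnergy_pos hψ.continuous fun h0 => hh₀ ?_, fun h hh => ?_⟩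
      · rw [(hψ0 h₀).1 h0]
        exact mem_interior_iff_mem_nhds.2 hN
      · by_contra hcon
        exact absurd (hmin (show h ∈ (interior N)ᶜ from fun hi => hcon (interior_subset hi)))
          (not_le.2 hh)
    · rw [Set.not_nonempty_iff_eq_empty, Set.compl_empty_iff] at hne
      exact ⟨1, one_pos, fun h _ => interior_subset (hne ▸ Set.mem_univ h)⟩
  obtain ⟨n, hn⟩ := exists_uniform_path hcont (conjEnergy_one hψ1)
    (fun g => exists_list_energy_lt hψ hψ1 g hη)
  -- `g` is the `(n + 1)`-st power of the exponential of a vector in the unit ball.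
  refine ⟨n + 1, fun g => ?_⟩
  obtain ⟨h, hh, rfl⟩ := exists_pow_of_path hψ hsinj (N := N) (fun h hh => hh.1) hηN (hn g)
  obtain ⟨a, ha, rfl⟩ := hh.2
  refine ⟨((n + 1 : ℕ) : ℝ) • a, ?_, expE_nsmul a (n + 1)⟩
  rw [mem_ball_zero_iff] at ha
  rw [mem_closedBall_zero_iff, norm_smul, Real.norm_natCast, Nat.cast_succ]
  exact mul_le_of_le_one_right (by positivity) ha.le

end DiscreteGeodesics

/-! ### Measurable logarithms -/

section Logarithm

open MeasureTheory

/-- A continuous surjection from a compact metric space has a Borel section: parametrize the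
space by the Cantor set and choose the least parameter. -/
lemma exists_measurable_section {X Y : Type*} [MetricSpace X] [CompactSpace X] [MeasurableSpace X]
    [BorelSpace X] [TopologicalSpace Y] [T2Space Y] [MeasurableSpace Y] [BorelSpace Y] {f : X → Y}
    (hf : Continuous f) (hsurj : Function.Surjective f) :
    ∃ s : Y → X, Measurable s ∧ ∀ y, f (s y) = y := by
  rcases isEmpty_or_nonempty X with hX | hX
  · have : IsEmpty Y := ⟨fun y => hX.elim (hsurj y).choose⟩
    exact ⟨isEmptyElim, measurable_of_empty _, isEmptyElim⟩
  obtain ⟨π₀, hπ₀, hπ₀s⟩ := exists_nat_bool_continuous_surjective_of_compact X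
  let π : cantorSet → X := π₀ ∘ cantorSetHomeomorphNatToBool
  have hπ : Continuous π := hπ₀.comp cantorSetHomeomorphNatToBool.continuous
  have hπs : Function.Surjective π := hπ₀s.comp cantorSetHomeomorphNatToBool.surjective
  have : CompactSpace cantorSet := isCompact_iff_compactSpace.1 isCompact_cantorSet
  let C : Y → Set ℝ := fun y => Subtype.val '' {x : cantorSet | f (π x) = y}
  have hC : ∀ y, IsCompact (C y) := fun y =>
    ((isClosed_eq (hf.comp hπ) continuous_const).isCompact).image continuous_subtype_val
  have hmem : ∀ y, sInf (C y) ∈ C y := by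
    intro y
    obtain ⟨x, hx⟩ := (hsurj.comp hπs) y
    exact (hC y).sInf_mem ⟨x, x, hx, rfl⟩
  have hmeas : Measurable fun y => sInf (C y) := by
    refine measurable_of_Iic fun c => ?_
    -- The sublevel sets are images of compact sets, since the least parameter is attained.
    have h1 : (fun y => sInf (C y)) ⁻¹' Set.Iic c = (f ∘ π) '' {x : cantorSet | (x : ℝ) ≤ c} := by
      ext y
      constructor
      · intro hy
        obtain ⟨x, hx, hxy⟩ := hmem y
        exact ⟨x, by rw [Set.mem_ofPred_eq, hxy]; exact hy, hx⟩
      · rintro ⟨x, hx, rfl⟩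
        exact (csInf_le (hC _).bddBelow ⟨x, rfl, rfl⟩).trans hx
    rw [h1]
    have h2 : IsClosed {x : cantorSet | (x : ℝ) ≤ c} :=
      isClosed_le continuous_subtype_val continuous_const
    exact (h2.isCompact.image (hf.comp hπ)).isClosed.measurableSet
  have hin : ∀ y, sInf (C y) ∈ cantorSet := fun y => by
    obtain ⟨x, -, hx⟩ := hmem y
    rw [← hx]; exact x.2
  refine ⟨fun y => π ⟨sInf (C y), hin y⟩, hπ.measurable.comp (hmeas.subtype_mk), fun y => ?_⟩
  obtain ⟨x, hx, hxy⟩ := hmem y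
  have : (⟨sInf (C y), hin y⟩ : cantorSet) = x := Subtype.ext hxy.symm
  change f (π ⟨sInf (C y), hin y⟩) = y
  rw [this]
  exact hx

variable {F : Type*} [NormedAddCommGroup F] [NormedSpace ℝ F] [FiniteDimensional ℝ F]
  {G : Type*} [TopologicalSpace G] [ChartedSpace F G] [Group G] [LieGroup 𝓘(ℝ, F) ∞ G]
  [T2Space G] [CompactSpace G] [ConnectedSpace G] [MeasurableSpace G] [BorelSpace G]

variable (F) in
/-- A compact connected Lie group has a bounded Borel logarithm. -/
theorem exists_isLogarithm (ν : Measure G) [ν.IsHaarMeasure] [IsProbabilityMeasure ν] :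
    ∃ log : G → GroupLieAlgebra 𝓘(ℝ, F) G, IsLogarithm ν log := by
  obtain ⟨R, hR⟩ := exists_expE_surjOn F ν
  borelize F
  have : ProperSpace F := FiniteDimensional.proper ℝ F
  have : CompactSpace (Metric.closedBall (0 : F) R) :=
    isCompact_iff_compactSpace.1 (isCompact_closedBall 0 R)
  obtain ⟨s, hs, hsec⟩ := exists_measurable_section
    (f := fun a : Metric.closedBall (0 : F) R => expE G (a : F))
    ((continuous_expE F G).comp continuous_subtype_val)
    (fun g => by
      obtain ⟨a, ha, hag⟩ := hR g
      exact ⟨⟨a, ha⟩, hag⟩)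
  have hm : Measurable fun g => (s g : F) := measurable_subtype_coe.comp hs
  have hK : IsCompact (Metric.closedBall (0 : F) R) := isCompact_closedBall _ _
  exact ⟨fun g => ((s g : F) : F), hm.aestronglyMeasurable,
    ⟨(Metric.closedBall (0 : F) R : Set F), hK, fun g => (s g).2⟩, hsec⟩

end Logarithm

/-! ### Projection of forms along the normal bundle -/

section Splitting

variable {E : Type*} [NormedAddCommGroup E] [NormedSpace ℝ E] [FiniteDimensional ℝ E]
  {M : Type*} [TopologicalSpace M] [ChartedSpace E M]

/-- The projection onto `V p` along `H p`, as an endomorphism of the model space. -/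
def projE {V H : Distribution E M} (h : ∀ q, IsCompl (V q) (H q)) (p : M) : E →L[ℝ] E :=
  LinearMap.toContinuousLinearMap ((V p).projection (H p) (h p))

lemma projE_mem {V H : Distribution E M} (h : ∀ q, IsCompl (V q) (H q)) (p : M) (v : E) :
    projE h p v ∈ V p := by
  exact Submodule.projection_apply_mem (h p) v

lemma sub_projE_mem {V H : Distribution E M} (h : ∀ q, IsCompl (V q) (H q)) (p : M) (v : E) :
    v - projE h p v ∈ H p := by
  have h1 := Submodule.projection_add_projection_eq_self (h p) (v : Tan E p)
  have h2 : v - projE h p v = (H p).projection (V p) (h p).symm v := by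
    refine sub_eq_iff_eq_add'.2 h1.symm
  rw [h2]
  exact Submodule.projection_apply_mem (h p).symm v

lemma projE_of_mem {V H : Distribution E M} (h : ∀ q, IsCompl (V q) (H q)) {p : M} {v w : E}
    (hv : v ∈ V p) (hw : w ∈ H p) : projE h p (v + w) = v := by
  have h1 : projE h p v = v := Submodule.projection_apply_left (h p) ⟨v, hv⟩
  have h2 : projE h p w = 0 := Submodule.projection_apply_of_mem_right (h p) hw
  rw [map_add, h1, h2, add_zero]

/-- The composition of a 1-form with the projection onto `V` along `H`. -/
def projForm {V H : Distribution E M} (h : ∀ q, IsCompl (V q) (H q)) (α : OneForm E M) :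
    OneForm E M := fun q => ((covE α q).comp (projE h q) : E →L[ℝ] ℝ)

variable [IsManifold 𝓘(ℝ, E) ∞ M]

/-- The projection along a smooth sub-bundle is smooth: in a chart, a local frame adapted to the
splitting conjugates it to a constant projection. -/
lemma SmoothOneForm.projForm {V H : Distribution E M} (hV : IsSubbundle V) (hH : IsSubbundle H)
    (h : ∀ q, IsCompl (V q) (H q)) {α : OneForm E M} (hα : SmoothOneForm α) :
    SmoothOneForm (projForm h α) := by
  refine smoothOneForm_of_center fun q => ?_
  let b := Module.finBasis ℝ E
  let π₀ : E →L[ℝ] E := projE h q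
  have hX : ∀ e : E, ∃ X : VField E M, SmoothVField X ∧ (∀ p, X p ∈ V p) ∧ vecE X q = π₀ e :=
    fun e => hV.smooth q _ (projE_mem h q e)
  have hY : ∀ e : E, ∃ X : VField E M, SmoothVField X ∧ (∀ p, X p ∈ H p) ∧ vecE X q = e - π₀ e :=
    fun e => hH.smooth q _ (sub_projE_mem h q e)
  -- `X e` and `Y e` are sections of `V` and `H` that extend the two components of `e` at `q`.
  choose X hXs hXV hXq using hX
  choose Y hYs hYH hYq using hY
  -- The linear map that sends the `i`-th basis vector to the local expression of `Z (b i)`.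
  let fr : (E → VField E M) → E → E →L[ℝ] E := fun Z y =>
    ∑ i, (LinearMap.toContinuousLinearMap (b.coord i)).smulRight (vecLoc (Z (b i)) q y)
  have hfr_smooth : ∀ Z : E → VField E M, (∀ e, SmoothVField (Z e)) →
      ContDiffAt ℝ ∞ (fr Z) (extChartAt 𝓘(ℝ, E) q q) := fun Z hZ =>
    ContDiffAt.sum fun i _ => contDiffAt_const.smulRight ((hZ (b i)).contDiffAt q)
  have hfr_apply : ∀ (Z : E → VField E M) (y e : E),
      fr Z y e = ∑ i, b.repr e i • vecLoc (Z (b i)) q y := fun Z y e => by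
    simp [fr]
  have hfr_mem : ∀ (Z : E → VField E M) (W : Distribution E M), (∀ e p, Z e p ∈ W p) → ∀ y e : E,
      y ∈ (extChartAt 𝓘(ℝ, E) q).target →
      chartDs q y (fr Z y e) ∈ W ((extChartAt 𝓘(ℝ, E) q).symm y) := fun Z W hW y e hy => by
    rw [hfr_apply, map_sum]
    refine Submodule.sum_mem (W ((extChartAt 𝓘(ℝ, E) q).symm y)) fun i _ => ?_
    rw [map_smul]
    refine Submodule.smul_mem (W ((extChartAt 𝓘(ℝ, E) q).symm y)) _ ?_
    have h1 := chartDs_chartD ((extChartAt 𝓘(ℝ, E) q).map_target hy)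
      (vecE (Z (b i)) ((extChartAt 𝓘(ℝ, E) q).symm y))
    rw [(extChartAt 𝓘(ℝ, E) q).right_inv hy] at h1
    have h2 : chartDs q y (vecLoc (Z (b i)) q y) = vecE (Z (b i)) ((extChartAt 𝓘(ℝ, E) q).symm y) :=
      h1
    rw [h2]
    exact hW _ _
  -- `L y` maps the splitting at `q` to the splitting near `q`, and is invertible near `q` since
  -- at `q` it is the differential of the chart.
  let L : E → E →L[ℝ] E := fun y => (fr X y).comp π₀ + (fr Y y).comp (ContinuousLinearMap.id ℝ E - π₀)
  have hLs : ContDiffAt ℝ ∞ L (extChartAt 𝓘(ℝ, E) q q) :=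
    ((hfr_smooth X hXs).clm_comp contDiffAt_const).add
      ((hfr_smooth Y hYs).clm_comp contDiffAt_const)
  have hfr_center : ∀ (Z : E → VField E M) (T : E →L[ℝ] E), (∀ e, vecE (Z e) q = T e) → ∀ e,
      fr Z (extChartAt 𝓘(ℝ, E) q q) e = chartD E q q (T e) := fun Z T hT e => by
    rw [hfr_apply]
    have h1 : ∀ i, vecLoc (Z (b i)) q (extChartAt 𝓘(ℝ, E) q q) = chartD E q q (T (b i)) :=
      fun i => (vecLoc_chart (Z (b i)) (mem_extChartAt_source q)).trans
        (congrArg (chartD E q q) (hT (b i)))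
    simp_rw [h1]
    conv_rhs => rw [← b.sum_repr e]
    simp only [map_sum, map_smul]
  have hπ : ∀ e, π₀ (π₀ e) = π₀ e := fun e => by
    have := projE_of_mem h (projE_mem h q e) (Submodule.zero_mem (H q))
    exact (congrArg π₀ (add_zero (π₀ e))).symm.trans this
  let e₀ : E ≃L[ℝ] E := ContinuousLinearEquiv.equivOfInverse (chartD E q q)
    (chartDs q (extChartAt 𝓘(ℝ, E) q q)) (chartDs_chartD (mem_extChartAt_source q))
    (chartD_chartDs (mem_extChartAt_source q))
  have hL0 : L (extChartAt 𝓘(ℝ, E) q q) = (e₀ : E →L[ℝ] E) := by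
    ext e
    change fr X _ (π₀ e) + fr Y _ (e - π₀ e) = chartD E q q e
    rw [hfr_center X π₀ hXq, hfr_center Y (ContinuousLinearMap.id ℝ E - π₀) hYq, ← map_add]
    congr 1
    change π₀ (π₀ e) + (e - π₀ e - π₀ (e - π₀ e)) = e
    rw [map_sub, hπ]; abel
  have hinv : ContDiffAt ℝ ∞ (fun y => ContinuousLinearMap.inverse (L y))
      (extChartAt 𝓘(ℝ, E) q q) := by
    refine ContDiffAt.comp (g := ContinuousLinearMap.inverse) _ ?_ hLs
    rw [hL0]
    exact contDiffAt_map_inverse e₀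
  have hev : ∀ᶠ y in 𝓝 (extChartAt 𝓘(ℝ, E) q q),
      L y ∈ Set.range ((↑) : (E ≃L[ℝ] E) → E →L[ℝ] E) := by
    refine hLs.continuousAt.eventually_mem ?_
    rw [hL0]
    exact e₀.nhds
  refine (contDiffAt_congr_nhds (g := fun y =>
    (localExpr α q y).comp (((fr X y).comp π₀).comp (ContinuousLinearMap.inverse (L y)))) ?_).2
    ((hα.contDiffAt q).clm_comp (((hfr_smooth X hXs).clm_comp contDiffAt_const).clm_comp hinv))
  filter_upwards [hev, target_mem_nhds (E := E) q] with y hy hyt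
  obtain ⟨e, he⟩ := hy
  ext w
  obtain ⟨v, rfl⟩ := e.surjective w
  have h1 : ContinuousLinearMap.inverse (L y) (e v) = v := by
    rw [← he, ContinuousLinearMap.inverse_equiv]
    exact e.symm_apply_apply v
  have h2 : e v = fr X y (π₀ v) + fr Y y (v - π₀ v) := by
    change (e : E →L[ℝ] E) v = _
    rw [he]; rfl
  change _ = localExpr α q y (fr X y (π₀ (ContinuousLinearMap.inverse (L y) (e v))))
  rw [h1, localExpr_apply, localExpr_apply]
  change covE α _ (projE h _ (chartDs q y (e v))) = covE α _ _
  rw [h2, map_add, projE_of_mem h (hfr_mem X V hXV y _ hyt) (hfr_mem Y H hYH y _ hyt)]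

end Splitting

/-! ### Compatibility of the action and Lie derivatives of Poisson tensors -/

section Compatibility

variable {E : Type*} [NormedAddCommGroup E] [NormedSpace ℝ E] [FiniteDimensional ℝ E]
  {M : Type*} [TopologicalSpace M] [ChartedSpace E M] [IsManifold 𝓘(ℝ, E) ∞ M]

/-- The Poisson tensors of an almost-coupling deformation agree with the leaf-tangent one on the
annihilator of the normal bundle, and the latter only depends on the `H⁰`-component. -/
lemma IsAlmostCouplingDeformation.apply_projForm [T2Space M] {V H : Distribution E M} {P : TwoTensor E M}
    {Pi : ℝ → TwoTensor E M} (hPi : IsAlmostCouplingDeformation V H P Pi)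
    (hP : IsLeafTangentPoisson V P) (h : ∀ q, IsCompl (V q) (H q)) {ε : ℝ}
    (hε : ε ∈ Set.Icc (0 : ℝ) 1) (α : OneForm E M) (q : M) :
    Pi ε q (projForm h α q) = P q (α q) := by
  let pr : (E →L[ℝ] ℝ) → (E →L[ℝ] ℝ) := fun β => β.comp (projE h q)
  let su : (E →L[ℝ] ℝ) → (E →L[ℝ] ℝ) := fun β => β - pr β
  have hprH : ∀ β, (pr β : Cot E q) ∈ annihilator H q := fun β v hv => by
    have h1 : projE h q v = 0 := by
      have := projE_of_mem h (Submodule.zero_mem (V q)) hv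
      exact (congrArg (projE h q) (zero_add (v : E))).symm.trans this
    change β (projE h q v) = 0
    rw [h1, map_zero]
  have hprV : ∀ β, ∀ v : E, v ∈ V q → pr β v = β v := fun β v hv => by
    have := projE_of_mem h hv (Submodule.zero_mem (H q))
    have h1 : projE h q v = v := (congrArg (projE h q) (add_zero (v : E))).symm.trans this
    change β (projE h q v) = β v
    rw [h1]
  have hsubV : ∀ β, (su β : Cot E q) ∈ annihilator V q := fun β v hv =>
    sub_eq_zero.2 (hprV β v hv).symm
  -- the values of the two tensors, and the pairings, in the model space
  let Q : (E →L[ℝ] ℝ) →L[ℝ] E := tensE (Pi ε) q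
  let P' : (E →L[ℝ] ℝ) →L[ℝ] E := tensE P q
  let γ : E →L[ℝ] ℝ := covE α q
  have hskQ : ∀ β β' : E →L[ℝ] ℝ, β' (Q β) = - β (Q β') := (hPi.isPoisson ε hε).skew q
  have hskP : ∀ β β' : E →L[ℝ] ℝ, β' (P' β) = - β (P' β') := hP.skew q
  have hsu : ∀ (β : E →L[ℝ] ℝ) (x : E), su β x = β x - pr β x := fun β x => rfl
  have h1 : ∀ β, pr β (Q (pr γ)) = pr β (P' (pr γ)) := fun β =>
    hPi.vertical ε hε q _ (hprH γ) _ (hprH β)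
  have h2 : ∀ β, pr γ (Q (su β)) = 0 := fun β =>
    hprH γ _ (hPi.almostCoupling ε hε q _ (hsubV β))
  have h3 : ∀ β δ, su β (P' δ) = 0 := fun β δ => hsubV β _ (hP.leafTangent q _)
  -- Split `β` and `γ` along the annihilators: the mixed terms of `Q` vanish, its `(0, 2)` part is
  -- that of `P'`, and `P'` kills the `V⁰`-components.
  have key : ∀ β : E →L[ℝ] ℝ, β (Q (pr γ)) = β (P' γ) := fun β => by
    have e1 := hskQ (pr γ) (su β)
    rw [h2, neg_zero, hsu, h1] at e1
    have e2 := h3 β γ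
    rw [hsu] at e2
    have e3 := h3 γ (pr β)
    rw [hsu] at e3
    have e4 := hskP γ (pr β)
    have e5 := hskP (pr γ) (pr β)
    linarith
  exact eq_of_forall_cot key

variable {F : Type*} [NormedAddCommGroup F] [NormedSpace ℝ F] [FiniteDimensional ℝ F]
  {G : Type*} [TopologicalSpace G] [ChartedSpace F G] [Group G] [LieGroup 𝓘(ℝ, F) ∞ G]
  [T2Space G] [MulAction G M] [ContMDiffSMul 𝓘(ℝ, F) 𝓘(ℝ, E) ∞ G M]

variable (M) in
/-- The infinitesimal generator of `a`, with `a` in the model space. -/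
def genE (a : F) : VField E M := infGen (F := F) (G := G) E M a

lemma contMDiff_expE_smul (a : F) (q : M) :
    ContMDiff 𝓘(ℝ, ℝ) 𝓘(ℝ, E) ∞ (fun t : ℝ => expE G (t • a) • q) :=
  ContMDiff.smul (I := 𝓘(ℝ, F)) (isOneParameterSubgroup_expE (G := G) a).smooth contMDiff_const

lemma hasMFDerivAt_expE_smul_zero (a : F) (q : M) :
    HasMFDerivAt 𝓘(ℝ, ℝ) 𝓘(ℝ, E) (fun t : ℝ => expE G (t • a) • q) 0
      ((1 : ℝ →L[ℝ] ℝ).smulRight (genE (G := G) M a q)) := by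
  have h1 := ((contMDiff_expE_smul (G := G) (E := E) a q 0).mdifferentiableAt
    (by simp)).hasMFDerivAt
  refine h1.congr_mfderiv ?_
  obtain ⟨L, hL⟩ : ∃ L : ℝ →L[ℝ] E,
    L = mfderiv 𝓘(ℝ, ℝ) 𝓘(ℝ, E) (fun t : ℝ => expE G (t • a) • q) 0 := ⟨_, rfl⟩
  refine ContinuousLinearMap.ext fun (s : ℝ) => ?_
  have : L s = s • L 1 := by rw [← map_smul, smul_eq_mul, mul_one]
  rw [hL] at this
  exact this

/-- The orbits of one-parameter subgroups are the integral curves of infinitesimal generators. -/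
lemma hasMFDerivAt_expE_smul (a : F) (q : M) (t : ℝ) :
    HasMFDerivAt 𝓘(ℝ, ℝ) 𝓘(ℝ, E) (fun t : ℝ => expE G (t • a) • q) t
      ((1 : ℝ →L[ℝ] ℝ).smulRight (genE (G := G) M a (expE G (t • a) • q))) := by
  have h1 := hasMFDerivAt_expE_smul_zero (G := G) (E := E) a (expE G (t • a) • q)
  have h4 : HasMFDerivAt 𝓘(ℝ, ℝ) 𝓘(ℝ, ℝ) (fun s : ℝ => s - t) t (ContinuousLinearMap.id ℝ ℝ) :=
    ((hasFDerivAt_id t).sub_const t).hasMFDerivAt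
  have h1' : HasMFDerivAt 𝓘(ℝ, ℝ) 𝓘(ℝ, E) (fun s : ℝ => expE G (s • a) • expE G (t • a) • q)
      (t - t) ((1 : ℝ →L[ℝ] ℝ).smulRight (genE (G := G) M a (expE G (t • a) • q))) := by
    rw [sub_self]; exact h1
  have h3 := HasMFDerivAt.comp (f := fun s : ℝ => s - t) t h1' h4
  have h5 : (fun s : ℝ => expE G (s • a) • expE G (t • a) • q) ∘ (fun s : ℝ => s - t) =
      fun s : ℝ => expE G (s • a) • q := by
    funext s
    change expE G ((s - t) • a) • expE G (t • a) • q = expE G (s • a) • q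
    rw [← mul_smul, ← expE_add_smul, sub_add_cancel]
  rw [h5] at h3
  exact h3

/-- If every element of the group is an exponential and the generators are sections of `D`, the
action is compatible with `D`. -/
lemma isCompatible_of_isSection {D : GenDistribution E M}
    {ρ : GroupLieAlgebra 𝓘(ℝ, F) G →ₗ[ℝ] OneForm E M}
    (hexp : ∀ g : G, ∃ a : F, expE G a = g)
    (h : ∀ a : GroupLieAlgebra 𝓘(ℝ, F) G, IsSection D (infGen E M a) (ρ a)) :
    IsCompatible D ρ where
  leaf g q := by
    obtain ⟨a, rfl⟩ := hexp g
    refine Relation.EqvGen.rel _ _ ⟨infGen (F := F) (G := G) E M a, ρ a,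
      fun t => expE G (t • a) • q, 0, 1, zero_le_one, h a, fun t _ => ?_, ?_, ?_⟩
    · exact (hasMFDerivAt_expE_smul a q t).hasMFDerivWithinAt
    · change expE G ((0 : ℝ) • a) • q = q
      rw [zero_smul, expE_zero, one_smul]
    · change expE G ((1 : ℝ) • a) • q = _
      rw [one_smul]
  isSection := h

end Compatibility

section LieDerivative

variable {E : Type*} [NormedAddCommGroup E] [NormedSpace ℝ E] [FiniteDimensional ℝ E]

/-- The differentials of the inverse flow of a vector field `X`, along an integral curve of `X`,
have the derivative `- DX` at the initial time. -/
lemma hasDerivAt_fderiv_inverse_flow {u : ℝ → E → E} {y₀ : E} {X : E → E} {DX : E →L[ℝ] E}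
    (hu : ContDiffAt ℝ ∞ (Function.uncurry u) (0, y₀))
    (hDX : HasFDerivAt X DX y₀)
    (hu0 : ∀ᶠ y in 𝓝 y₀, u 0 y = y)
    (hu1 : ∀ᶠ y in 𝓝 y₀, HasDerivAt (fun s => u s y) (X y) 0) :
    HasDerivAt (fun s => fderiv ℝ (u (-s)) (u s y₀)) (-DX) 0 := by
  have hu00 : u 0 y₀ = y₀ := hu0.self_of_nhds
  have hx : HasDerivAt (fun s => u s y₀) (X y₀) 0 := hu1.self_of_nhds
  let U := Function.uncurry u
  have hDU : ContDiffAt ℝ ∞ (fderiv ℝ U) (0, y₀) := hu.fderiv_right (m := ∞) (by simp)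
  have hDU' := (hDU.differentiableAt (by simp)).hasFDerivAt
  set D2 := fderiv ℝ (fderiv ℝ U) (0, y₀) with hD2
  -- symmetry of the second derivatives
  have hsymm : ∀ v w, D2 v w = D2 w v := by
    have := hu.isSymmSndFDerivAt (by
      simp only [minSmoothness_of_isRCLikeNormedField]; exact WithTop.coe_le_coe.2 (le_top : (2 : ℕ∞) ≤ ⊤))
    intro v w
    exact this v w
  have hdiffU : ∀ᶠ p in 𝓝 ((0 : ℝ), y₀), DifferentiableAt ℝ U p := by
    have := (hu.of_le (m := 1) (by exact_mod_cast le_top)).eventually (by simp)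
    filter_upwards [this] with p hp using hp.differentiableAt (by simp)
  have hpart : ∀ p : ℝ × E, DifferentiableAt ℝ U p →
      fderiv ℝ (u p.1) p.2 = (fderiv ℝ U p).comp (ContinuousLinearMap.inr ℝ ℝ E) := by
    rintro ⟨s, y⟩ hp
    have h1 : HasFDerivAt (fun y : E => (s, y)) (ContinuousLinearMap.inr ℝ ℝ E) y :=
      hasFDerivAt_prodMk_right s y
    exact (HasFDerivAt.comp (g := U) y hp.hasFDerivAt h1).fderiv
  have hslice : ∀ᶠ y in 𝓝 y₀, ∀ (σ : ℝ) (v : E), fderiv ℝ U (0, y) (σ, v) = σ • X y + v := by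
    have hc : Filter.Tendsto (fun y : E => ((0 : ℝ), y)) (𝓝 y₀) (𝓝 (0, y₀)) :=
      (Continuous.prodMk_right (0 : ℝ)).tendsto y₀
    filter_upwards [hc.eventually hdiffU, hu1, hu0.eventually_nhds] with y hy hy1 hy0 σ v
    have h1 : fderiv ℝ U (0, y) (1, 0) = X y := by
      have h2 : HasFDerivAt (fun s : ℝ => (s, y)) (ContinuousLinearMap.inl ℝ ℝ E) 0 :=
        hasFDerivAt_prodMk_left 0 y
      have h3 := HasFDerivAt.comp (g := U) (0 : ℝ) hy.hasFDerivAt h2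
      have h4 := h3.hasDerivAt.unique hy1
      simpa using h4
    have h2 : fderiv ℝ U (0, y) (0, v) = v := by
      have h3 := hpart (0, y) hy
      have h4 : fderiv ℝ (u 0) y = ContinuousLinearMap.id ℝ E := by
        have : u 0 =ᶠ[𝓝 y] id := hy0
        rw [this.fderiv_eq, fderiv_id]
      have h5 := congrArg (fun T : E →L[ℝ] E => T v) (h3.symm.trans h4)
      simpa using h5
    have h3 : ((σ, v) : ℝ × E) = σ • (1, 0) + (0, v) := by simp
    rw [h3, map_add, map_smul, h1, h2]
  have hD2' : ∀ (w : E) (σ : ℝ) (v : E), D2 (0, w) (σ, v) = σ • DX w := by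
    intro w σ v
    have h1 : HasFDerivAt (fun y : E => fderiv ℝ U (0, y) (σ, v))
        ((D2.comp (ContinuousLinearMap.inr ℝ ℝ E)).flip (σ, v)) y₀ := by
      have h2 : HasFDerivAt (fun y : E => ((0 : ℝ), y)) (ContinuousLinearMap.inr ℝ ℝ E) y₀ :=
        hasFDerivAt_prodMk_right 0 y₀
      have h3 := HasFDerivAt.comp (g := fderiv ℝ U) y₀ hDU' h2
      have h4 := hasFDerivAt_clm_eval h3.differentiableAt (σ, v)
      rw [h3.fderiv] at h4
      exact h4
    have h2 : HasFDerivAt (fun y : E => fderiv ℝ U (0, y) (σ, v)) (σ • DX) y₀ := by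
      refine ((hDX.const_smul σ).add_const v).congr_of_eventuallyEq ?_
      filter_upwards [hslice] with y hy using hy σ v
    have := congrArg (fun T : E →L[ℝ] E => T w) (h1.unique h2)
    simpa using this
  have hcurve : HasDerivAt (fun s : ℝ => ((-s, u s y₀) : ℝ × E)) (-1, X y₀) 0 :=
    (hasDerivAt_neg' 0).prodMk hx
  have h0 : ((-(0 : ℝ), u 0 y₀) : ℝ × E) = (0, y₀) := by rw [hu00, neg_zero]
  have h1 : HasDerivAt (fun s : ℝ => fderiv ℝ U (-s, u s y₀)) (D2 (-1, X y₀)) 0 := by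
    have h2 : HasFDerivAt (fderiv ℝ U) D2 (-(0 : ℝ), u 0 y₀) := by rw [h0]; exact hDU'
    exact h2.comp_hasDerivAt (0 : ℝ) hcurve
  have h3 := h1.clm_comp (hasDerivAt_const (0 : ℝ) (ContinuousLinearMap.inr ℝ ℝ E))
  have h4 : (fun s => fderiv ℝ (u (-s)) (u s y₀)) =ᶠ[𝓝 0] fun s =>
      (fderiv ℝ U (-s, u s y₀)).comp (ContinuousLinearMap.inr ℝ ℝ E) := by
    have h5 : Filter.Tendsto (fun s : ℝ => ((-s, u s y₀) : ℝ × E)) (𝓝 0) (𝓝 (0, y₀)) := by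
      have := hcurve.continuousAt.tendsto
      rwa [h0] at this
    filter_upwards [h5.eventually hdiffU] with s hs using hpart _ hs
  refine (h3.congr_of_eventuallyEq h4).congr_deriv ?_
  ext w
  have h6 : D2 (-1, X y₀) (0, w) = - DX w := by
    rw [hsymm, hD2', neg_one_smul]
  simpa using h6

/-- The Jacobi identity, contracted with `r`, in terms of the derivative `DX` of `X = P^♯ r`. -/
lemma jacobi_contraction {y₀ : E} {P : E → (E →L[ℝ] ℝ) →L[ℝ] E}
    {r : E → E →L[ℝ] ℝ} (hP : ContDiffAt ℝ ∞ P y₀)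
    (hskew : ∀ y (l m : E →L[ℝ] ℝ), l (P y m) = - m (P y l))
    (hjac : ∀ l m n : E →L[ℝ] ℝ, n (fderiv ℝ P y₀ (P y₀ l) m) + l (fderiv ℝ P y₀ (P y₀ m) n)
      + m (fderiv ℝ P y₀ (P y₀ n) l) = 0) {DX : E →L[ℝ] E}
    (hDX : DX = (fderiv ℝ P y₀).flip (r y₀) + (P y₀).comp (fderiv ℝ r y₀)) (l : E →L[ℝ] ℝ) :
    -DX (P y₀ l) + (fderiv ℝ P y₀ (P y₀ (r y₀)) l + P y₀ (-l.comp DX)) =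
      -P y₀ (extdBil r y₀ (P y₀ l)) := by
  have hsep : ∀ v w : E, (∀ m : E →L[ℝ] ℝ, m v = m w) → v = w := fun v w h =>
    (SeparatingDual.eq_iff_forall_dual_eq (R := ℝ)).2 h
  refine hsep _ _ fun m => ?_
  have k1 : ∀ w, DX w = fderiv ℝ P y₀ w (r y₀) + P y₀ (fderiv ℝ r y₀ w) := fun w => by
    rw [hDX]; rfl
  have k2 := hskew y₀ m (l.comp DX)
  have k3 := hskew y₀ m (extdBil r y₀ (P y₀ l))
  have k4 : extdBil r y₀ (P y₀ l) (P y₀ m) =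
    fderiv ℝ r y₀ (P y₀ l) (P y₀ m) - fderiv ℝ r y₀ (P y₀ m) (P y₀ l) := rfl
  have k5 := hskew y₀ m (fderiv ℝ r y₀ (P y₀ l))
  have k6 := hskew y₀ l (fderiv ℝ r y₀ (P y₀ m))
  have k7 := hjac l m (r y₀)
  -- skew-symmetry of the derivative of `P`
  have k8 : ∀ w, (r y₀) (fderiv ℝ P y₀ w m) = - m (fderiv ℝ P y₀ w (r y₀)) := by
    intro w
    have hd := hP.differentiableAt (by simp : (∞ : WithTop ℕ∞) ≠ 0)
    have a1 := (r y₀).hasFDerivAt.comp y₀ (hasFDerivAt_clm_eval hd m)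
    have a2 := (m.hasFDerivAt.comp y₀ (hasFDerivAt_clm_eval hd (r y₀))).neg
    have a3 : (r y₀) ∘ (fun z => P z m) = -(m ∘ fun z => P z (r y₀)) := by
      funext z; exact hskew z (r y₀) m
    rw [a3] at a1
    exact congrArg (fun T : E →L[ℝ] ℝ => T w) (a1.unique a2)
  have k9 := k8 (P y₀ l)
  have k10 : (l.comp DX) (P y₀ m) = l (DX (P y₀ m)) := rfl
  rw [k10, k1, map_add] at k2
  rw [k1]
  simp only [map_add, map_neg] at k2 ⊢
  linarith

/-- The Lie derivative of a Poisson tensor `P` along `X = P^♯ r` is `- P^♯ ∘ dr ∘ P^♯`: here `u` is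
the flow of `X`, and the left-hand side is the derivative of the pull-backs of `P` by the flow. -/
lemma hasDerivAt_pullback_tensor {u : ℝ → E → E} {y₀ : E} {P : E → (E →L[ℝ] ℝ) →L[ℝ] E}
    {r : E → E →L[ℝ] ℝ} (hu : ContDiffAt ℝ ∞ (Function.uncurry u) (0, y₀))
    (hP : ContDiffAt ℝ ∞ P y₀) (hr : ContDiffAt ℝ ∞ r y₀)
    (hu0 : ∀ᶠ y in 𝓝 y₀, u 0 y = y)
    (hu1 : ∀ᶠ y in 𝓝 y₀, HasDerivAt (fun s => u s y) (P y (r y)) 0)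
    (hskew : ∀ y (l m : E →L[ℝ] ℝ), l (P y m) = - m (P y l))
    (hjac : ∀ l m n : E →L[ℝ] ℝ, n (fderiv ℝ P y₀ (P y₀ l) m) + l (fderiv ℝ P y₀ (P y₀ m) n)
      + m (fderiv ℝ P y₀ (P y₀ n) l) = 0) :
    HasDerivAt (fun s => (fderiv ℝ (u (-s)) (u s y₀)).comp ((P (u s y₀)).comp
        ((ContinuousLinearMap.compL ℝ E E ℝ).flip (fderiv ℝ (u (-s)) (u s y₀)))))
      (-(P y₀).comp ((extdBil r y₀).comp (P y₀))) 0 := by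
  have hu00 : u 0 y₀ = y₀ := hu0.self_of_nhds
  have hx : HasDerivAt (fun s => u s y₀) (P y₀ (r y₀)) 0 := hu1.self_of_nhds
  -- the derivative of the vector field
  let DX : E →L[ℝ] E := (fderiv ℝ P y₀).flip (r y₀) + (P y₀).comp (fderiv ℝ r y₀)
  have hDX : HasFDerivAt (fun y => P y (r y)) DX y₀ := by
    have h := (hP.differentiableAt (by simp)).hasFDerivAt.clm_apply
      (hr.differentiableAt (by simp)).hasFDerivAt
    refine h.congr_fderiv ?_
    ext v
    simp [DX, add_comm]
  have hJ := hasDerivAt_fderiv_inverse_flow hu hDX hu0 hu1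
  have hJ0 : fderiv ℝ (u (-0)) (u 0 y₀) = ContinuousLinearMap.id ℝ E := by
    have : u 0 =ᶠ[𝓝 y₀] id := hu0
    rw [hu00, neg_zero, this.fderiv_eq, fderiv_id]
  have hPx : HasDerivAt (fun s => P (u s y₀)) (fderiv ℝ P y₀ (P y₀ (r y₀))) 0 := by
    have h2 : HasFDerivAt P (fderiv ℝ P y₀) (u 0 y₀) := by
      rw [hu00]; exact (hP.differentiableAt (by simp)).hasFDerivAt
    have h3 := HasFDerivAt.comp_hasDerivAt (E := (E →L[ℝ] ℝ) →L[ℝ] E) (f := fun s => u s y₀) (0 : ℝ) h2 hx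
    exact h3
  have hT : HasDerivAt (fun s => (ContinuousLinearMap.compL ℝ E E ℝ).flip
      (fderiv ℝ (u (-s)) (u s y₀))) ((ContinuousLinearMap.compL ℝ E E ℝ).flip (-DX)) 0 :=
    HasFDerivAt.comp_hasDerivAt (E := (E →L[ℝ] ℝ) →L[ℝ] (E →L[ℝ] ℝ)) (0 : ℝ)
      (ContinuousLinearMap.hasFDerivAt (ContinuousLinearMap.compL ℝ E E ℝ).flip) hJ
  refine (hJ.clm_comp (hPx.clm_comp hT)).congr_deriv ?_
  rw [hJ0, hu00]
  refine ContinuousLinearMap.ext fun l => ?_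
  have hl : (ContinuousLinearMap.compL ℝ E E ℝ).flip (ContinuousLinearMap.id ℝ E) l = l := by
    ext; simp
  have hl' : (ContinuousLinearMap.compL ℝ E E ℝ).flip (-DX) l = - l.comp DX := by
    ext; simp
  change -DX (P y₀ ((ContinuousLinearMap.compL ℝ E E ℝ).flip (ContinuousLinearMap.id ℝ E) l)) +
    (fderiv ℝ P y₀ (P y₀ (r y₀))
        ((ContinuousLinearMap.compL ℝ E E ℝ).flip (ContinuousLinearMap.id ℝ E) l)
      + P y₀ ((ContinuousLinearMap.compL ℝ E E ℝ).flip (-DX) l)) =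
    -P y₀ (extdBil r y₀ (P y₀ l))
  rw [hl, hl']
  exact jacobi_contraction hP hskew hjac rfl l

end LieDerivative

/-! ### Pull-backs of forms by the action -/

section ActionForms

variable {E : Type*} [NormedAddCommGroup E] [NormedSpace ℝ E] [FiniteDimensional ℝ E]
  {M : Type*} [TopologicalSpace M] [ChartedSpace E M] [IsManifold 𝓘(ℝ, E) ∞ M]

/-- The operator that computes the exterior derivative of a 1-form at `q` from the differential of
its local expression. -/
def extdOp (q : M) : (E →L[ℝ] E →L[ℝ] ℝ) →L[ℝ] (E →L[ℝ] E →L[ℝ] ℝ) :=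
  ((ContinuousLinearMap.compL ℝ E (E →L[ℝ] ℝ) (E →L[ℝ] ℝ)
    (ContinuousLinearMap.precomp ℝ (chartD E q q))).comp
    ((ContinuousLinearMap.compL ℝ E E (E →L[ℝ] ℝ)).flip (chartD E q q))).comp
    (ContinuousLinearMap.id ℝ _ -
      (ContinuousLinearMap.flipₗᵢ ℝ E E ℝ).toContinuousLinearEquiv.toContinuousLinearMap)

lemma extdE_eq_extdOp (α : OneForm E M) (q : M) :
    extdE α q = extdOp q (fderiv ℝ (localExpr α q) (extChartAt 𝓘(ℝ, E) q q)) := rfl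

variable {F : Type*} [NormedAddCommGroup F] [NormedSpace ℝ F] [FiniteDimensional ℝ F]
  {G : Type*} [TopologicalSpace G] [ChartedSpace F G] [Group G] [LieGroup 𝓘(ℝ, F) ∞ G]
  [MulAction G M] [ContMDiffSMul 𝓘(ℝ, F) 𝓘(ℝ, E) ∞ G M]

variable (F) in
include F in
lemma contMDiff_act (g : G) : ContMDiff 𝓘(ℝ, E) 𝓘(ℝ, E) ∞ (fun p : M => g • p) :=
  ContMDiffSMul.contMDiff_const_smul (I := 𝓘(ℝ, F)) g

/-- In charts, the action is jointly smooth. -/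
lemma contMDiffAt_mapLoc_smul {q r : M} {g : G} {y : E} (hy : y ∈ (extChartAt 𝓘(ℝ, E) q).target)
    (hr : g • (extChartAt 𝓘(ℝ, E) q).symm y ∈ (extChartAt 𝓘(ℝ, E) r).source) :
    ContMDiffAt (𝓘(ℝ, F).prod 𝓘(ℝ, E)) 𝓘(ℝ, E) ∞
      (Function.uncurry fun (g : G) => mapLoc (fun p : M => g • p) q r) (g, y) := by
  have h1 : ContMDiffAt (𝓘(ℝ, F).prod 𝓘(ℝ, E)) 𝓘(ℝ, E) ∞
      (fun x : G × E => (extChartAt 𝓘(ℝ, E) q).symm x.2) (g, y) :=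
    ContMDiffAt.comp (g := (extChartAt 𝓘(ℝ, E) q).symm) (f := Prod.snd) (g, y)
      (contMDiffAt_chart_symm hy) contMDiffAt_snd
  have h2 : ContMDiffAt (𝓘(ℝ, F).prod 𝓘(ℝ, E)) 𝓘(ℝ, E) ∞
      (fun x : G × E => x.1 • (extChartAt 𝓘(ℝ, E) q).symm x.2) (g, y) :=
    ContMDiffAt.smul (I := 𝓘(ℝ, F)) contMDiffAt_fst h1
  exact ContMDiffAt.comp (g := extChartAt 𝓘(ℝ, E) r) (g, y) (contMDiffAt_chart hr) h2

/-- In a chart, the pull-back of a smooth 1-form by the action is jointly smooth. -/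
lemma contMDiffOn_localExpr_pullForm_smul {α : OneForm E M} (hα : SmoothOneForm α) (q : M) :
    ContMDiffOn (𝓘(ℝ, F).prod 𝓘(ℝ, E)) 𝓘(ℝ, E →L[ℝ] ℝ) ∞
      (Function.uncurry fun (g : G) => localExpr (pullForm (fun p : M => g • p) α) q)
      (Set.univ ×ˢ (extChartAt 𝓘(ℝ, E) q).target) := by
  rintro ⟨g, y⟩ ⟨-, hy⟩
  refine ContMDiffAt.contMDiffWithinAt ?_
  have : ContinuousSMul G M := ContMDiffSMul.continuousSMul (I := 𝓘(ℝ, F)) (I' := 𝓘(ℝ, E)) ∞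
  let r : M := g • (extChartAt 𝓘(ℝ, E) q).symm y
  have hm := contMDiffAt_mapLoc_smul (F := F) (g := g) hy (mem_extChartAt_source (I := 𝓘(ℝ, E)) r)
  have hα' : ContMDiffAt 𝓘(ℝ, E) 𝓘(ℝ, E →L[ℝ] ℝ) ∞ (localExpr α r)
      (mapLoc (fun p : M => g • p) q r y) :=
    contMDiffAt_iff_contDiffAt.2 (hα.contDiffAt r)
  have h1 := (ContMDiffAt.comp (g := localExpr α r) (g, y) hα' hm).clm_comp
    (contMDiffAt_partial_fderiv hm)
  refine h1.congr_of_eventuallyEq ?_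
  have hc : ContinuousAt (fun x : G × E => x.1 • (extChartAt 𝓘(ℝ, E) q).symm x.2) (g, y) :=
    continuousAt_fst.smul (ContinuousAt.comp (f := Prod.snd) (x := (g, y))
      (contMDiffAt_chart_symm hy).continuousAt continuousAt_snd)
  have hs : ∀ᶠ x : G × E in 𝓝 (g, y),
      x.1 • (extChartAt 𝓘(ℝ, E) q).symm x.2 ∈ (extChartAt 𝓘(ℝ, E) r).source :=
    hc.eventually_mem ((isOpen_extChartAt_source r).mem_nhds (mem_extChartAt_source r))
  have ht : ∀ᶠ x : G × E in 𝓝 (g, y), x.2 ∈ (extChartAt 𝓘(ℝ, E) q).target :=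
    continuousAt_snd.eventually_mem ((isOpen_extChartAt_target q).mem_nhds hy)
  filter_upwards [hs, ht] with x hx hxt
  have h2 := localExpr_pullForm (f := fun p : M => x.1 • p) (r := r) α
    ((extChartAt 𝓘(ℝ, E) q).map_target hxt) hx
    ((contMDiff_act F x.1 _).mdifferentiableAt (by simp))
  rw [(extChartAt 𝓘(ℝ, E) q).right_inv hxt] at h2
  exact h2

/-- In a chart, the pull-backs by the action of a linear family of smooth 1-forms are jointly
smooth. -/
lemma contMDiffOn_localExpr_pullForm_family {ρ : F →ₗ[ℝ] OneForm E M}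
    (hρ : ∀ a, SmoothOneForm (ρ a)) (q : M) :
    ContMDiffOn ((𝓘(ℝ, F).prod 𝓘(ℝ, F)).prod 𝓘(ℝ, E)) 𝓘(ℝ, E →L[ℝ] ℝ) ∞
      (Function.uncurry fun (z : G × F) => localExpr (pullForm (fun p : M => z.1 • p) (ρ z.2)) q)
      (Set.univ ×ˢ (extChartAt 𝓘(ℝ, E) q).target) := by
  let b := Module.finBasis ℝ F
  have hsum : ∀ (z : G × F) (y : E), localExpr (pullForm (fun p : M => z.1 • p) (ρ z.2)) q y =
      ∑ i, b.repr z.2 i • localExpr (pullForm (fun p : M => z.1 • p) (ρ (b i))) q y := by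
    intro z y
    let Λ : OneForm E M →ₗ[ℝ] (E →L[ℝ] ℝ) :=
      { toFun := fun α => localExpr (pullForm (fun p : M => z.1 • p) α) q y
        map_add' := fun α β => rfl
        map_smul' := fun c α => rfl }
    change Λ (ρ z.2) = ∑ i, b.repr z.2 i • Λ (ρ (b i))
    conv_lhs => rw [← b.sum_repr z.2]
    simp only [map_sum, map_smul]
  have h1 : ContMDiffOn ((𝓘(ℝ, F).prod 𝓘(ℝ, F)).prod 𝓘(ℝ, E)) 𝓘(ℝ, E →L[ℝ] ℝ) ∞
      (fun x : (G × F) × E => ∑ i, b.repr x.1.2 i •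
        localExpr (pullForm (fun p : M => x.1.1 • p) (ρ (b i))) q x.2)
      (Set.univ ×ˢ (extChartAt 𝓘(ℝ, E) q).target) := by
    refine contMDiffOn_finsetSum fun i _ => ?_
    have h2 : ContMDiff ((𝓘(ℝ, F).prod 𝓘(ℝ, F)).prod 𝓘(ℝ, E)) 𝓘(ℝ, ℝ) ∞
        (fun x : (G × F) × E => b.repr x.1.2 i) :=
      ContMDiff.comp (I' := 𝓘(ℝ, F)) (g := fun v : F => b.repr v i) (f := fun x : (G × F) × E => x.1.2)
        (contMDiff_iff_contDiff.2 (LinearMap.toContinuousLinearMap (b.coord i)).contDiff)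
        (contMDiff_snd.comp contMDiff_fst)
    have h3 := ContMDiffOn.comp (I' := 𝓘(ℝ, F).prod 𝓘(ℝ, E))
      (f := fun x : (G × F) × E => (x.1.1, x.2))
      (s := Set.univ ×ˢ (extChartAt 𝓘(ℝ, E) q).target)
      (contMDiffOn_localExpr_pullForm_smul (F := F) (G := G) (hρ (b i)) q)
      (ContMDiff.contMDiffOn (n := ∞) (I := (𝓘(ℝ, F).prod 𝓘(ℝ, F)).prod 𝓘(ℝ, E))
        ((contMDiff_fst.comp contMDiff_fst).prodMk contMDiff_snd)) (fun x hx => ⟨trivial, hx.2⟩)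
    exact h2.contMDiffOn.smul h3
  exact h1.congr fun x _ => hsum x.1 x.2

/-- The exterior derivatives at `q` of the pull-backs depend continuously on the parameters. -/
lemma continuous_extdE_pullForm {ρ : F →ₗ[ℝ] OneForm E M}
    (hρ : ∀ a, SmoothOneForm (ρ a)) (q : M) :
    Continuous fun z : G × F => extdE (pullForm (fun p : M => z.1 • p) (ρ z.2)) q := by
  simp_rw [extdE_eq_extdOp]
  refine (extdOp q).continuous.comp ?_
  have h : ∀ z : G × F, ContinuousAt (fun x : (G × F) × E =>
      fderiv ℝ (localExpr (pullForm (fun p : M => x.1.1 • p) (ρ x.1.2)) q) x.2)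
      (z, extChartAt 𝓘(ℝ, E) q q) := fun z =>
    have : IsManifold (𝓘(ℝ, F).prod 𝓘(ℝ, F)) 1 (G × F) := inferInstance
    (contMDiffAt_partial_fderiv ((contMDiffOn_localExpr_pullForm_family hρ q).contMDiffAt
      ((isOpen_univ.prod (isOpen_extChartAt_target q)).mem_nhds
        ⟨trivial, mem_extChartAt_target q⟩))).continuousAt
  exact continuous_iff_continuousAt.2 fun z =>
    ContinuousAt.comp (f := fun z : G × F => (z, extChartAt 𝓘(ℝ, E) q q)) (h z) (by fun_prop)

end ActionForms

/-! ### The Riccati equation for pull-backs of a Poisson tensor -/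

section Riccati

open Set

variable {E : Type*} [NormedAddCommGroup E] [NormedSpace ℝ E]
  {V : Type*} [NormedAddCommGroup V] [NormedSpace ℝ V]

/-- Solutions of `Q' = - Q b Q` satisfy `Q (1 + B Q(0)) = Q(0)`, where `B` is the integral of `b`:
the difference of the two sides satisfies a linear differential equation. -/
lemma riccati_solution [FiniteDimensional ℝ V] {Q : ℝ → V →L[ℝ] E} {b : ℝ → E →L[ℝ] V}
    (hb : Continuous b)
    (hQ : ∀ t, HasDerivAt Q (-(Q t).comp ((b t).comp (Q t))) t) (l : V) :
    Q 1 (l + (∫ t in (0 : ℝ)..1, b t) (Q 0 l)) = Q 0 l := by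
  have : CompleteSpace V := FiniteDimensional.complete ℝ V
  -- The defect `z s = Q s (l + B s (Q 0 l)) - Q 0 l` solves `z' = - Q b z`, `z 0 = 0`.
  let B : ℝ → E →L[ℝ] V := fun s => ∫ t in (0 : ℝ)..s, b t
  have hB : ∀ s, HasDerivAt B (b s) s := fun s => hb.integral_hasStrictDerivAt 0 s |>.hasDerivAt
  let z : ℝ → E := fun s => Q s (l + B s (Q 0 l)) - Q 0 l
  have hz : ∀ s, HasDerivAt z (-(Q s (b s (z s)))) s := by
    intro s
    have h1 : HasDerivAt (fun s => l + B s (Q 0 l)) (b s (Q 0 l)) s := by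
      have h2 := (hB s).clm_apply (hasDerivAt_const s (Q 0 l))
      simpa using h2.const_add l
    refine (((hQ s).clm_apply h1).sub_const (Q 0 l)).congr_deriv ?_
    simp only [z, map_sub, map_add, neg_apply, ContinuousLinearMap.comp_apply]
    abel
  have hQc : Continuous Q := continuous_iff_continuousAt.2 fun t => (hQ t).continuousAt
  have hA : Continuous fun s => (Q s).comp (b s) := hQc.clm_comp hb
  obtain ⟨C, hC⟩ := (isCompact_Icc (a := (0 : ℝ)) (b := 1)).exists_bound_of_continuousOn
    hA.continuousOn
  have h0 : z 0 = 0 := by simp [z, B]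
  have h1 := norm_le_gronwallBound_of_norm_deriv_right_le (f := z) (a := 0) (b := 1) (δ := 0)
    (K := C) (ε := 0) (fun s _ => (hz s).continuousAt.continuousWithinAt)
    (fun s _ => (hz s).hasDerivWithinAt) (by simp [h0]) (fun s hs => by
      rw [norm_neg, add_zero]
      exact ((Q s).comp (b s)).le_of_opNorm_le (hC s (Ico_subset_Icc_self hs)) (z s))
    1 (right_mem_Icc.2 zero_le_one)
  have h2 : z 1 = 0 := by
    rw [gronwallBound_ε0_δ0] at h1
    exact norm_le_zero_iff.1 h1
  exact sub_eq_zero.1 h2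

end Riccati

section Flow

variable {E : Type*} [NormedAddCommGroup E] [NormedSpace ℝ E] [FiniteDimensional ℝ E]
  {M : Type*} [TopologicalSpace M] [ChartedSpace E M] [IsManifold 𝓘(ℝ, E) ∞ M]
  {F : Type*} [NormedAddCommGroup F] [NormedSpace ℝ F] [FiniteDimensional ℝ F]
  {G : Type*} [TopologicalSpace G] [ChartedSpace F G] [Group G] [LieGroup 𝓘(ℝ, F) ∞ G]
  [MulAction G M] [ContMDiffSMul 𝓘(ℝ, F) 𝓘(ℝ, E) ∞ G M]

variable (E) in
/-- The tangent map of the action, as an endomorphism of the model space. -/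
def actE (g : G) (p : M) : E →L[ℝ] E := tmap E (fun x : M => g • x) p

variable (F) in
include F in
lemma actE_mul (g h : G) (p : M) : actE E (g * h) p = (actE E g (h • p)).comp (actE E h p) := by
  have h1 : (fun x : M => (g * h) • x) = (fun x : M => g • x) ∘ fun x : M => h • x := by
    funext x; exact mul_smul g h x
  rw [actE, h1]
  exact mfderiv_comp p ((contMDiff_act F g _).mdifferentiableAt (by simp))
    ((contMDiff_act F h _).mdifferentiableAt (by simp))

lemma actE_one (p : M) : actE E (1 : G) p = ContinuousLinearMap.id ℝ E := by
  have h1 : (fun x : M => (1 : G) • x) = id := by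
    funext x; exact one_smul G x
  rw [actE, h1]
  exact mfderiv_id

variable (F) in
include F in
lemma actE_inv_actE (g : G) (p : M) (v : E) : actE E g⁻¹ (g • p) (actE E g p v) = v := by
  have h := actE_mul (E := E) F g⁻¹ g p
  rw [inv_mul_cancel, actE_one] at h
  exact (congrArg (fun T : E →L[ℝ] E => T v) h).symm

variable (F) in
include F in
lemma actE_actE_inv (g : G) (p : M) (v : E) : actE E g p (actE E g⁻¹ (g • p) v) = v := by
  have h := actE_inv_actE (E := E) F g⁻¹ (g • p) v
  rwa [inv_inv, inv_smul_smul] at h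

/-- The pull-back at `q` of a 2-tensor by the action of `g`. -/
def pullTens (P : TwoTensor E M) (g : G) (q : M) : (E →L[ℝ] ℝ) →L[ℝ] E :=
  (actE E g⁻¹ (g • q)).comp ((tensE P (g • q)).comp
    ((ContinuousLinearMap.compL ℝ E E ℝ).flip (actE E g⁻¹ (g • q))))

lemma pullTens_one (P : TwoTensor E M) (q : M) : pullTens P (1 : G) q = tensE P q := by
  rw [pullTens, inv_one, one_smul, actE_one]
  ext l
  simp

variable (F) in
include F in
lemma pullTens_mul (P : TwoTensor E M) (g h : G) (q : M) :
    pullTens P (g * h) q = (actE E h⁻¹ (h • q)).comp ((pullTens P g (h • q)).comp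
      ((ContinuousLinearMap.compL ℝ E E ℝ).flip (actE E h⁻¹ (h • q)))) := by
  have h1 : actE E (g * h)⁻¹ ((g * h) • q) =
      (actE E h⁻¹ (h • q)).comp (actE E g⁻¹ (g • h • q)) := by
    rw [mul_inv_rev, actE_mul F, mul_smul, inv_smul_smul]
  rw [pullTens, h1, mul_smul]
  rfl

variable [T2Space M] [T2Space G]

/-- If the infinitesimal generator of `a` is `P^♯ r`, the pull-backs of the Poisson tensor `P` by
`exp (s a)` have the derivative `- P^♯ ∘ dr ∘ P^♯` at `s = 0`. -/
lemma hasDerivAt_pullTens_zero {P : TwoTensor E M} (hP : IsPoisson P) {r : OneForm E M}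
    (hr : SmoothOneForm r) {a : F} (ha : ∀ q, genE (G := G) M a q = P q (r q)) (q : M) :
    HasDerivAt (fun s : ℝ => pullTens P (expE G (s • a)) q)
      (-(tensE P q).comp ((extdE r q).comp (tensE P q))) 0 := by
  set y₀ := extChartAt 𝓘(ℝ, E) q q with hy₀
  let c : E →L[ℝ] E := chartD E q q
  let cs : E →L[ℝ] E := chartDs q y₀
  have hsrc := mem_extChartAt_source (I := 𝓘(ℝ, E)) q
  have hcc : ∀ v, cs (c v) = v := chartDs_chartD hsrc
  let u : ℝ → E → E := fun s => mapLoc (fun p : M => expE G (s • a) • p) q q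
  have hγ := isOneParameterSubgroup_expE (G := G) a
  have hsymm : (extChartAt 𝓘(ℝ, E) q).symm y₀ = q := extChartAt_to_inv q
  have hu : ContDiffAt ℝ ∞ (Function.uncurry u) (0, y₀) := by
    have h1 : ContMDiffAt (𝓘(ℝ, F).prod 𝓘(ℝ, E)) 𝓘(ℝ, E) ∞
        (Function.uncurry fun (g : G) => mapLoc (fun p : M => g • p) q q)
        (expE G ((0 : ℝ) • a), y₀) := by
      refine contMDiffAt_mapLoc_smul (mem_extChartAt_target q) ?_
      rw [zero_smul, expE_zero, one_smul, hsymm]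
      exact hsrc
    have h2 : ContMDiffAt (𝓘(ℝ, ℝ).prod 𝓘(ℝ, E)) (𝓘(ℝ, F).prod 𝓘(ℝ, E)) ∞
        (fun x : ℝ × E => (expE G (x.1 • a), x.2)) (0, y₀) :=
      (ContMDiffAt.comp (I' := 𝓘(ℝ, ℝ)) (g := fun t : ℝ => expE G (t • a)) (f := Prod.fst) _
        (hγ.smooth _) contMDiffAt_fst).prodMk contMDiffAt_snd
    have h3 : ContMDiffAt (𝓘(ℝ, ℝ).prod 𝓘(ℝ, E)) 𝓘(ℝ, E) ∞ (Function.uncurry u) (0, y₀) :=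
      ContMDiffAt.comp (g := Function.uncurry fun (g : G) => mapLoc (fun p : M => g • p) q q)
        (0, y₀) h1 h2
    rw [← modelWithCornersSelf_prod, chartedSpaceSelf_prod] at h3
    exact contMDiffAt_iff_contDiffAt.1 h3
  have hu0 : ∀ᶠ y in 𝓝 y₀, u 0 y = y := by
    filter_upwards [target_mem_nhds (E := E) q] with y hy
    change extChartAt 𝓘(ℝ, E) q (expE G ((0 : ℝ) • a) • (extChartAt 𝓘(ℝ, E) q).symm y) = y
    rw [zero_smul, expE_zero, one_smul, (extChartAt 𝓘(ℝ, E) q).right_inv hy]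
  have hu1 : ∀ᶠ y in 𝓝 y₀, HasDerivAt (fun s => u s y) (tensLoc P q y (localExpr r q y)) 0 := by
    filter_upwards [target_mem_nhds (E := E) q] with y hy
    set p : M := (extChartAt 𝓘(ℝ, E) q).symm y with hp
    have hps : p ∈ (extChartAt 𝓘(ℝ, E) q).source := (extChartAt 𝓘(ℝ, E) q).map_target hy
    have h1 := hasMFDerivAt_expE_smul_zero (G := G) (E := E) a p
    have h2 : HasMFDerivAt 𝓘(ℝ, E) 𝓘(ℝ, E) (extChartAt 𝓘(ℝ, E) q) (expE G ((0 : ℝ) • a) • p)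
        (mfderiv 𝓘(ℝ, E) 𝓘(ℝ, E) (extChartAt 𝓘(ℝ, E) q) (expE G ((0 : ℝ) • a) • p)) := by
      refine ((contMDiffAt_chart ?_).mdifferentiableAt (by simp)).hasMFDerivAt
      rw [zero_smul, expE_zero, one_smul]; exact hps
    have h3 := HasMFDerivAt.comp (0 : ℝ) h2 h1
    obtain ⟨L, hL⟩ : ∃ L : ℝ →L[ℝ] E, L = (chartD E q (expE G ((0 : ℝ) • a) • p)).comp
      ((1 : ℝ →L[ℝ] ℝ).smulRight (vecE (genE (G := G) M a) p)) := ⟨_, rfl⟩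
    have h4 : HasMFDerivAt 𝓘(ℝ, ℝ) 𝓘(ℝ, E) (fun s => u s y) (0 : ℝ) L := by
      rw [hL]; exact h3
    have h5 : HasFDerivAt (fun s => u s y) L 0 := hasMFDerivAt_iff_hasFDerivAt.1 h4
    have h6 := h5.hasDerivAt
    refine h6.congr_deriv ?_
    have h7 : genE (G := G) M a = sharp P r := funext ha
    rw [← vecLoc_sharp P r hy, hL, zero_smul, expE_zero, one_smul, h7]
    have h8 := vecLoc_chart (sharp P r) hps
    rw [hp, (extChartAt 𝓘(ℝ, E) q).right_inv hy] at h8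
    rw [h8]
    change chartD E q p ((1 : ℝ) • vecE (sharp P r) p) = _
    rw [one_smul]
    rfl
  have hx0 : ∀ s, u s y₀ = extChartAt 𝓘(ℝ, E) q (expE G (s • a) • q) := fun s => by
    change extChartAt 𝓘(ℝ, E) q (expE G (s • a) • (extChartAt 𝓘(ℝ, E) q).symm y₀) = _
    rw [hsymm]
  have hmain := hasDerivAt_pullback_tensor hu (hP.toIsBivectorField.contDiffAt_tensLoc q)
    (hr.contDiffAt q) hu0 hu1 (hP.toIsBivectorField.tensLoc_skew q) (hP.tensLoc_jacobi q)
  have hconj := ((hasDerivAt_const (0 : ℝ) cs).clm_comp (hmain.clm_comp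
    (hasDerivAt_const (0 : ℝ) ((ContinuousLinearMap.compL ℝ E E ℝ).flip cs))))
  have hev : (fun s : ℝ => pullTens P (expE G (s • a)) q) =ᶠ[𝓝 0] fun s =>
      cs.comp (((fderiv ℝ (u (-s)) (u s y₀)).comp ((tensLoc P q (u s y₀)).comp
        ((ContinuousLinearMap.compL ℝ E E ℝ).flip (fderiv ℝ (u (-s)) (u s y₀))))).comp
        ((ContinuousLinearMap.compL ℝ E E ℝ).flip cs)) := by
    have hcont : ContinuousAt (fun s : ℝ => expE G (s • a) • q) 0 :=
      (contMDiff_expE_smul (E := E) a q 0).continuousAt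
    have h0 : expE G ((0 : ℝ) • a) • q ∈ (extChartAt 𝓘(ℝ, E) q).source := by
      rw [zero_smul, expE_zero, one_smul]; exact hsrc
    filter_upwards [hcont.eventually_mem ((isOpen_extChartAt_source q).mem_nhds h0)] with s hs
    set g := expE G (s • a) with hg
    have hginv : expE G (-s • a) = g⁻¹ := by rw [neg_smul, expE_neg]
    have hJ : ∀ v, fderiv ℝ (u (-s)) (u s y₀) v =
        c (actE E g⁻¹ (g • q) (chartDs q (extChartAt 𝓘(ℝ, E) q (g • q)) v)) := by
      intro v
      rw [hx0]
      have h1 := fderiv_mapLoc (f := fun p : M => g⁻¹ • p) (r := q) hs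
        (by rw [inv_smul_smul]; exact hsrc) ((contMDiff_act F g⁻¹ _).mdifferentiableAt (by simp)) v
      rw [inv_smul_smul] at h1
      have h2 : u (-s) = mapLoc (fun p : M => g⁻¹ • p) q q := by
        rw [← hginv]
      rw [h2]
      exact h1
    have hJl : ∀ l : E →L[ℝ] ℝ, ((l.comp cs).comp (fderiv ℝ (u (-s)) (u s y₀))).comp
        (chartD E q (g • q)) = l.comp (actE E g⁻¹ (g • q)) := by
      intro l
      ext v
      change l (cs (fderiv ℝ (u (-s)) (u s y₀) (chartD E q (g • q) v))) = l (actE E g⁻¹ (g • q) v)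
      rw [hJ, hcc, chartDs_chartD hs]
    refine ContinuousLinearMap.ext fun l => ?_
    change actE E g⁻¹ (g • q) (tensE P (g • q) (l.comp (actE E g⁻¹ (g • q)))) =
      cs (fderiv ℝ (u (-s)) (u s y₀) (tensLoc P q (u s y₀)
        ((l.comp cs).comp (fderiv ℝ (u (-s)) (u s y₀)))))
    rw [hJ, hcc, tensLoc_apply]
    have hxs : (extChartAt 𝓘(ℝ, E) q).symm (u s y₀) = g • q := by
      rw [hx0]; exact (extChartAt 𝓘(ℝ, E) q).left_inv hs
    rw [hxs, hJl, chartDs_chartD hs]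
  refine (hconj.congr_of_eventuallyEq hev).congr_deriv ?_
  refine ContinuousLinearMap.ext fun l => ?_
  have ht : ∀ m : E →L[ℝ] ℝ, tensLoc P q y₀ m = c (tensE P q (m.comp c)) := fun m => by
    rw [tensLoc_apply, hsymm]
  have hlc : (l.comp cs).comp c = l := by
    ext v
    exact congrArg l (hcc v)
  have hext : (extdBil (localExpr r q) y₀ (c (tensE P q l))).comp c = extdE r q (tensE P q l) := by
    ext v
    exact (extd_eq_extdVec r q (tensE P q l) v).symm
  have hgoal : cs (-(tensLoc P q y₀ (extdBil (localExpr r q) y₀ (tensLoc P q y₀ (l.comp cs))))) =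
      -(tensE P q (extdE r q (tensE P q l))) := by
    rw [ht (l.comp cs), hlc, ht, hext, map_neg, hcc]
  simpa using hgoal

/-- The pull-backs of the Poisson tensor `P` by the flow of the infinitesimal generator
`a_M = P^♯ r` solve a Riccati equation. -/
lemma hasDerivAt_pullTens {P : TwoTensor E M} (hP : IsPoisson P) {r : OneForm E M}
    (hr : SmoothOneForm r) {a : F} (ha : ∀ q, genE (G := G) M a q = P q (r q)) (q : M) (t : ℝ) :
    HasDerivAt (fun s : ℝ => pullTens P (expE G (s • a)) q)
      (-(pullTens P (expE G (t • a)) q).comp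
        ((extdE (pullForm (fun p : M => expE G (t • a) • p) r) q).comp
          (pullTens P (expE G (t • a)) q))) t := by
  set g := expE G (t • a) with hg
  have h0 := hasDerivAt_pullTens_zero hP hr ha (g • q)
  have h1 := ((hasDerivAt_const (0 : ℝ) (actE E g⁻¹ (g • q))).clm_comp (h0.clm_comp
    (hasDerivAt_const (0 : ℝ) ((ContinuousLinearMap.compL ℝ E E ℝ).flip (actE E g⁻¹ (g • q))))))
  have h2 := HasDerivAt.comp_sub_const (x := t) t (by rw [sub_self]; exact h1)
  -- By the group property, the derivative at `t` is the pull-back by `g = exp (t a)` of the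
  -- derivative at `0`.
  have h3 : (fun s : ℝ => pullTens P (expE G (s • a)) q) = fun s : ℝ =>
      (actE E g⁻¹ (g • q)).comp ((pullTens P (expE G ((s - t) • a)) (g • q)).comp
        ((ContinuousLinearMap.compL ℝ E E ℝ).flip (actE E g⁻¹ (g • q)))) := by
    funext s
    rw [← pullTens_mul F, hg, ← expE_add_smul, sub_add_cancel]
  rw [h3]
  refine h2.congr_deriv ?_
  refine ContinuousLinearMap.ext fun l => ?_
  have hpt : ∀ m, pullTens P g q m = actE E g⁻¹ (g • q) (tensE P (g • q)
      (m.comp (actE E g⁻¹ (g • q)))) := fun m => rfl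
  set w := tensE P (g • q) (l.comp (actE E g⁻¹ (g • q))) with hw
  have h4 : (extdE (pullForm (fun p : M => g • p) r) q (pullTens P g q l)).comp
      (actE E g⁻¹ (g • q)) = extdE r (g • q) w := by
    ext x
    have h5 := extd_pullForm hr (contMDiff_act F g q) (pullTens P g q l) (actE E g⁻¹ (g • q) x)
    refine h5.trans ?_
    change extdE r (g • q) (actE E g q _) (actE E g q _) = _
    rw [actE_actE_inv F, hpt, actE_actE_inv F]
  have h6 : pullTens P g q (extdE (pullForm (fun p : M => g • p) r) q (pullTens P g q l)) =
      actE E g⁻¹ (g • q) (tensE P (g • q) (extdE r (g • q) w)) := by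
    rw [hpt, h4]
  have h7 : actE E g⁻¹ (g • q) (-(tensE P (g • q) (extdE r (g • q) w))) =
      -(pullTens P g q (extdE (pullForm (fun p : M => g • p) r) q (pullTens P g q l))) := by
    rw [h6, map_neg]
  simpa using h7

/-- The action maps the characteristic distribution of a Poisson tensor `P` to itself, and changes
the leafwise form by the integral of the exterior derivatives of the forms `Φ_{exp(τa)}^* r`, if
the infinitesimal generator of `a` is `P^♯ r`. -/
lemma graph_smul_mem {P : TwoTensor E M} (hP : IsPoisson P) {r : OneForm E M}
    (hr : SmoothOneForm r) {a : F} (ha : ∀ q, genE (G := G) M a q = P q (r q)) (q : M)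
    (hb : Continuous fun t : ℝ => extdE (pullForm (fun p : M => expE G (t • a) • p) r) q)
    (l : E →L[ℝ] ℝ) :
    actE E (expE G a) q (tensE P q l) = tensE P (expE G a • q)
      ((l + (∫ t in (0 : ℝ)..1, extdE (pullForm (fun p : M => expE G (t • a) • p) r) q)
        (tensE P q l)).comp (actE E (expE G a)⁻¹ (expE G a • q))) := by
  have h1 := riccati_solution hb (hasDerivAt_pullTens hP hr ha q) l
  simp only [zero_smul, expE_zero, one_smul, pullTens_one] at h1
  have h2 := congrArg (actE E (expE G a) q) h1
  rw [← h2]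
  exact actE_actE_inv F _ _ _

end Flow

/-! ### The averaged form and the average -/

section Averaging

open MeasureTheory

variable {E : Type*} [NormedAddCommGroup E] [NormedSpace ℝ E] [FiniteDimensional ℝ E]
  {M : Type*} [TopologicalSpace M] [ChartedSpace E M] [IsManifold 𝓘(ℝ, E) ∞ M]
  {F : Type*} [NormedAddCommGroup F] [NormedSpace ℝ F] [FiniteDimensional ℝ F]
  {G : Type*} [TopologicalSpace G] [ChartedSpace F G] [Group G] [LieGroup 𝓘(ℝ, F) ∞ G]
  [T2Space G] [CompactSpace G] [MeasurableSpace G] [BorelSpace G]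
  [MulAction G M] [ContMDiffSMul 𝓘(ℝ, F) 𝓘(ℝ, E) ∞ G M]

/-- The parameters `(exp (τ a), a)`, `a = log g`, of the integrand of the averaged form. -/
def avgParam (log : G → F) (s : G × ℝ) : G × F := (expE G (s.2 • log s.1), log s.1)

/-- The product of the Haar measure and the Lebesgue measure of the unit interval. -/
def avgMeasure (ν : Measure G) : Measure (G × ℝ) :=
  ν.prod (volume.restrict (Set.Ioc (0 : ℝ) 1))

instance (ν : Measure G) [IsFiniteMeasure ν] : IsFiniteMeasure (avgMeasure ν) := by
  unfold avgMeasure; infer_instance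

variable {ν : Measure G} [IsProbabilityMeasure ν]

lemma aestronglyMeasurable_avgParam {log : G → F} (hlog : AEStronglyMeasurable log ν) :
    AEStronglyMeasurable (avgParam log) (avgMeasure ν) := by
  have h1 : AEStronglyMeasurable (fun s : G × ℝ => log s.1) (avgMeasure ν) := hlog.comp_fst
  have h2 : AEStronglyMeasurable (fun s : G × ℝ => s.2) (avgMeasure ν) :=
    measurable_snd.aestronglyMeasurable
  exact ((continuous_expE F G).comp_aestronglyMeasurable (h2.smul h1)).prodMk h1

lemma avgParam_mem {log : G → F} {K : Set F} (h : ∀ g, log g ∈ K) (s : G × ℝ) :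
    avgParam log s ∈ (Set.univ ×ˢ K : Set (G × F)) := ⟨trivial, h _⟩

variable {ρ : F →ₗ[ℝ] OneForm E M} {log : G → F} {K : Set F}

/-- In a chart, the averaged form is a parametric integral. -/
lemma localExpr_averagedForm (hρ : ∀ a, SmoothOneForm (ρ a)) (hlog : AEStronglyMeasurable log ν)
    (hK : IsCompact K) (hlK : ∀ g, log g ∈ K) {q : M} {y : E}
    (hy : y ∈ (extChartAt 𝓘(ℝ, E) q).target) :
    localExpr (averagedForm ν log ρ) q y =
      ∫ s, localExpr (pullForm (fun p : M => (avgParam log s).1 • p) (ρ (avgParam log s).2)) q y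
        ∂(avgMeasure ν) := by
  set p : M := (extChartAt 𝓘(ℝ, E) q).symm y with hp
  have hps : p ∈ (extChartAt 𝓘(ℝ, E) q).source := (extChartAt 𝓘(ℝ, E) q).map_target hy
  have hyp : extChartAt 𝓘(ℝ, E) q p = y := (extChartAt 𝓘(ℝ, E) q).right_inv hy
  let T : (E →L[ℝ] ℝ) →L[ℝ] (E →L[ℝ] ℝ) := (ContinuousLinearMap.compL ℝ E E ℝ).flip (chartD E q p)
  let Ts : (E →L[ℝ] ℝ) →L[ℝ] (E →L[ℝ] ℝ) := (ContinuousLinearMap.compL ℝ E E ℝ).flip (chartDs q y)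
  have hloc : ∀ α : OneForm E M, localExpr α q y = Ts (covE α p) := fun α => rfl
  have hcov : ∀ α : OneForm E M, covE α p = T (localExpr α q y) := fun α => by
    ext v
    have := oneForm_eq_localExpr α hps v
    rw [hyp] at this
    exact this
  have hint : Integrable (fun s => localExpr (pullForm (fun p : M => (avgParam log s).1 • p)
      (ρ (avgParam log s).2)) q y) (avgMeasure ν) :=
    integrable_of_contMDiffOn (contMDiffOn_localExpr_pullForm_family (F := F) (G := G) hρ q)
      (aestronglyMeasurable_avgParam hlog) (isCompact_univ.prod hK) (avgParam_mem hlK) hy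
  have hint' : Integrable (fun s => covE (pullForm (fun p : M => (avgParam log s).1 • p)
      (ρ (avgParam log s).2)) p) (avgMeasure ν) := by
    simp_rw [hcov]
    exact T.integrable_comp hint
  have h1 : covE (averagedForm ν log ρ) p =
      ∫ s, covE (pullForm (fun p : M => (avgParam log s).1 • p) (ρ (avgParam log s).2)) p
        ∂(avgMeasure ν) := by
    rw [avgMeasure, integral_prod _ hint']
    refine integral_congr_ae (Filter.Eventually.of_forall fun g => ?_)
    exact intervalIntegral.integral_of_le zero_le_one
  rw [hloc, h1, ← Ts.integral_comp_comm hint']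
  rfl

/-- The averaged form is smooth. -/
lemma smoothOneForm_averagedForm (hρ : ∀ a, SmoothOneForm (ρ a))
    (hlog : AEStronglyMeasurable log ν) (hK : IsCompact K) (hlK : ∀ g, log g ∈ K) :
    SmoothOneForm (averagedForm (M := M) ν log ρ) := by
  refine smoothOneForm_of_center fun q => ?_
  have h1 := (contDiffOn_integral_of_contMDiffOn (isOpen_extChartAt_target q)
      (contMDiffOn_localExpr_pullForm_family (F := F) (G := G) hρ q)
      (aestronglyMeasurable_avgParam hlog) (isCompact_univ.prod hK)
      (avgParam_mem hlK)).contDiffAt (target_mem_nhds (E := E) q)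
  refine (contDiffAt_congr_nhds ?_).2 h1
  filter_upwards [target_mem_nhds (E := E) q] with y hy
  exact localExpr_averagedForm hρ hlog hK hlK hy

/-- The exterior derivative of the averaged form is the average of the exterior derivatives of the
forms `Φ_{exp(τa)}^* ρ_a`. -/
lemma extdE_averagedForm (hρ : ∀ a, SmoothOneForm (ρ a)) (hlog : AEStronglyMeasurable log ν)
    (hK : IsCompact K) (hlK : ∀ g, log g ∈ K) (q : M) :
    Integrable (fun g => ∫ t in (0 : ℝ)..1,
      extdE (pullForm (fun p : M => expE G (t • log g) • p) (ρ (log g))) q) ν ∧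
    extdE (averagedForm ν log ρ) q = ∫ g, (∫ t in (0 : ℝ)..1,
      extdE (pullForm (fun p : M => expE G (t • log g) • p) (ρ (log g))) q) ∂ν := by
  have hint := (extdOp q).integrable_comp (integrable_fderiv_of_contMDiffOn
    (isOpen_extChartAt_target q) (contMDiffOn_localExpr_pullForm_family (F := F) (G := G) hρ q)
    (aestronglyMeasurable_avgParam hlog) (isCompact_univ.prod hK) (avgParam_mem hlK)
    (mem_extChartAt_target q))
  have hI : ∀ g, (∫ t in (0 : ℝ)..1,
      extdE (pullForm (fun p : M => expE G (t • log g) • p) (ρ (log g))) q) =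
      ∫ t in Set.Ioc (0 : ℝ) 1, extdOp q (fderiv ℝ (localExpr (pullForm
        (fun p : M => (avgParam log (g, t)).1 • p) (ρ (avgParam log (g, t)).2)) q)
          (extChartAt 𝓘(ℝ, E) q q)) := fun g =>
    intervalIntegral.integral_of_le zero_le_one
  simp_rw [hI]
  refine ⟨hint.integral_prod_left, ?_⟩
  have h1 := integral_prod _ hint
  refine Eq.trans ?_ h1
  have h2 := hasFDerivAt_integral_of_contMDiffOn (isOpen_extChartAt_target q)
    (contMDiffOn_localExpr_pullForm_family (F := F) (G := G) hρ q)
    (aestronglyMeasurable_avgParam hlog) (isCompact_univ.prod hK) (avgParam_mem hlK)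
    (mem_extChartAt_target q)
  have h3 : localExpr (averagedForm ν log ρ) q =ᶠ[𝓝 (extChartAt 𝓘(ℝ, E) q q)] fun y =>
      ∫ s, localExpr (pullForm (fun p : M => (avgParam log s).1 • p) (ρ (avgParam log s).2)) q y
        ∂(avgMeasure ν) := by
    filter_upwards [target_mem_nhds (E := E) q] with y hy
    exact localExpr_averagedForm hρ hlog hK hlK hy
  rw [extdE_eq_extdOp, h3.fderiv_eq, h2.fderiv]
  refine ((extdOp q).integral_comp_comm ?_).symm
  exact integrable_fderiv_of_contMDiffOn
    (isOpen_extChartAt_target q) (contMDiffOn_localExpr_pullForm_family (F := F) (G := G) hρ q)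
    (aestronglyMeasurable_avgParam hlog) (isCompact_univ.prod hK) (avgParam_mem hlK)
    (mem_extChartAt_target q)

end Averaging

section Average

open MeasureTheory

variable {E : Type*} [NormedAddCommGroup E] [NormedSpace ℝ E] [FiniteDimensional ℝ E]
  {M : Type*} [TopologicalSpace M] [ChartedSpace E M] [IsManifold 𝓘(ℝ, E) ∞ M]
  [T2Space M]
  {F : Type*} [NormedAddCommGroup F] [NormedSpace ℝ F] [FiniteDimensional ℝ F]
  {G : Type*} [TopologicalSpace G] [ChartedSpace F G] [Group G] [LieGroup 𝓘(ℝ, F) ∞ G]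
  [T2Space G] [CompactSpace G] [MeasurableSpace G] [BorelSpace G]
  [MulAction G M] [ContMDiffSMul 𝓘(ℝ, F) 𝓘(ℝ, E) ∞ G M]
  {ν : Measure G}

omit [T2Space G] [CompactSpace G] [BorelSpace G] in
/-- Averages are unique. -/
lemma IsAverage.eq {D D₁ D₂ : GenDistribution E M} (h₁ : IsAverage ν D D₁)
    (h₂ : IsAverage ν D D₂) : D₁ = D₂ := by
  refine h₁.isDirac.ext h₂.isDirac (h₁.charDist_eq.trans h₂.charDist_eq.symm)
    fun q X hX Y hY => ?_
  rw [h₁.charDist_eq] at hX hY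
  rw [h₁.leafForm_eq q X hX Y hY, h₂.leafForm_eq q X hX Y hY]

variable (F) in
include F in
/-- A compact group is unimodular: right translates of the normalized Haar measure are normalized
Haar measures. -/
lemma isMulRightInvariant_of_compactSpace (ν : Measure G) [ν.IsHaarMeasure]
    [IsProbabilityMeasure ν] : ν.IsMulRightInvariant := by
  have : IsTopologicalGroup G := topologicalGroup_of_lieGroup 𝓘(ℝ, F) ∞
  have : SecondCountableTopology G := ChartedSpace.secondCountable_of_sigmaCompact F G
  refine ⟨fun g => ?_⟩
  have : IsProbabilityMeasure (ν.map (· * g)) :=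
    Measure.isProbabilityMeasure_map (measurable_mul_const g).aemeasurable
  exact Measure.isHaarMeasure_eq_of_isProbabilityMeasure _ _

variable (F) in
include F in
/-- Averages are invariant. -/
lemma IsAverage.isInvariant [ν.IsHaarMeasure] [IsProbabilityMeasure ν]
    {D D' : GenDistribution E M} (h : IsAverage ν D D') : IsInvariant G D' := by
  intro g q X α
  have : IsTopologicalGroup G := topologicalGroup_of_lieGroup 𝓘(ℝ, F) ∞
  have : SecondCountableTopology G := ChartedSpace.secondCountable_of_sigmaCompact F G
  have : ν.IsMulRightInvariant := isMulRightInvariant_of_compactSpace F ν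
  have hC : charDist D' = charDist D := h.charDist_eq
  have hmul : ∀ (k : G) (Z : E), actE E k (g • q) (actE E g q Z) = actE E (k * g) q Z :=
    fun k Z => by rw [actE_mul F]; rfl
  have hcov : ∀ k : G, k • g • q = (k * g) • q := fun k => (mul_smul k g q).symm
  have hform : ∀ X ∈ charDist D q, ∀ Y ∈ charDist D q,
      leafForm D' (g • q) (dact E g q X) (dact E g q Y) = leafForm D' q X Y := by
    intro X hX Y hY
    rw [h.leafForm_eq (g • q) _ (h.charDist_map g q X hX) _ (h.charDist_map g q Y hY),
      h.leafForm_eq q X hX Y hY]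
    -- The average is invariant on the leaves, by the right-invariance of the Haar measure.
    rw [← integral_mul_right_eq_self (μ := ν)
      (fun k => leafForm D (k • q) (dact E k q X) (dact E k q Y)) g]
    refine integral_congr_ae (Filter.Eventually.of_forall fun k => ?_)
    have hlf : ∀ (p p' : M) (A B : E), p = p' →
        leafForm (E := E) D p A B = leafForm (E := E) D p' A B := by
      rintro p _ A B rfl; rfl
    refine (hlf _ _ _ _ (hcov k)).trans ?_
    exact congrArg₂ (fun A B : E => leafForm (E := E) D ((k * g) • q) A B) (hmul k X) (hmul k Y)
  have hmem : ∀ Z : E, Z ∈ charDist (E := E) D q ↔ actE E g q Z ∈ charDist (E := E) D (g • q) := by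
    intro Z
    refine ⟨fun hZ => h.charDist_map g q Z hZ, fun hZ => ?_⟩
    have h1 := h.charDist_map g⁻¹ (g • q) _ hZ
    have h2 : ∀ (p p' : M) (A B : E), p = p' → A = B →
        A ∈ charDist (E := E) D p → B ∈ charDist (E := E) D p' := by
      rintro p _ A _ rfl rfl hA; exact hA
    exact h2 _ _ _ _ (inv_smul_smul g q) (actE_inv_actE F g q Z) h1
  rw [h.isDirac.mem_iff, h.isDirac.mem_iff, hC]
  constructor
  · rintro ⟨hX, hα⟩
    refine ⟨(hmem X).1 hX, fun (Z : E) hZ => ?_⟩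
    have hsurj : actE E g q (actE E g⁻¹ (g • q) Z) = Z := actE_actE_inv F g q Z
    have hZ' : actE E g⁻¹ (g • q) Z ∈ charDist (E := E) D q := by
      rw [hmem, hsurj]; exact hZ
    have h1 := hα _ hZ'
    rw [← hform X hX _ hZ'] at h1
    have h2 : ∀ A B : E, A = B → (α : E →L[ℝ] ℝ) A = - leafForm (E := E) D' (g • q) (dact E g q X) A →
        (α : E →L[ℝ] ℝ) B = - leafForm (E := E) D' (g • q) (dact E g q X) B := by
      rintro A _ rfl hA; exact hA
    exact h2 _ _ hsurj h1
  · rintro ⟨hX, hα⟩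
    have hX' := (hmem X).2 hX
    refine ⟨hX', fun Y hY => ?_⟩
    rw [← hform X hX' Y hY]
    exact hα _ ((hmem Y).1 hY)

variable {P : TwoTensor E M} {ρ : F →ₗ[ℝ] OneForm E M} {log : G → F} {K : Set F}

/-- The leafwise form of `Graph P` at `g • q`, pulled back by the action of `g = exp a`. -/
lemma leafForm_graph_smul (hP : IsPoisson P) (hρ : ∀ a, SmoothOneForm (ρ a))
    (hgen : ∀ (a : F) (q : M), genE (G := G) M a q = P q (ρ a q)) (a : F) (q : M)
    (l : E →L[ℝ] ℝ) :
    actE E (expE G a) q (tensE P q l) ∈ charDist (E := E) (graph P) (expE G a • q) ∧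
    ∀ m : E →L[ℝ] ℝ, leafForm (E := E) (graph P) (expE G a • q) (actE E (expE G a) q (tensE P q l))
      (actE E (expE G a) q (tensE P q m)) = - (l (tensE P q m)
        + (∫ t in (0 : ℝ)..1, extdE (pullForm (fun p : M => expE G (t • a) • p) (ρ a)) q)
          (tensE P q l) (tensE P q m)) := by
  have hb : Continuous fun t : ℝ =>
      extdE (pullForm (fun p : M => expE G (t • a) • p) (ρ a)) q :=
    (continuous_extdE_pullForm (F := F) (G := G) hρ q).comp
      (f := fun t : ℝ => ((expE G (t • a), a) : G × F))
      (((continuous_expE F G).comp (by fun_prop : Continuous fun t : ℝ => t • a)).prodMk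
        continuous_const)
  have hmem := fun l => graph_smul_mem hP (hρ a) (hgen a) q hb l
  have hC : ∀ l, actE E (expE G a) q (tensE P q l) ∈
      charDist (E := E) (graph P) (expE G a • q) := fun l => ⟨(_, _), mem_graph.2 (hmem l), rfl⟩
  refine ⟨hC l, fun m => ?_⟩
  have h1 := hP.isDirac_graph.leafForm_eq (mem_graph.2 (hmem l)) (hC m)
  refine h1.trans ?_
  exact congrArg Neg.neg (congrArg
    (l + (∫ t in (0 : ℝ)..1, extdE (pullForm (fun p : M => expE G (t • a) • p) (ρ a)) q)
      (tensE P q l)) (actE_inv_actE F (expE G a) q (tensE P q m)))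

/-- The exact gauge transform of `Graph P` by the averaged form is an average of `Graph P`. -/
theorem isAverage_exactGauge [IsProbabilityMeasure ν] (hP : IsPoisson P)
    (hρ : ∀ a, SmoothOneForm (ρ a))
    (hgen : ∀ (a : F) (q : M), genE (G := G) M a q = P q (ρ a q))
    (hlog : AEStronglyMeasurable log ν) (hK : IsCompact K) (hlK : ∀ g, log g ∈ K)
    (hexp : ∀ g, expE G (log g) = g) :
    IsAverage ν (graph P) (exactGauge (graph P) (averagedForm ν log ρ)) := by
  have hΘ : SmoothOneForm (averagedForm (M := M) ν log ρ) :=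
    smoothOneForm_averagedForm hρ hlog hK hlK
  have hD := hP.isDirac_graph
  have hC : ∀ (q : M) (X : E), X ∈ charDist (E := E) (graph P) q ↔
      ∃ l : E →L[ℝ] ℝ, tensE P q l = X := by
    intro q X
    constructor
    · rintro ⟨⟨Y, l⟩, hl, rfl⟩
      exact ⟨l, (mem_graph.1 hl).symm⟩
    · rintro ⟨l, rfl⟩
      exact ⟨(_, l), mem_graph.2 rfl, rfl⟩
  have hCeq : charDist (exactGauge (graph P) (averagedForm ν log ρ)) = charDist (graph P) := by
    funext q
    ext X
    constructor
    · rintro ⟨⟨Y, l⟩, hl, rfl⟩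
      exact ⟨(Y, _), mem_exactGauge.1 hl, rfl⟩
    · rintro ⟨⟨Y, l⟩, hl, rfl⟩
      refine ⟨(Y, l + extd (averagedForm ν log ρ) q Y), mem_exactGauge.2 ?_, rfl⟩
      rw [add_sub_cancel_right]
      exact hl
  -- The action of `g` changes the leafwise form by `- B q g`, and the average of `B` is `dΘ`.
  let B : M → G → E →L[ℝ] E →L[ℝ] ℝ := fun q g => ∫ t in (0 : ℝ)..1,
    extdE (pullForm (fun p : M => expE G (t • log g) • p) (ρ (log g))) q
  have hB : ∀ q, Integrable (B q) ν ∧ extdE (averagedForm ν log ρ) q = ∫ g, B q g ∂ν :=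
    fun q => extdE_averagedForm hρ hlog hK hlK q
  have hform : ∀ (q : M) (l m : E →L[ℝ] ℝ) (g : G),
      leafForm (E := E) (graph P) (g • q) (actE E g q (tensE P q l)) (actE E g q (tensE P q m)) =
        - (l (tensE P q m) + B q g (tensE P q l) (tensE P q m)) := by
    intro q l m g
    have h1 := (leafForm_graph_smul (G := G) hP hρ hgen (log g) q l).2 m
    rw [hexp] at h1
    exact h1
  have hBXY : ∀ (q : M) (X Y : E), Integrable (fun g => B q g X Y) ν := fun q X Y =>
    ((hB q).1.apply_continuousLinearMap X).apply_continuousLinearMap Y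
  refine ⟨hD.exactGauge hΘ, hCeq, ?_, ?_, ?_⟩
  · intro g q X hX
    obtain ⟨l, rfl⟩ := (hC q X).1 hX
    have h1 := (leafForm_graph_smul (G := G) hP hρ hgen (log g) q l).1
    rw [hexp] at h1
    exact h1
  · intro q X hX Y hY
    obtain ⟨l, rfl⟩ := (hC q X).1 hX
    obtain ⟨m, rfl⟩ := (hC q Y).1 hY
    refine Integrable.congr (f := fun g => - (l (tensE P q m) +
      B q g (tensE P q l) (tensE P q m))) ?_
      (Filter.Eventually.of_forall fun g => (hform q l m g).symm)
    exact ((integrable_const _).add (hBXY q _ _)).neg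
  · intro q X hX Y hY
    obtain ⟨l, rfl⟩ := (hC q X).1 hX
    obtain ⟨m, rfl⟩ := (hC q Y).1 hY
    have h1 : (∫ g, leafForm (E := E) (graph P) (g • q) (actE E g q (tensE P q l))
        (actE E g q (tensE P q m)) ∂ν) =
        ∫ g, - (l (tensE P q m) + B q g (tensE P q l) (tensE P q m)) ∂ν :=
      integral_congr_ae (Filter.Eventually.of_forall fun g => hform q l m g)
    refine Eq.trans ?_ h1.symm
    rw [integral_neg, integral_add (integrable_const _) (hBXY q _ _), integral_const,
      probReal_univ, one_smul,
      ← ContinuousLinearMap.integral_apply ((hB q).1.apply_continuousLinearMap _),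
      ← ContinuousLinearMap.integral_apply (hB q).1, ← (hB q).2]
    have h2 : ((tensE P q l : Tan E q), (l + extdE (averagedForm ν log ρ) q (tensE P q l) : Cot E q)) ∈
        exactGauge (graph P) (averagedForm ν log ρ) q := by
      refine mem_exactGauge.2 (mem_graph.2 ?_)
      have h4 : l + extdE (averagedForm ν log ρ) q (tensE P q l)
          - extdE (averagedForm ν log ρ) q (tensE P q l) = l := add_sub_cancel_right _ _
      exact (congrArg (tensE P q) h4).symm
    have h3 := (hD.exactGauge hΘ).leafForm_eq h2 (by rw [hCeq]; exact hY)
    exact h3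

end Average

end DiracAveraging

end

theorem theorem4p1
    -- the compact connected Lie group `G`, with normalized Haar measure `ν`
    {F : Type*} [NormedAddCommGroup F] [NormedSpace ℝ F] [FiniteDimensional ℝ F]
    {G : Type*} [TopologicalSpace G] [ChartedSpace F G] [Group G] [LieGroup 𝓘(ℝ, F) ∞ G]
    [T2Space G] [CompactSpace G] [ConnectedSpace G] [MeasurableSpace G] [BorelSpace G]
    (ν : MeasureTheory.Measure G) [ν.IsHaarMeasure] [MeasureTheory.IsProbabilityMeasure ν]
    -- the manifold `M` with its smooth `G`-action
    {E : Type*} [NormedAddCommGroup E] [NormedSpace ℝ E] [FiniteDimensional ℝ E]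
    {M : Type*} [TopologicalSpace M] [ChartedSpace E M] [IsManifold 𝓘(ℝ, E) ∞ M]
    [T2Space M] [SecondCountableTopology M]
    [MulAction G M] [ContMDiffSMul 𝓘(ℝ, F) 𝓘(ℝ, E) ∞ G M]
    -- the foliation, the leaf-tangent Poisson structure, the normal bundle and the deformation
    (V H : DiracAveraging.Distribution E M) (P : DiracAveraging.TwoTensor E M)
    (Pi : ℝ → DiracAveraging.TwoTensor E M)
    (hV : DiracAveraging.IsFoliation V) (hP : DiracAveraging.IsLeafTangentPoisson V P)
    (hH : DiracAveraging.IsNormalBundle V H)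
    (hPi : DiracAveraging.IsAlmostCouplingDeformation V H P Pi)
    -- compatibility of the action with `P`
    (μ : GroupLieAlgebra 𝓘(ℝ, F) G →ₗ[ℝ] DiracAveraging.OneForm E M)
    (hμ : ∀ a, DiracAveraging.SmoothOneForm (μ a))
    (hμP : ∀ a, ∀ q : M, DiracAveraging.infGen E M a q = P q (μ a q)) :
    -- the integral defining `Θ` makes sense
    (∃ log : G → GroupLieAlgebra 𝓘(ℝ, F) G, DiracAveraging.IsLogarithm ν log) ∧
    ∀ ε ∈ Set.Icc (0 : ℝ) 1,
      DiracAveraging.IsDirac (DiracAveraging.graph (Pi ε)) ∧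
      DiracAveraging.IsCompatible (DiracAveraging.graph (Pi ε))
        (DiracAveraging.comp01 hH.isCompl μ) ∧
      (∃! D' : DiracAveraging.GenDistribution E M,
        DiracAveraging.IsAverage ν (DiracAveraging.graph (Pi ε)) D') ∧
      ∀ log : G → GroupLieAlgebra 𝓘(ℝ, F) G, DiracAveraging.IsLogarithm ν log →
        DiracAveraging.SmoothOneForm
          (DiracAveraging.averagedForm (E := E) (M := M) ν log
            (DiracAveraging.comp01 hH.isCompl μ)) ∧
        DiracAveraging.IsAverage ν (DiracAveraging.graph (Pi ε))
          (DiracAveraging.exactGauge (DiracAveraging.graph (Pi ε))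
            (DiracAveraging.averagedForm ν log (DiracAveraging.comp01 hH.isCompl μ))) ∧
        DiracAveraging.IsInvariant G
          (DiracAveraging.exactGauge (DiracAveraging.graph (Pi ε))
            (DiracAveraging.averagedForm ν log (DiracAveraging.comp01 hH.isCompl μ))) := by
  obtain ⟨log₀, hlog₀⟩ := DiracAveraging.exists_isLogarithm F ν
  refine ⟨⟨log₀, hlog₀⟩, fun ε hε => ?_⟩
  have hPε := hPi.isPoisson ε hε
  -- the forms `ρ_a`, with `a` in the model space of the group
  let ρ : F →ₗ[ℝ] DiracAveraging.OneForm E M := DiracAveraging.comp01 hH.isCompl μ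
  have hρ : ∀ a, DiracAveraging.SmoothOneForm (ρ a) := fun a =>
    (hμ a).projForm hV.toIsSubbundle hH.toIsSubbundle hH.isCompl
  have hgen : ∀ (a : F) (q : M), DiracAveraging.genE (G := G) M a q = Pi ε q (ρ a q) :=
    fun a q => (hμP a q).trans (hPi.apply_projForm hP hH.isCompl hε (μ a) q).symm
  have havg : ∀ log : G → GroupLieAlgebra 𝓘(ℝ, F) G, DiracAveraging.IsLogarithm ν log →
      DiracAveraging.IsAverage ν (DiracAveraging.graph (Pi ε))
        (DiracAveraging.exactGauge (DiracAveraging.graph (Pi ε))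
          (DiracAveraging.averagedForm ν log (DiracAveraging.comp01 hH.isCompl μ))) := by
    intro log hlog
    obtain ⟨K, hK, hlK⟩ := hlog.bounded
    exact DiracAveraging.isAverage_exactGauge (F := F) hPε hρ hgen hlog.measurable hK hlK
      hlog.exp_log
  refine ⟨hPε.isDirac_graph, ?_, ⟨_, havg log₀ hlog₀, fun D' hD' => hD'.eq (havg log₀ hlog₀)⟩,
    fun log hlog => ⟨?_, havg log hlog, (havg log hlog).isInvariant F⟩⟩
  · refine DiracAveraging.isCompatible_of_isSection (fun g => ⟨log₀ g, hlog₀.exp_log g⟩)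
      fun a => ⟨?_, hρ a, fun q => DiracAveraging.mem_graph.2 (hgen a q)⟩
    have h : DiracAveraging.infGen E M a = DiracAveraging.sharp (Pi ε) (ρ a) := funext (hgen a)
    rw [h]
    exact hPε.smooth _ (hρ a)
  · obtain ⟨K, hK, hlK⟩ := hlog.bounded
    exact DiracAveraging.smoothOneForm_averagedForm (F := F) hρ hlog.measurable hK hlK
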